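/- Let $dA$ be Lebesgue measure on $\mathbb C$ and normalise $dd^c$ by $dd^c\log|z|^2=\delta_0$, so $dd^cu=\frac1{4\pi}\Delta u\,dA$. Let $\kappa:\mathbb C\to(0,\infty)$ be $C^\infty$ and such that, for every $z\in\mathbb C$, the function $\zeta\mapsto\log|z-\zeta|^2/\kappa(\zeta)$ is integrable on $\mathbb C$. Put $$\phi(z)=\int_{\mathbb C}\log|z-\zeta|^2\,\frac{dA_\zeta}{\kappa(\zeta)}-\log(1+|z|^2),\qquad \omega=dd^c\log(1+|z|^2),\qquad \omega_\phi=\omega+dd^c\phi .$$ Let $\{\Omega_t\}_{t\in(0,b)}$ be a strictly increasing family of bounded simply connected domains in $\mathbb C$ containing $0$, with smooth boundaries varying smoothly with $t$ (for $t$ near $t_0$, $\partial\Omega_t$ lies near $\partial\Omega_{t_0}$, and near each point of $\partial\Omega_{t_0}$ the domain $\Omega_t$ is, in suitable Euclidean coordinates, the region on one side of the graph of a function depending smoothly on position and on $t$). Suppose that $\Omega_t$ tends to $\{0\}$ as $t\to0$, i.e. for every neighbourhood $U$ of $0$ one has $\Omega_t\subset U$ for all sufficiently small $t>0$. Suppose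 moreover that $\{\Omega_t\}$ is the strong Hele-Shaw flow with permeability $\kappa$: for every $t\in(0,b)$, $$V_t=-\kappa\nabla p_t\quad\text{on }\partial\Omega_t,$$ where $V_t$ is the (outward) normal velocity of $\partial\Omega_t$ and $p_t$ is the function on $\overline{\Omega_t}\setminus\{0\}$ with $\Delta p_t=-\delta_0$ in $\Omega_t$ and $p_t=0$ on $\partial\Omega_t$. Then $\{\Omega_t\}_{t\in(0,b)}$ is the (weak) Hele-Shaw flow on $\mathbb C$ with respect to $\omega_\phi$. That is, $\phi$ is $C^\infty$, $\omega_\phi$ is a Kähler form, $b\le\int_{\mathbb C}\omega_\phi$, and for every $t\in(0,b)$ $$\Omega_t=\{z\in\mathbb C:\psi_t(z)<\phi(z)\},$$ where $\psi_t$ is the pointwise supremum of all upper semicontinuous $\psi:\mathbb C\to\mathbb R\cup\{-\infty\}$ such that $\psi\le\phi$, $\omega+dd^c\psi\ge0$ (i.e. $\psi+\log(1+|z|^2)$ is subharmonic), and $\psi(z)\le t\log|z|^2+O(1)$ near $0$. -/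

import Mathlib

open Set Filter Topology MeasureTheory
open scoped ContDiff

noncomputable section

namespace HeleShaw

/-! ### Envelopes and the (weak) Hele-Shaw flow on `X = ℂ` with origin `0`

A Kähler form `ω` on `ℂ` is given through a global potential `g`, that is `ω = dd^c g`. -/

/-- The density with respect to Lebesgue measure of `dd^c u`, normalised by
`dd^c log |z|² = δ₀`; thus `dd^c u = (1 / 4π) Δu dA`. -/
def ddcDensity (u : ℂ → ℝ) (z : ℂ) : ℝ :=
  (1 / (4 * Real.pi)) * Laplacian.laplacian u z

/-- Subharmonic functions `ℂ → [-∞, ∞)`: upper semicontinuous functions such that on each compact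
set `K`, each continuous function on `K` that is harmonic inside `K` and majorizes `u` on the
boundary of `K` majorizes `u` on `K`. The constant `-∞` is allowed. -/
structure IsSubharmonic (u : ℂ → EReal) : Prop where
  usc : UpperSemicontinuous u
  lt_top : ∀ z, u z < ⊤
  le_of_le_frontier : ∀ (K : Set ℂ) (h : ℂ → ℝ), IsCompact K → ContinuousOn h K →
    InnerProductSpace.HarmonicOnNhd h (interior K) →
    (∀ z ∈ frontier K, u z ≤ (h z : EReal)) → ∀ z ∈ K, u z ≤ (h z : EReal)

/-- `ν₀(ψ) ≥ t`: `ψ(z) ≤ t log |z|² + O(1)` near the origin. -/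
def LelongGE (ψ : ℂ → EReal) (t : ℝ) : Prop :=
  ∃ C : ℝ, ∀ᶠ z in 𝓝[≠] (0 : ℂ), ψ z ≤ ((t * Real.log (‖z‖ ^ 2) + C : ℝ) : EReal)

/-- The competitors `ψ` in the envelope at time `t`: `ψ` is usc, `ψ ≤ φ`, `ω + dd^c ψ ≥ 0`
(that is `g + ψ` is subharmonic, where `ω = dd^c g`) and `ν₀(ψ) ≥ t`. -/
structure IsCandidate (g φ : ℂ → ℝ) (t : ℝ) (ψ : ℂ → EReal) : Prop where
  usc : UpperSemicontinuous ψ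
  le : ∀ z, ψ z ≤ (φ z : EReal)
  subharmonic : IsSubharmonic fun z => (g z : EReal) + ψ z
  lelong : LelongGE ψ t

/-- The Hele-Shaw envelope `ψ_t`, the pointwise supremum of all candidates. -/
def envelope (g φ : ℂ → ℝ) (t : ℝ) (z : ℂ) : EReal :=
  ⨆ (ψ : ℂ → EReal) (_ : IsCandidate g φ t ψ), ψ z

/-- The Hele-Shaw domain `{ψ_t < φ}`. -/
def domain (g φ : ℂ → ℝ) (t : ℝ) : Set ℂ :=
  {z | envelope g φ t z < (φ z : EReal)}

/-- `{Ω_t}`, `t ∈ (0, b)`, is the (weak) Hele-Shaw flow for `ω_φ = dd^c (g + φ)`: the potential `φ`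
is smooth, `ω_φ` is a Kähler form, `b` does not exceed the total area of `ω_φ`, and
`Ω_t = {ψ_t < φ}` for all `t ∈ (0, b)`. -/
structure IsHeleShawFlow (g φ : ℂ → ℝ) (Ω : ℝ → Set ℂ) (b : ℝ) : Prop where
  smooth : ContDiff ℝ ∞ φ
  kahler : ∀ z, 0 < ddcDensity (fun w => g w + φ w) z
  time_le : ENNReal.ofReal b ≤ ∫⁻ z : ℂ, ENNReal.ofReal (ddcDensity (fun w => g w + φ w) z)
  eq_domain : ∀ t ∈ Ioo 0 b, Ω t = domain g φ t

/-- The potential `log (1 + |z|²)` of the Fubini-Study form. -/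
def fsPotential (z : ℂ) : ℝ := Real.log (1 + ‖z‖ ^ 2)

/-- `φ(z) = ∫ log |z - ζ|² dA_ζ / κ(ζ) - log (1 + |z|²)`. -/
def potential (κ : ℂ → ℝ) (z : ℂ) : ℝ :=
  (∫ ζ : ℂ, Real.log (‖z - ζ‖ ^ 2) / κ ζ) - Real.log (1 + ‖z‖ ^ 2)

/-! ### The strong Hele-Shaw flow -/

/-- A smoothly varying family of bounded open sets with smooth boundary: near each boundary point
`x₀` of `Ω_{t₀}`, and for `t` near `t₀`, in suitable rotated Euclidean coordinates `(p, q)` centred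
at `x₀` the set `Ω_t` is the subgraph `q < γ(p, t)` of a function `γ` smooth in `(p, t)`; moreover
for `t` near `t₀` the boundary of `Ω_t` lies near that of `Ω_{t₀}`. -/
structure IsSmoothFamily (Ω : ℝ → Set ℂ) (a b : ℝ) : Prop where
  isOpen : ∀ t ∈ Ioo a b, IsOpen (Ω t)
  isBounded : ∀ t ∈ Ioo a b, Bornology.IsBounded (Ω t)
  local_graph : ∀ t₀ ∈ Ioo a b, ∀ x₀ ∈ frontier (Ω t₀),
    ∃ (u : ℂ) (γ : ℝ × ℝ → ℝ) (ε : ℝ), ‖u‖ = 1 ∧ 0 < ε ∧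
      ContDiffOn ℝ ∞ γ (Ioo (-ε) ε ×ˢ Ioo (t₀ - ε) (t₀ + ε)) ∧
      ∀ p ∈ Ioo (-ε) ε, ∀ q ∈ Ioo (-ε) ε, ∀ t ∈ Ioo (t₀ - ε) (t₀ + ε),
        (x₀ + ((p : ℂ) + (q : ℂ) * Complex.I) * u ∈ Ω t ↔ q < γ (p, t))
  frontier_near : ∀ t₀ ∈ Ioo a b, ∀ U : Set ℂ, IsOpen U → frontier (Ω t₀) ⊆ U →
    ∀ᶠ t in 𝓝 t₀, frontier (Ω t) ⊆ U

/-- `n` is the outward unit normal of `D` at the boundary point `x`. (For `D` with smooth boundary,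
locally on one side of it, this determines `n`.) -/
structure IsOutwardUnitNormal (D : Set ℂ) (x n : ℂ) : Prop where
  norm_eq : ‖n‖ = 1
  inward : ∀ v : ℂ, inner ℝ v n < 0 → ∀ᶠ s : ℝ in 𝓝[>] 0, x + s • v ∈ D
  outward : ∀ v : ℂ, 0 < inner ℝ v n → ∀ᶠ s : ℝ in 𝓝[>] 0, x + s • v ∉ D

/-- `V` is the normal velocity of `∂Ω_{t₀}` at the boundary point `x`: if `n` is the outward unit
normal at `x` and `∂Ω_t` meets the normal line in `x + f(t) n` for `t` near `t₀`, `f(t₀) = 0`,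
then `V = f'(t₀) n`. -/
def HasNormalVelocity (Ω : ℝ → Set ℂ) (t₀ : ℝ) (x V : ℂ) : Prop :=
  ∃ (n : ℂ) (f : ℝ → ℝ) (v : ℝ), IsOutwardUnitNormal (Ω t₀) x n ∧ f t₀ = 0 ∧
    (∀ᶠ t in 𝓝 t₀, x + f t • n ∈ frontier (Ω t)) ∧ HasDerivAt f v t₀ ∧ V = v • n

/-- `p` is the Green potential of the bounded domain `D ∋ 0`: `Δp = -δ₀` in `D` (that is, `p` is
`-(1/2π) log |z|` plus a harmonic function on `D`) and `p` vanishes on the boundary of `D`.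
Only the values of `p` on `D \ {0}` matter. -/
structure IsGreenPotential (D : Set ℂ) (p : ℂ → ℝ) : Prop where
  laplacian_eq : ∃ h : ℂ → ℝ, InnerProductSpace.HarmonicOnNhd h D ∧
    ∀ z ∈ D, z ≠ 0 → p z = -(1 / (2 * Real.pi)) * Real.log ‖z‖ + h z
  boundary : ∀ x ∈ frontier D, Tendsto p (𝓝[D] x) (𝓝 0)

/-- Strong Hele-Shaw flow with permeability `κ`: `V_t = -κ ∇p_t` on `∂Ω_t` for `t ∈ (a, b)`. The
value of `∇p_t` at a boundary point is its limit `G` from inside `Ω_t`. -/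
def IsStrongHeleShawFlow (κ : ℂ → ℝ) (Ω : ℝ → Set ℂ) (a b : ℝ) : Prop :=
  ∀ t ∈ Ioo a b, ∃ p : ℂ → ℝ, IsGreenPotential (Ω t) p ∧
    ∀ x ∈ frontier (Ω t), ∃ V G : ℂ, HasNormalVelocity Ω t x V ∧
      Tendsto (gradient p) (𝓝[Ω t] x) (𝓝 G) ∧ V = -(κ x • G)

end HeleShaw

end

/-! The motion of the boundary and Green's formula give the transport identity
`d/dt ∫_{Ω_t} F / κ = F 0 + ∫_{Ω_t} p_t ΔF`, with `p_t ≥ 0`. Since `Ω_t` shrinks to the origin,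
`∫_{Ω_t} F / κ = t F 0` for harmonic `F`, and `∫_{Ω_t} F / κ - t F 0` increases with `t` for
subharmonic `F`. Taking for `F` regularisations of `log |z - ·|²`, one finds that the difference
`Q_t` between the logarithmic potential of `1_{Ω_t} / κ` and `t log |z|²` vanishes off `Ω_t`, is
nonnegative and increases with `t`. For `s < t` the difference `Q_t - Q_s` is harmonic on
`Ω_s ∖ {0}` with a positive pole at the origin, hence positive there; so `Q_t > 0` on
`Ω_t ∖ {0}`.

Therefore `φ - Q_t` is a competitor for the envelope `ψ_t`. It dominates every other competitor by
the maximum principle on `Ω_t`, where `φ - Q_t + log (1 + |z|²)` is harmonic away from the pole;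
the `O(1)` at the pole is absorbed by a small multiple of a Green function. Hence
`ψ_t = φ - Q_t`, and `{ψ_t < φ} = Ω_t`.
-/

open Laplacian
open scoped Interval

noncomputable section

namespace HeleShaw

/-! ### The Laplacian -/

section Laplacian

variable {E : Type*} [NormedAddCommGroup E] [InnerProductSpace ℝ E] [FiniteDimensional ℝ E]

theorem contDiff_fderiv_apply {E F : Type*} [NormedAddCommGroup E] [NormedSpace ℝ E]
    [NormedAddCommGroup F] [NormedSpace ℝ F] {f : E → F} {m n : ℕ∞ω} (hf : ContDiff ℝ n f)
    (hmn : m + 1 ≤ n) (v : E) : ContDiff ℝ m (fderiv ℝ f · v) :=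
  (hf.fderiv_right hmn).clm_apply contDiff_const

theorem contDiffAt_fderiv_apply {E F : Type*} [NormedAddCommGroup E] [NormedSpace ℝ E]
    [NormedAddCommGroup F] [NormedSpace ℝ F] {f : E → F} {m n : ℕ∞ω} {x : E}
    (hf : ContDiffAt ℝ n f x) (hmn : m + 1 ≤ n) (v : E) : ContDiffAt ℝ m (fderiv ℝ f · v) x :=
  (hf.fderiv_right hmn).clm_apply contDiffAt_const

theorem laplacian_eq_sum_fderiv_fderiv {F ι : Type*} [NormedAddCommGroup F] [NormedSpace ℝ F]
    [Fintype ι] (v : OrthonormalBasis ι ℝ E) {f : E → F} {x : E} (hf : ContDiffAt ℝ 2 f x) :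
    Δ f x = ∑ i, fderiv ℝ (fderiv ℝ f · (v i)) x (v i) := by
  have hd : DifferentiableAt ℝ (fderiv ℝ f) x :=
    (hf.fderiv_right (m := 1) le_rfl).differentiableAt one_ne_zero
  rw [InnerProductSpace.laplacian_eq_iteratedFDeriv_orthonormalBasis f v]
  refine Finset.sum_congr rfl fun i _ => ?_
  simp [iteratedFDeriv_two_apply, fderiv_clm_apply hd (differentiableAt_const _)]

theorem contDiff_laplacian {F : Type*} [NormedAddCommGroup F] [NormedSpace ℝ F] {f : E → F}
    {m n : ℕ∞ω} (hf : ContDiff ℝ n f) (hmn : m + 2 ≤ n) : ContDiff ℝ m (Δ f) := by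
  have h : Δ f = fun x => ∑ i, fderiv ℝ (fderiv ℝ f · (stdOrthonormalBasis ℝ E i)) x
      (stdOrthonormalBasis ℝ E i) := by
    ext x
    exact laplacian_eq_sum_fderiv_fderiv _ (hf.contDiffAt.of_le (le_add_self.trans hmn))
  rw [← one_add_one_eq_two, ← add_assoc] at hmn
  rw [h]
  exact ContDiff.sum fun i _ =>
    contDiff_fderiv_apply (contDiff_fderiv_apply hf hmn _) le_rfl _

theorem support_laplacian_subset {F : Type*} [NormedAddCommGroup F] [NormedSpace ℝ F]
    (f : E → F) : Function.support (Δ f) ⊆ tsupport f := by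
  intro x hx
  by_contra h
  have h0 : f =ᶠ[𝓝 x] fun _ => 0 := notMem_tsupport_iff_eventuallyEq.1 h
  exact hx ((InnerProductSpace.laplacian_congr_nhds h0).self_of_nhds.trans (by simp))

theorem laplacian_eq_zero_of_notMem_tsupport {F : Type*} [NormedAddCommGroup F] [NormedSpace ℝ F]
    {f : E → F} {x : E} (hx : x ∉ tsupport f) : Δ f x = 0 :=
  Function.notMem_support.1 fun h => hx (support_laplacian_subset f h)

theorem tsupport_laplacian_subset {F : Type*} [NormedAddCommGroup F] [NormedSpace ℝ F]
    (f : E → F) : tsupport (Δ f) ⊆ tsupport f :=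
  closure_minimal (support_laplacian_subset f) (isClosed_tsupport f)

theorem hasCompactSupport_laplacian {F : Type*} [NormedAddCommGroup F] [NormedSpace ℝ F]
    {f : E → F} (hf : HasCompactSupport f) : HasCompactSupport (Δ f) :=
  hf.mono' (support_laplacian_subset f)

variable [MeasurableSpace E] [BorelSpace E]

theorem integrable_mul_of_continuousAt_tsupport {X : Type*} [TopologicalSpace X]
    [MeasurableSpace X] [OpensMeasurableSpace X] {μ : Measure X} [IsFiniteMeasureOnCompacts μ]
    {f g : X → ℝ} (hg : Continuous g)
    (hgs : HasCompactSupport g) (hf : ∀ x ∈ tsupport g, ContinuousAt f x) :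
    Integrable (fun x => f x * g x) μ :=
  (continuous_of_tsupport fun x hx =>
    (hf x (tsupport_mul_subset_right hx)).mul hg.continuousAt).integrable_of_hasCompactSupport
      hgs.mul_left

theorem integral_mul_fderiv_apply_comm {f F : E → ℝ} (hF : ContDiff ℝ 1 F)
    (hFs : HasCompactSupport F) (hf : ∀ x ∈ tsupport F, ContDiffAt ℝ 1 f x) (v : E) :
    ∫ x, f x * fderiv ℝ F x v = -∫ x, fderiv ℝ f x v * F x := by
  refine integral_mul_fderiv_eq_neg_fderiv_mul_of_integrable ?_ ?_ ?_
    (fun x hx => (hf x hx).differentiableAt one_ne_zero) fun x _ => hF.differentiable one_ne_zero x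
  · exact integrable_mul_of_continuousAt_tsupport hF.continuous hFs fun x hx =>
      (contDiffAt_fderiv_apply (hf x hx) (m := 0) le_rfl v).continuousAt
  · exact integrable_mul_of_continuousAt_tsupport
      (contDiff_fderiv_apply hF (m := 0) le_rfl v).continuous (hFs.fderiv_apply ℝ v)
      fun x hx => (hf x (tsupport_fderiv_apply_subset ℝ v hx)).continuousAt
  · exact integrable_mul_of_continuousAt_tsupport hF.continuous hFs fun x hx =>
      (hf x hx).continuousAt

theorem integral_mul_fderiv_fderiv_apply_comm {f F : E → ℝ} (hF : ContDiff ℝ 2 F)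
    (hFs : HasCompactSupport F) (hf : ∀ x ∈ tsupport F, ContDiffAt ℝ 2 f x) (v : E) :
    ∫ x, f x * fderiv ℝ (fderiv ℝ F · v) x v = ∫ x, fderiv ℝ (fderiv ℝ f · v) x v * F x := by
  rw [integral_mul_fderiv_apply_comm (contDiff_fderiv_apply hF (m := 1) le_rfl v)
      (hFs.fderiv_apply ℝ v) fun x hx =>
        (hf x (tsupport_fderiv_apply_subset ℝ v hx)).of_le one_le_two,
    integral_mul_fderiv_apply_comm (hF.of_le one_le_two) hFs
      (fun x hx => contDiffAt_fderiv_apply (hf x hx) le_rfl v), neg_neg]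

theorem integral_mul_laplacian_comm {f F : E → ℝ} (hF : ContDiff ℝ 2 F)
    (hFs : HasCompactSupport F) (hf : ∀ x ∈ tsupport F, ContDiffAt ℝ 2 f x) :
    ∫ x, f x * Δ F x = ∫ x, Δ f x * F x := by
  set e := stdOrthonormalBasis ℝ E
  have hF' : ∀ x, f x * Δ F x = ∑ i, f x * fderiv ℝ (fderiv ℝ F · (e i)) x (e i) := fun x => by
    rw [laplacian_eq_sum_fderiv_fderiv e hF.contDiffAt, Finset.mul_sum]
  have hf' : ∀ x, Δ f x * F x = ∑ i, fderiv ℝ (fderiv ℝ f · (e i)) x (e i) * F x := fun x => by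
    by_cases hx : x ∈ tsupport F
    · rw [laplacian_eq_sum_fderiv_fderiv e (hf x hx), Finset.sum_mul]
    · simp only [image_eq_zero_of_notMem_tsupport hx, mul_zero, Finset.sum_const_zero]
  simp_rw [hF', hf']
  rw [integral_finsetSum, integral_finsetSum]
  · exact Finset.sum_congr rfl fun i _ => integral_mul_fderiv_fderiv_apply_comm hF hFs hf (e i)
  · exact fun i _ => integrable_mul_of_continuousAt_tsupport hF.continuous hFs fun x hx =>
      (contDiffAt_fderiv_apply (contDiffAt_fderiv_apply (hf x hx) (m := 1) le_rfl _)
        (m := 0) le_rfl _).continuousAt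
  · refine fun i _ => integrable_mul_of_continuousAt_tsupport
      (contDiff_fderiv_apply (contDiff_fderiv_apply hF (m := 1) le_rfl _)
        (m := 0) le_rfl _).continuous
      ((hFs.fderiv_apply ℝ _).fderiv_apply ℝ _) fun x hx => (hf x ?_).continuousAt
    exact tsupport_fderiv_apply_subset ℝ _ (tsupport_fderiv_apply_subset ℝ _ hx)

theorem integral_harmonic_mul_laplacian {f F : E → ℝ} (hF : ContDiff ℝ 2 F)
    (hFs : HasCompactSupport F) (hf : InnerProductSpace.HarmonicOnNhd f (tsupport F)) :
    ∫ x, f x * Δ F x = 0 := by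
  rw [integral_mul_laplacian_comm hF hFs fun x hx => (hf x hx).1]
  refine integral_eq_zero_of_ae (Eventually.of_forall fun x => ?_)
  by_cases hx : x ∈ tsupport F
  · simp [(hf x hx).2.self_of_nhds]
  · simp [image_eq_zero_of_notMem_tsupport hx]

end Laplacian

/-! ### The fundamental solution -/

section LogNormSq

variable {E : Type*} [NormedAddCommGroup E] [InnerProductSpace ℝ E]

theorem contDiff_log_norm_sub_sq_add (x : E) {ε : ℝ} (hε : 0 < ε) {n : ℕ∞ω} :
    ContDiff ℝ n fun y : E => Real.log (‖x - y‖ ^ 2 + ε) :=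
  (((contDiff_const.sub contDiff_id).norm_sq ℝ).add contDiff_const).log
    fun y => by positivity

theorem hasFDerivAt_norm_sub_sq_add (x y : E) (ε : ℝ) :
    HasFDerivAt (fun y => ‖x - y‖ ^ 2 + ε) (2 • innerSL ℝ (y - x)) y := by
  simp_rw [norm_sub_rev x]
  simpa using (((hasFDerivAt_id y).sub_const x).norm_sq).add_const ε

theorem laplacian_log_norm_sub_sq_add [FiniteDimensional ℝ E] (x : E) {ε : ℝ} (hε : 0 < ε)
    (y : E) : Δ (fun y : E => Real.log (‖x - y‖ ^ 2 + ε)) y =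
      2 * Module.finrank ℝ E / (‖x - y‖ ^ 2 + ε)
        - 4 * ‖x - y‖ ^ 2 / (‖x - y‖ ^ 2 + ε) ^ 2 := by
  have hpos : ∀ y : E, ‖x - y‖ ^ 2 + ε ≠ 0 := fun y => by positivity
  have hd : ∀ v : E, (fderiv ℝ (fun y : E => Real.log (‖x - y‖ ^ 2 + ε)) · v) =
      fun y => (‖x - y‖ ^ 2 + ε)⁻¹ * (2 * inner ℝ (y - x) v) := fun v => by
    ext y
    rw [((hasFDerivAt_norm_sub_sq_add x y ε).log (hpos y)).fderiv]
    simp [-map_sub]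
  have hdd : ∀ v : E, fderiv ℝ (fderiv ℝ (fun y : E => Real.log (‖x - y‖ ^ 2 + ε)) · v) y v =
      2 * ‖v‖ ^ 2 / (‖x - y‖ ^ 2 + ε)
        - 4 * inner ℝ (y - x) v ^ 2 / (‖x - y‖ ^ 2 + ε) ^ 2 := fun v => by
    have h : HasFDerivAt (fun y => (‖x - y‖ ^ 2 + ε)⁻¹ * (2 * inner ℝ (y - x) v)) _ y :=
      ((hasDerivAt_inv (hpos y)).comp_hasFDerivAt y (hasFDerivAt_norm_sub_sq_add x y ε)).mul
        ((((hasFDerivAt_id y).sub_const x).inner ℝ (hasFDerivAt_const v y)).const_mul 2)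
    rw [hd, h.fderiv]
    have := hpos y
    simp [-map_sub]
    field_simp
    ring
  rw [laplacian_eq_sum_fderiv_fderiv (stdOrthonormalBasis ℝ E)
    (contDiff_log_norm_sub_sq_add x hε).contDiffAt]
  simp_rw [hdd, Finset.sum_sub_distrib, ← Finset.sum_div, ← Finset.mul_sum,
    OrthonormalBasis.sum_sq_inner_left, norm_sub_rev x]
  simp

end LogNormSq

theorem laplacian_log_norm_sub_sq_add_complex (z : ℂ) {ε : ℝ} (hε : 0 < ε) (w : ℂ) :
    Δ (fun w : ℂ => Real.log (‖z - w‖ ^ 2 + ε)) w = 4 * ε / (‖z - w‖ ^ 2 + ε) ^ 2 := by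
  rw [laplacian_log_norm_sub_sq_add z hε, Complex.finrank_real_complex]
  field_simp
  ring

theorem locallyIntegrable_log_norm_sub_sq (z : ℂ) :
    LocallyIntegrable fun ζ : ℂ => Real.log (‖z - ζ‖ ^ 2) := by
  have hball : ∀ r : ℝ, IntegrableOn (fun ζ : ℂ => Real.log (‖ζ‖ ^ 2)) (Metric.ball 0 r) := by
    intro r
    rw [integrableOn_fun_norm_addHaar volume (f := fun x => Real.log (x ^ 2))]
    refine (((Real.continuous_mul_log.const_smul (2 : ℝ)).integrableOn_Icc
      (a := 0) (b := r)).mono_set Ioo_subset_Icc_self).congr_fun (fun y _ => ?_) measurableSet_Ioo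
    simp only [Real.log_pow, Nat.cast_ofNat, smul_eq_mul, Complex.finrank_real_complex,
      Pi.smul_apply]
    ring
  intro w
  refine ⟨Metric.ball w 1, Metric.ball_mem_nhds w one_pos, ?_⟩
  refine (((Measure.measurePreserving_sub_left volume z).integrableOn_comp_preimage
    (MeasurableEquiv.subLeft z).measurableEmbedding).2 (hball (‖z - w‖ + 1))).mono_set ?_
  intro ζ hζ
  rw [Metric.mem_ball, dist_eq_norm, norm_sub_rev] at hζ
  simpa using (norm_sub_le_norm_sub_add_norm_sub z w ζ).trans_lt (by gcongr)

theorem integrable_log_norm_sub_sq_mul {g : ℂ → ℝ} (z : ℂ) (hg : Continuous g)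
    (hgs : HasCompactSupport g) : Integrable fun ζ => Real.log (‖z - ζ‖ ^ 2) * g ζ := by
  simpa [mul_comm] using
    (locallyIntegrable_log_norm_sub_sq z).integrable_smul_left_of_hasCompactSupport hg hgs

theorem integral_inv_one_add_norm_sq_sq :
    ∫ z : ℂ, 1 / (Real.pi * (1 + ‖z‖ ^ 2) ^ 2) = 1 := by
  rw [integral_fun_norm_addHaar volume (fun x : ℝ => 1 / (Real.pi * (1 + x ^ 2) ^ 2))]
  have hderiv : ∀ x ∈ Ici (0 : ℝ),
      HasDerivAt (fun x : ℝ => -(1 / (2 * Real.pi)) * (1 + x ^ 2)⁻¹)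
        (x * (1 / (Real.pi * (1 + x ^ 2) ^ 2))) x := by
    intro x _
    have h : HasDerivAt (fun x : ℝ => 1 + x ^ 2) (2 * x) x := by
      simpa using (hasDerivAt_pow 2 x).const_add 1
    convert! (h.fun_inv (by positivity)).const_mul (-(1 / (2 * Real.pi))) using 1
    field_simp
  have hlim : Tendsto (fun x : ℝ => -(1 / (2 * Real.pi)) * (1 + x ^ 2)⁻¹) atTop (𝓝 0) := by
    have : Tendsto (fun x : ℝ => (1 + x ^ 2)) atTop atTop :=
      tendsto_atTop_add_const_left _ _ (tendsto_pow_atTop two_ne_zero)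
    simpa using this.inv_tendsto_atTop.const_mul (-(1 / (2 * Real.pi)))
  have hradial := integral_Ioi_of_hasDerivAt_of_nonneg' hderiv
    (fun x hx => mul_nonneg (le_of_lt hx) (by positivity)) hlim
  have hball : (volume : Measure ℂ).real (Metric.ball 0 1) = Real.pi := by
    simp [Measure.real, Complex.volume_ball]
  simp only [Complex.finrank_real_complex, smul_eq_mul, hball]
  norm_num at hradial ⊢
  rw [hradial]
  field_simp

theorem abs_log_add_le {x ε : ℝ} (hx : 0 < x) (hε : 0 ≤ ε) (hε1 : ε ≤ 1) :
    |Real.log (x + ε)| ≤ |Real.log x| + Real.log (1 + x) := by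
  have h1 : Real.log x ≤ Real.log (x + ε) := Real.log_le_log hx (by linarith)
  have h2 : Real.log (x + ε) ≤ Real.log (1 + x) := Real.log_le_log (by linarith) (by linarith)
  have h3 : 0 ≤ Real.log (1 + x) := Real.log_nonneg (by linarith)
  rw [abs_le]
  constructor
  · linarith [neg_abs_le (Real.log x)]
  · linarith [abs_nonneg (Real.log x)]

theorem tendsto_log_add_inv_sq {x : ℝ} (hx : x ≠ 0) :
    Tendsto (fun c : ℝ => Real.log (x + (c ^ 2)⁻¹)) atTop (𝓝 (Real.log x)) := by
  have h : Tendsto (fun c : ℝ => x + (c ^ 2)⁻¹) atTop (𝓝 (x + 0)) :=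
    (tendsto_inv_atTop_zero.comp (tendsto_pow_atTop two_ne_zero)).const_add x
  rw [add_zero] at h
  exact h.log hx

theorem ae_norm_sub_sq_pos (z : ℂ) : ∀ᵐ ζ : ℂ, 0 < ‖z - ζ‖ ^ 2 := by
  filter_upwards [(by simp [ae_iff, measure_singleton] : ∀ᵐ ζ : ℂ, ζ ≠ z)] with ζ hζ
  have := norm_pos_iff.2 (sub_ne_zero.2 hζ.symm)
  positivity

theorem tendsto_integral_log_add_inv_sq_mul {g : ℂ → ℝ} (z : ℂ) (hg : AEStronglyMeasurable g)
    (hlog : Integrable fun ζ => Real.log (‖z - ζ‖ ^ 2) * g ζ)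
    (hlog1 : Integrable fun ζ => Real.log (1 + ‖z - ζ‖ ^ 2) * g ζ) :
    Tendsto (fun c : ℝ => ∫ ζ, Real.log (‖z - ζ‖ ^ 2 + (c ^ 2)⁻¹) * g ζ) atTop
      (𝓝 (∫ ζ, Real.log (‖z - ζ‖ ^ 2) * g ζ)) := by
  refine tendsto_integral_filter_of_dominated_convergence
    (fun ζ => |Real.log (‖z - ζ‖ ^ 2) * g ζ| + |Real.log (1 + ‖z - ζ‖ ^ 2) * g ζ|) ?_ ?_
    (hlog.abs.add hlog1.abs) ?_
  · exact Eventually.of_forall fun c => AEStronglyMeasurable.mul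
      (by fun_prop : Measurable fun ζ : ℂ =>
        Real.log (‖z - ζ‖ ^ 2 + (c ^ 2)⁻¹)).aestronglyMeasurable hg
  · filter_upwards [eventually_ge_atTop (1 : ℝ)] with c hc
    filter_upwards [ae_norm_sub_sq_pos z] with ζ hζ
    rw [norm_mul, abs_mul, abs_mul, ← add_mul, Real.norm_eq_abs, Real.norm_eq_abs]
    gcongr
    refine (abs_log_add_le hζ (by positivity) (inv_le_one_of_one_le₀ (one_le_pow₀ hc))).trans ?_
    gcongr
    exact le_abs_self _
  · filter_upwards [ae_norm_sub_sq_pos z] with ζ hζ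
    exact (tendsto_log_add_inv_sq hζ.ne').mul_const _

theorem tendsto_norm_sq_mul_inv_one_add_norm_sq_sq :
    Tendsto (fun z : ℂ => ‖z‖ ^ 2 * (1 / (Real.pi * (1 + ‖z‖ ^ 2) ^ 2)))
      (Bornology.cobounded ℂ) (𝓝 0) := by
  have hlim : Tendsto (fun z : ℂ => (1 + ‖z‖ ^ 2)⁻¹) (Bornology.cobounded ℂ) (𝓝 0) :=
    (tendsto_atTop_add_const_left _ _ ((tendsto_pow_atTop two_ne_zero).comp
      tendsto_norm_cobounded_atTop)).inv_tendsto_atTop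
  refine squeeze_zero (fun z => by positivity) (fun z => ?_) hlim
  have hsq : ‖z‖ ^ 2 ≤ Real.pi * (1 + ‖z‖ ^ 2) := by
    nlinarith [Real.pi_gt_three, sq_nonneg ‖z‖]
  rw [mul_one_div, div_le_iff₀ (by positivity)]
  calc ‖z‖ ^ 2 ≤ Real.pi * (1 + ‖z‖ ^ 2) := hsq
    _ = (1 + ‖z‖ ^ 2)⁻¹ * (Real.pi * (1 + ‖z‖ ^ 2) ^ 2) := by field_simp

theorem laplacian_log_norm_sub_sq_add_inv_sq (z w : ℂ) {c : ℝ} (hc : 0 < c) :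
    Δ (fun w : ℂ => Real.log (‖z - w‖ ^ 2 + (c ^ 2)⁻¹)) w =
      4 * Real.pi * (c ^ 2 * (1 / (Real.pi * (1 + ‖c • (z - w)‖ ^ 2) ^ 2))) := by
  have hsum : ‖z - w‖ ^ 2 + (c ^ 2)⁻¹ = (1 + (c * ‖z - w‖) ^ 2) / c ^ 2 := by
    field_simp
    ring
  rw [laplacian_log_norm_sub_sq_add_complex z (by positivity), hsum, norm_smul,
    Real.norm_of_nonneg hc.le]
  field_simp

/-- The Laplacians of the regularisations `log (|z - ζ|² + c⁻²)` are `4π` times an approximate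
identity. -/
theorem integral_log_norm_sub_sq_mul_laplacian {F : ℂ → ℝ} (hF : ContDiff ℝ 2 F)
    (hFs : HasCompactSupport F) (z : ℂ) :
    ∫ ζ, Real.log (‖z - ζ‖ ^ 2) * Δ F ζ = 4 * Real.pi * F z := by
  have hΔ := (contDiff_laplacian (m := 0) hF (by simp)).continuous
  have hΔs := hasCompactSupport_laplacian hFs
  have hpoisson := tendsto_integral_comp_smul_smul_of_integrable' (μ := (volume : Measure ℂ))
    (φ := fun x : ℂ => 1 / (Real.pi * (1 + ‖x‖ ^ 2) ^ 2)) (fun x => by positivity)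
    integral_inv_one_add_norm_sq_sq (by
      simpa only [Complex.finrank_real_complex] using tendsto_norm_sq_mul_inv_one_add_norm_sq_sq)
    (g := F) (x₀ := z)
    (hF.continuous.integrable_of_hasCompactSupport hFs) hF.continuous.continuousAt
  refine tendsto_nhds_unique (tendsto_integral_log_add_inv_sq_mul z
    hΔ.aestronglyMeasurable (integrable_log_norm_sub_sq_mul z hΔ hΔs)
    (integrable_mul_of_continuousAt_tsupport hΔ hΔs fun ζ _ =>
      ContinuousAt.log (by fun_prop) (by positivity)))
    ((hpoisson.const_mul (4 * Real.pi)).congr' ?_)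
  filter_upwards [eventually_gt_atTop (0 : ℝ)] with c hc
  rw [integral_mul_laplacian_comm hF hFs fun ζ _ =>
    (contDiff_log_norm_sub_sq_add z (by positivity)).contDiffAt, ← integral_const_mul]
  refine integral_congr_ae (Eventually.of_forall fun ζ => ?_)
  simp only [laplacian_log_norm_sub_sq_add_inv_sq z ζ hc, Complex.finrank_real_complex,
    smul_eq_mul, mul_assoc]

/-! ### Logarithmic potentials -/

/-- Non-negative, locally bounded densities on `ℂ` whose logarithmic potential converges absolutely
at every point. -/
structure IsLogDensity (m : ℂ → ℝ) : Prop where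
  measurable : Measurable m
  nonneg : ∀ z, 0 ≤ m z
  locally_bounded : ∀ R : ℝ, ∃ C, ∀ z ∈ Metric.closedBall (0 : ℂ) R, m z ≤ C
  integrable_log : ∀ z : ℂ, Integrable fun ζ : ℂ => Real.log (‖z - ζ‖ ^ 2) * m ζ

/-- The logarithmic potential of the measure with density `m`, normalised so that its Laplacian is
`4π m`. -/
def logPotential (m : ℂ → ℝ) (z : ℂ) : ℝ :=
  ∫ ζ : ℂ, Real.log (‖z - ζ‖ ^ 2) * m ζ

theorem IsLogDensity.mono {m m' : ℂ → ℝ} (hm : IsLogDensity m) (hmeas : Measurable m')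
    (h0 : ∀ z, 0 ≤ m' z) (hle : ∀ z, m' z ≤ m z) : IsLogDensity m' where
  measurable := hmeas
  nonneg := h0
  locally_bounded R :=
    let ⟨C, hC⟩ := hm.locally_bounded R
    ⟨C, fun z hz => (hle z).trans (hC z hz)⟩
  integrable_log z := by
    refine (hm.integrable_log z).mono ?_ (Eventually.of_forall fun ζ => ?_)
    · exact ((by fun_prop : Measurable fun ζ : ℂ => Real.log (‖z - ζ‖ ^ 2)).mul
        hmeas).aestronglyMeasurable
    · rw [norm_mul, norm_mul, Real.norm_of_nonneg (h0 ζ), Real.norm_of_nonneg (hm.nonneg ζ)]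
      gcongr
      exact hle ζ

theorem IsLogDensity.indicator {m : ℂ → ℝ} (hm : IsLogDensity m) {S : Set ℂ}
    (hS : MeasurableSet S) : IsLogDensity (S.indicator m) :=
  hm.mono (hm.measurable.indicator hS) (fun z => indicator_nonneg (fun x _ => hm.nonneg x) z)
    (fun z => indicator_le_self' (fun x _ => hm.nonneg x) z)

theorem IsLogDensity.exists_bound {m : ℂ → ℝ} (hm : IsLogDensity m) (c : ℂ) (R : ℝ) :
    ∃ C, 0 ≤ C ∧ ∀ z ∈ Metric.ball c R, m z ≤ C := by
  obtain ⟨C, hC⟩ := hm.locally_bounded (‖c‖ + R)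
  refine ⟨max C 0, le_max_right _ _, fun z hz => (hC z ?_).trans (le_max_left _ _)⟩
  rw [mem_closedBall_zero_iff]
  rw [mem_ball_iff_norm] at hz
  linarith [norm_sub_norm_le z c]

theorem IsLogDensity.integrable {m : ℂ → ℝ} (hm : IsLogDensity m) : Integrable m := by
  obtain ⟨C, -, hC⟩ := hm.exists_bound 0 2
  have hnear : IntegrableOn m (Metric.ball 0 2) :=
    Measure.integrableOn_of_bounded (M := C) measure_ball_lt_top.ne
      hm.measurable.aestronglyMeasurable (by
        filter_upwards [ae_restrict_mem Metric.isOpen_ball.measurableSet] with z hz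
        rw [Real.norm_of_nonneg (hm.nonneg z)]
        exact hC z hz)
  have hfar : IntegrableOn m (Metric.ball 0 2)ᶜ := by
    refine Integrable.mono (hm.integrable_log 0).integrableOn hm.measurable.aestronglyMeasurable ?_
    filter_upwards [ae_restrict_mem Metric.isOpen_ball.measurableSet.compl] with z hz
    have hz : 2 ≤ ‖z‖ := by simpa using hz
    rw [norm_mul, zero_sub, norm_neg]
    refine le_mul_of_one_le_left (norm_nonneg _) (le_trans ?_ (le_abs_self _))
    rw [Real.le_log_iff_exp_le (by positivity)]
    nlinarith [Real.exp_one_lt_d9]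
  simpa using hnear.union hfar

section Continuity

theorem continuous_integral_sub_mul_of_bounded {G : Type*} [AddCommGroup G] [TopologicalSpace G]
    [IsTopologicalAddGroup G] [LocallyCompactSpace G] [SecondCountableTopology G]
    [MeasurableSpace G] [BorelSpace G] {μ : Measure G} [μ.IsAddHaarMeasure]
    [μ.IsNegInvariant] {k m : G → ℝ} (hk : Integrable k μ) (hm : Integrable m μ) {C : ℝ}
    (hC : ∀ x, |m x| ≤ C) : Continuous fun x => ∫ y, k (x - y) * m y ∂μ := by
  have hC0 : 0 ≤ C := (abs_nonneg _).trans (hC 0)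
  have hint : ∀ {q : G → ℝ}, Integrable q μ → ∀ x, Integrable (fun y => q (x - y) * m y) μ :=
    fun hq x => (hq.comp_sub_left x).mul_bdd (c := C) hm.aestronglyMeasurable
      (Eventually.of_forall hC)
  refine continuous_of_uniform_approx_of_continuous fun u hu => ?_
  obtain ⟨ε, hε, hεu⟩ := Metric.mem_uniformity_dist.1 hu
  obtain ⟨g, hgs, hgle, hgc, hgi⟩ :=
    hk.exists_hasCompactSupport_integral_sub_le (ε := ε / (2 * (C + 1))) (by positivity)
  refine ⟨fun x => ∫ y, g (x - y) * m y ∂μ, ?_, fun x => hεu ?_⟩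
  · refine (hgs.continuous_convolution_right (ContinuousLinearMap.mul ℝ ℝ)
      hm.locallyIntegrable hgc).congr fun x => ?_
    simp [convolution_def, mul_comm]
  · rw [Real.dist_eq, ← integral_sub (hint hk x) (hint hgi x)]
    calc |∫ y, k (x - y) * m y - g (x - y) * m y ∂μ|
        ≤ ∫ y, |k (x - y) * m y - g (x - y) * m y| ∂μ := abs_integral_le_integral_abs
      _ ≤ ∫ y, ‖k (x - y) - g (x - y)‖ * C ∂μ := by
        refine integral_mono ((hint hk x).sub (hint hgi x)).abs
          (((hk.sub hgi).norm.comp_sub_left x).mul_const C) fun y => ?_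
        rw [← sub_mul, abs_mul, Real.norm_eq_abs]
        gcongr
        exact hC y
      _ = (∫ y, ‖k y - g y‖ ∂μ) * C := by
        rw [integral_mul_const, integral_sub_left_eq_self (fun y => ‖k y - g y‖) μ x]
      _ ≤ ε / (2 * (C + 1)) * C := by gcongr
      _ < ε := by
        rw [div_mul_eq_mul_div, div_lt_iff₀ (by positivity)]
        nlinarith

variable {m k : ℂ → ℝ}

theorem IsLogDensity.integrable_kernel_mul (hm : IsLogDensity m) (hk : Measurable k)
    (hkb : ∀ z, |k z| ≤ |Real.log (‖z‖ ^ 2)|) (z : ℂ) :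
    Integrable fun ζ => k (z - ζ) * m ζ := by
  refine (hm.integrable_log z).mono ?_ (Eventually.of_forall fun ζ => ?_)
  · exact ((hk.comp (by fun_prop)).mul hm.measurable).aestronglyMeasurable
  · rw [norm_mul, norm_mul]
    gcongr
    exact hkb _

theorem IsLogDensity.continuousAt_integral_near (hm : IsLogDensity m) (hk : Measurable k)
    (hkb : ∀ z, |k z| ≤ |Real.log (‖z‖ ^ 2)|) (z₀ : ℂ) :
    ContinuousAt (fun z => ∫ ζ, k (z - ζ) * (Metric.ball z₀ 2).indicator m ζ) z₀ := by
  have hm₁ := hm.indicator (Metric.isOpen_ball (x := z₀) (ε := 2)).measurableSet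
  obtain ⟨C, hC0, hC⟩ := hm.exists_bound z₀ 2
  have hkint : Integrable ((Metric.ball (0 : ℂ) 3).indicator k) := by
    rw [integrable_indicator_iff Metric.isOpen_ball.measurableSet]
    refine Integrable.mono (((locallyIntegrable_iff.1 (locallyIntegrable_log_norm_sub_sq 0))
      (Metric.closedBall 0 3) (isCompact_closedBall _ _)).mono_set Metric.ball_subset_closedBall)
      hk.aestronglyMeasurable (Eventually.of_forall fun z => ?_)
    simpa using hkb z
  have hcont := continuous_integral_sub_mul_of_bounded hkint hm₁.integrable (C := C) fun z => by
    rw [abs_of_nonneg (hm₁.nonneg z)]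
    exact indicator_apply_le' (hC z) fun _ => hC0
  refine hcont.continuousAt.congr ?_
  filter_upwards [Metric.ball_mem_nhds z₀ one_pos] with z hz
  refine integral_congr_ae (Eventually.of_forall fun ζ => ?_)
  by_cases hζ : ζ ∈ Metric.ball z₀ 2
  · have : z - ζ ∈ Metric.ball (0 : ℂ) 3 := by
      rw [Metric.mem_ball] at hz hζ
      rw [mem_ball_zero_iff, ← dist_eq_norm]
      linarith [dist_triangle_right z ζ z₀]
    simp only [indicator_of_mem this]
  · simp only [indicator_of_notMem hζ, mul_zero]

theorem abs_log_norm_sub_sq_le {z z₀ ζ : ℂ} (hz : ‖z - z₀‖ ≤ 1) (hζ : 2 ≤ ‖z₀ - ζ‖) :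
    |Real.log (‖z - ζ‖ ^ 2)| ≤ 2 * |Real.log (‖z₀ - ζ‖ ^ 2)| := by
  have hlower : 1 ≤ ‖z - ζ‖ := by
    have := norm_sub_le_norm_sub_add_norm_sub z₀ z ζ
    rw [norm_sub_rev z₀ z] at this
    linarith
  have hupper : ‖z - ζ‖ ≤ ‖z₀ - ζ‖ ^ 2 := by
    nlinarith [norm_sub_le_norm_sub_add_norm_sub z z₀ ζ]
  rw [abs_of_nonneg (Real.log_nonneg (one_le_pow₀ hlower)),
    abs_of_nonneg (Real.log_nonneg (one_le_pow₀ (by linarith))), Real.log_pow]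
  push_cast
  gcongr

theorem IsLogDensity.continuousAt_integral_far (hm : IsLogDensity m) (hk : Measurable k)
    (hkc : ∀ z ≠ 0, ContinuousAt k z) (hkb : ∀ z, |k z| ≤ |Real.log (‖z‖ ^ 2)|) (z₀ : ℂ) :
    ContinuousAt (fun z => ∫ ζ, k (z - ζ) * (Metric.ball z₀ 2)ᶜ.indicator m ζ) z₀ := by
  have hm₂ := hm.indicator (Metric.isOpen_ball (x := z₀) (ε := 2)).measurableSet.compl
  have hfar : ∀ ζ ∈ (Metric.ball z₀ 2)ᶜ, 2 ≤ ‖z₀ - ζ‖ := fun ζ hζ => by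
    simpa [dist_eq_norm, norm_sub_rev] using hζ
  refine continuousAt_of_dominated (bound := fun ζ => 2 * |Real.log (‖z₀ - ζ‖ ^ 2) * m ζ|)
    (Eventually.of_forall fun z => (hm₂.integrable_kernel_mul hk hkb z).aestronglyMeasurable)
    ?_ ((hm.integrable_log z₀).abs.const_mul 2) (Eventually.of_forall fun ζ => ?_)
  · filter_upwards [Metric.ball_mem_nhds z₀ one_pos] with z hz
    refine Eventually.of_forall fun ζ => ?_
    by_cases hζ : ζ ∈ (Metric.ball z₀ 2)ᶜ
    · rw [indicator_of_mem hζ, norm_mul, abs_mul, ← mul_assoc, Real.norm_eq_abs, Real.norm_eq_abs]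
      rw [mem_ball_iff_norm] at hz
      gcongr
      exact (hkb _).trans (abs_log_norm_sub_sq_le hz.le (hfar ζ hζ))
    · rw [indicator_of_notMem hζ, mul_zero, norm_zero]
      positivity
  · by_cases hζ : ζ ∈ (Metric.ball z₀ 2)ᶜ
    · refine ContinuousAt.mul (ContinuousAt.comp (g := k) (hkc _ ?_) (by fun_prop))
        continuousAt_const
      exact norm_pos_iff.1 (two_pos.trans_le (hfar ζ hζ))
    · simp only [indicator_of_notMem hζ, mul_zero]
      exact continuousAt_const

theorem IsLogDensity.continuous_integral_kernel (hm : IsLogDensity m) (hk : Measurable k)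
    (hkc : ∀ z ≠ 0, ContinuousAt k z) (hkb : ∀ z, |k z| ≤ |Real.log (‖z‖ ^ 2)|) :
    Continuous fun z => ∫ ζ, k (z - ζ) * m ζ := by
  refine continuous_iff_continuousAt.2 fun z₀ => ?_
  have hball : MeasurableSet (Metric.ball z₀ 2) := Metric.isOpen_ball.measurableSet
  refine ((hm.continuousAt_integral_near hk hkb z₀).add
    (hm.continuousAt_integral_far hk hkc hkb z₀)).congr (Eventually.of_forall fun z => ?_)
  simp only [Pi.add_apply]
  rw [← integral_add ((hm.indicator hball).integrable_kernel_mul hk hkb z)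
    ((hm.indicator hball.compl).integrable_kernel_mul hk hkb z)]
  simp_rw [← mul_add, indicator_self_add_compl_apply]

theorem continuousAt_log_norm_sq {E : Type*} [NormedAddCommGroup E] {x : E} (hx : x ≠ 0) :
    ContinuousAt (fun x : E => Real.log (‖x‖ ^ 2)) x :=
  ContinuousAt.log (by fun_prop) (by simpa using hx)

theorem IsLogDensity.continuous_logPotential (hm : IsLogDensity m) :
    Continuous (logPotential m) :=
  hm.continuous_integral_kernel (k := fun z => Real.log (‖z‖ ^ 2)) (by fun_prop)
    (fun _ hz => continuousAt_log_norm_sq hz) fun _ => le_rfl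

end Continuity

section SubMeanValue

variable {m : ℂ → ℝ}

theorem IsLogDensity.integrable_prod_circle (hm : IsLogDensity m) (c : ℂ) (R : ℝ) :
    Integrable (fun p : ℝ × ℂ => Real.log (‖circleMap c R p.1 - p.2‖ ^ 2) * m p.2)
      ((volume.restrict (Ioc 0 (2 * Real.pi))).prod volume) := by
  have hmeas : Measurable fun p : ℝ × ℂ => Real.log (‖circleMap c R p.1 - p.2‖ ^ 2) * m p.2 := by
    have hcircle : Measurable fun p : ℝ × ℂ => circleMap c R p.1 :=
      (continuous_circleMap c R).measurable.comp measurable_fst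
    exact (Real.measurable_log.comp ((hcircle.sub measurable_snd).norm.pow_const 2)).mul
      (hm.measurable.comp measurable_snd)
  have hcont : Continuous fun z => ∫ ζ, |Real.log (‖z - ζ‖ ^ 2)| * m ζ :=
    hm.continuous_integral_kernel (k := fun z => |Real.log (‖z‖ ^ 2)|) (by fun_prop)
      (fun z hz => (continuousAt_log_norm_sq hz).abs) (fun z => (abs_abs _).le)
  rw [integrable_prod_iff hmeas.aestronglyMeasurable]
  refine ⟨Eventually.of_forall fun θ => hm.integrable_log (circleMap c R θ), ?_⟩
  simp only [norm_mul, Real.norm_eq_abs, abs_of_nonneg (hm.nonneg _)]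
  exact (hcont.comp (continuous_circleMap c R)).integrableOn_Ioc

theorem log_norm_sub_sq_le_circleAverage {c ζ : ℂ} (hne : c ≠ ζ) {R : ℝ} (hR : 0 < R) :
    Real.log (‖c - ζ‖ ^ 2) ≤ Real.circleAverage (fun z => Real.log (‖z - ζ‖ ^ 2)) c R := by
  have hlog : (fun z : ℂ => Real.log (‖z - ζ‖ ^ 2)) = fun z => (2 : ℝ) • Real.log ‖z - ζ‖ := by
    ext z
    simp [Real.log_pow]
  rw [hlog, Real.circleAverage_fun_smul,
    circleAverage_log_norm_sub_const_eq_log_radius_add_posLog hR.ne', Real.log_pow, smul_eq_mul]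
  push_cast
  gcongr
  have hpos : 0 < ‖c - ζ‖ := norm_pos_iff.2 (sub_ne_zero.2 hne)
  calc Real.log ‖c - ζ‖ = Real.log R + Real.log (R⁻¹ * ‖c - ζ‖) := by
        rw [← Real.log_mul hR.ne' (by positivity), mul_inv_cancel_left₀ hR.ne']
    _ ≤ Real.log R + Real.posLog (R⁻¹ * ‖c - ζ‖) := by
        gcongr
        exact le_max_right _ _

theorem IsLogDensity.logPotential_le_circleAverage (hm : IsLogDensity m) (c : ℂ)
    {R : ℝ} (hR : 0 < R) :
    logPotential m c ≤ Real.circleAverage (logPotential m) c R := by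
  have hprod := hm.integrable_prod_circle c R
  have haverage : ∀ ζ, (2 * Real.pi)⁻¹ * ∫ θ in Ioc 0 (2 * Real.pi),
      Real.log (‖circleMap c R θ - ζ‖ ^ 2) * m ζ =
        Real.circleAverage (fun z => Real.log (‖z - ζ‖ ^ 2)) c R * m ζ := fun ζ => by
    rw [Real.circleAverage, intervalIntegral.integral_of_le Real.two_pi_pos.le, smul_eq_mul,
      mul_assoc, integral_mul_const]
  have hfubini : Real.circleAverage (logPotential m) c R =
      ∫ ζ, Real.circleAverage (fun z => Real.log (‖z - ζ‖ ^ 2)) c R * m ζ := by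
    simp_rw [← haverage]
    rw [Real.circleAverage, intervalIntegral.integral_of_le Real.two_pi_pos.le,
      integral_const_mul, smul_eq_mul, ← integral_integral_swap hprod]
    rfl
  rw [hfubini]
  refine integral_mono_ae (hm.integrable_log c) ?_ ?_
  · exact ((hprod.integral_prod_right).const_mul (2 * Real.pi)⁻¹).congr
      (Eventually.of_forall haverage)
  · filter_upwards [ae_norm_sub_sq_pos c] with ζ hζ
    refine mul_le_mul_of_nonneg_right (log_norm_sub_sq_le_circleAverage ?_ hR) (hm.nonneg ζ)
    rintro rfl
    simp at hζ

end SubMeanValue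

section Harmonic

variable {m : ℂ → ℝ} {z₀ z ζ : ℂ} {r : ℝ}

theorem norm_sub_div_sub_le (hr : 0 < r) (hz : z ∈ Metric.ball z₀ (r / 2))
    (hζ : r ≤ ‖z₀ - ζ‖) : ‖(z - z₀) / (z₀ - ζ)‖ ≤ 1 / 2 := by
  rw [mem_ball_iff_norm] at hz
  rw [norm_div, div_le_iff₀ (by linarith)]
  linarith

theorem one_add_sub_div_sub_mem_slitPlane (hr : 0 < r) (hz : z ∈ Metric.ball z₀ (r / 2))
    (hζ : r ≤ ‖z₀ - ζ‖) : 1 + (z - z₀) / (z₀ - ζ) ∈ Complex.slitPlane :=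
  Complex.mem_slitPlane_of_norm_lt_one
    ((norm_sub_div_sub_le hr hz hζ).trans_lt (by norm_num))

theorem norm_inv_sub_le (hr : 0 < r) (hz : z ∈ Metric.ball z₀ (r / 2)) (hζ : r ≤ ‖z₀ - ζ‖) :
    ‖(z - ζ)⁻¹‖ ≤ 2 / r := by
  rw [mem_ball_iff_norm'] at hz
  have : r / 2 ≤ ‖z - ζ‖ := by linarith [norm_sub_le_norm_sub_add_norm_sub z₀ z ζ]
  rw [norm_inv, inv_le_comm₀ (by linarith) (by positivity), inv_div]
  exact this

theorem sub_eq_mul_one_add_div (hne : z₀ ≠ ζ) :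
    z - ζ = (z₀ - ζ) * (1 + (z - z₀) / (z₀ - ζ)) := by
  have := sub_ne_zero.2 hne
  field_simp
  ring

theorem hasDerivAt_log_one_add_sub_div_sub (hr : 0 < r) (hz : z ∈ Metric.ball z₀ (r / 2))
    (hζ : r ≤ ‖z₀ - ζ‖) :
    HasDerivAt (fun w => Complex.log (1 + (w - z₀) / (z₀ - ζ))) (z - ζ)⁻¹ z := by
  have hne : z₀ - ζ ≠ 0 := norm_pos_iff.1 (hr.trans_le hζ)
  have hslit := one_add_sub_div_sub_mem_slitPlane hr hz hζ
  convert! ((((hasDerivAt_id' z).sub_const z₀).div_const (z₀ - ζ)).const_add 1).clog hslit using 1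
  rw [sub_eq_mul_one_add_div (sub_ne_zero.1 hne), mul_inv]
  have := Complex.slitPlane_ne_zero hslit
  field_simp

theorem log_norm_sub_sq_eq_add_re_log (hr : 0 < r) (hz : z ∈ Metric.ball z₀ (r / 2))
    (hζ : r ≤ ‖z₀ - ζ‖) : Real.log (‖z - ζ‖ ^ 2) =
      Real.log (‖z₀ - ζ‖ ^ 2) + 2 * (Complex.log (1 + (z - z₀) / (z₀ - ζ))).re := by
  have hne : z₀ - ζ ≠ 0 := norm_pos_iff.1 (hr.trans_le hζ)
  have hne' := Complex.slitPlane_ne_zero (one_add_sub_div_sub_mem_slitPlane hr hz hζ)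
  rw [sub_eq_mul_one_add_div (sub_ne_zero.1 hne), norm_mul, Real.log_pow, Real.log_pow,
    Real.log_mul (norm_ne_zero_iff.2 hne) (norm_ne_zero_iff.2 hne'), Complex.log_re]
  push_cast
  ring

theorem aestronglyMeasurable_log_one_add_mul (hm : Integrable m) (z₀ z : ℂ) :
    AEStronglyMeasurable fun ζ => Complex.log (1 + (z - z₀) / (z₀ - ζ)) * (m ζ : ℂ) :=
  (by fun_prop : Measurable fun ζ : ℂ =>
    Complex.log (1 + (z - z₀) / (z₀ - ζ))).aestronglyMeasurable.mul
      hm.ofReal.aestronglyMeasurable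

theorem integrable_log_one_add_mul (hm : Integrable m) (hr : 0 < r)
    (hfar : ∀ ζ, m ζ ≠ 0 → r ≤ ‖z₀ - ζ‖) (hz : z ∈ Metric.ball z₀ (r / 2)) :
    Integrable fun ζ => Complex.log (1 + (z - z₀) / (z₀ - ζ)) * (m ζ : ℂ) := by
  refine hm.mono (aestronglyMeasurable_log_one_add_mul hm z₀ z) (Eventually.of_forall fun ζ => ?_)
  by_cases hζ : m ζ = 0
  · simp [hζ]
  · have hle := norm_sub_div_sub_le hr hz (hfar ζ hζ)
    rw [norm_mul, Complex.norm_real]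
    refine mul_le_of_le_one_left (norm_nonneg _)
      ((Complex.norm_log_one_add_half_le_self hle).trans ?_)
    linarith

theorem differentiableAt_integral_log_one_add_mul (hm : Integrable m) (hr : 0 < r)
    (hfar : ∀ ζ, m ζ ≠ 0 → r ≤ ‖z₀ - ζ‖) (hz : z ∈ Metric.ball z₀ (r / 2)) :
    DifferentiableAt ℂ
      (fun z => ∫ ζ, Complex.log (1 + (z - z₀) / (z₀ - ζ)) * (m ζ : ℂ)) z := by
  refine (hasDerivAt_integral_of_dominated_loc_of_deriv_le (𝕜 := ℂ)
    (F' := fun z ζ => (z - ζ)⁻¹ * (m ζ : ℂ)) (bound := fun ζ => 2 / r * ‖m ζ‖)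
    (Metric.isOpen_ball.mem_nhds hz)
    (Eventually.of_forall (aestronglyMeasurable_log_one_add_mul hm z₀))
    (integrable_log_one_add_mul hm hr hfar hz) ?_ (Eventually.of_forall fun ζ w hw => ?_)
    (hm.norm.const_mul _) (Eventually.of_forall fun ζ w hw => ?_)).2.differentiableAt
  · exact (by fun_prop : Measurable fun ζ : ℂ => (z - ζ)⁻¹).aestronglyMeasurable.mul
      hm.ofReal.aestronglyMeasurable
  · by_cases hζ : m ζ = 0
    · simp [hζ]
    · rw [norm_mul, Complex.norm_real]
      gcongr
      exact norm_inv_sub_le hr hw (hfar ζ hζ)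
  · by_cases hζ : m ζ = 0
    · simp only [hζ, Complex.ofReal_zero, mul_zero]
      exact hasDerivAt_const _ _
    · exact (hasDerivAt_log_one_add_sub_div_sub hr hw (hfar ζ hζ)).mul_const _

theorem IsLogDensity.logPotential_eq_add_re (hm : IsLogDensity m) (hr : 0 < r)
    (hfar : ∀ ζ, m ζ ≠ 0 → r ≤ ‖z₀ - ζ‖) (hz : z ∈ Metric.ball z₀ (r / 2)) :
    logPotential m z = logPotential m z₀ +
      2 * (∫ ζ, Complex.log (1 + (z - z₀) / (z₀ - ζ)) * (m ζ : ℂ)).re := by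
  have hint := integrable_log_one_add_mul hm.integrable hr hfar hz
  have hre := Complex.reCLM.integral_comp_comm hint
  have hreint := Complex.reCLM.integrable_comp hint
  simp only [Complex.reCLM_apply, Complex.re_mul_ofReal] at hre hreint
  rw [logPotential, logPotential, ← hre, ← integral_const_mul,
    ← integral_add (hm.integrable_log z₀) (hreint.const_mul 2)]
  refine integral_congr_ae (Eventually.of_forall fun ζ => ?_)
  by_cases hζ : m ζ = 0
  · simp [hζ]
  · simp only [log_norm_sub_sq_eq_add_re_log hr hz (hfar ζ hζ)]
    ring

/-- On a disc which does not meet the support, the potential is the real part of a holomorphic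
function up to a constant. -/
theorem IsLogDensity.harmonicOnNhd_logPotential (hm : IsLogDensity m) {O : Set ℂ}
    (hO : IsOpen O) (h0 : ∀ z ∈ O, m z = 0) :
    InnerProductSpace.HarmonicOnNhd (logPotential m) O := by
  intro z₀ hz₀
  obtain ⟨r, hr, hrO⟩ := Metric.isOpen_iff.1 hO z₀ hz₀
  have hfar : ∀ ζ, m ζ ≠ 0 → r ≤ ‖z₀ - ζ‖ := fun ζ hζ => by
    by_contra! h
    exact hζ (h0 ζ (hrO (mem_ball_iff_norm'.2 h)))
  have hball : Metric.ball z₀ (r / 2) ∈ 𝓝 z₀ := Metric.ball_mem_nhds _ (by positivity)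
  set Φ : ℂ → ℂ := fun z => ∫ ζ, Complex.log (1 + (z - z₀) / (z₀ - ζ)) * (m ζ : ℂ)
  have hΦ : AnalyticAt ℂ Φ z₀ := DifferentiableOn.analyticAt (fun z hz =>
    (differentiableAt_integral_log_one_add_mul hm.integrable hr hfar
      hz).differentiableWithinAt) hball
  have heq : logPotential m =ᶠ[𝓝 z₀]
      (fun _ => logPotential m z₀) + (2 : ℝ) • fun z => (Φ z).re := by
    filter_upwards [hball] with z hz
    exact hm.logPotential_eq_add_re hr hfar hz
  rw [InnerProductSpace.harmonicAt_congr_nhds heq]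
  exact (InnerProductSpace.harmonicAt_const _).add (hΦ.harmonicAt_re.const_smul)

end Harmonic

section Poisson

theorem logPotential_eq_convolution (G : ℂ → ℝ) :
    logPotential G = convolution (fun z : ℂ => Real.log (‖z‖ ^ 2)) G
      (ContinuousLinearMap.mul ℝ ℝ) volume := by
  ext z
  rw [convolution_def, logPotential,
    ← integral_sub_left_eq_self (fun ζ => Real.log (‖z - ζ‖ ^ 2) * G ζ) volume z]
  simp only [sub_sub_cancel, ContinuousLinearMap.mul_apply']

theorem locallyIntegrable_log_norm_sq : LocallyIntegrable fun ζ : ℂ => Real.log (‖ζ‖ ^ 2) := by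
  simpa using locallyIntegrable_log_norm_sub_sq 0

variable {G : ℂ → ℝ} {n : ℕ∞}

theorem contDiff_logPotential_of_hasCompactSupport (hG : ContDiff ℝ n G)
    (hGs : HasCompactSupport G) : ContDiff ℝ n (logPotential G) := by
  rw [logPotential_eq_convolution]
  exact hGs.contDiff_convolution_right _ locallyIntegrable_log_norm_sq hG

theorem fderiv_logPotential_of_hasCompactSupport (hG : ContDiff ℝ 1 G)
    (hGs : HasCompactSupport G) (v : ℂ) :
    (fderiv ℝ (logPotential G) · v) = logPotential (fderiv ℝ G · v) := by
  ext z
  rw [logPotential_eq_convolution, logPotential_eq_convolution,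
    (hGs.hasFDerivAt_convolution_right _ locallyIntegrable_log_norm_sq hG z).fderiv,
    convolution_precompR_apply _ locallyIntegrable_log_norm_sq (hGs.fderiv ℝ)
      (hG.continuous_fderiv one_ne_zero)]

theorem laplacian_logPotential_of_hasCompactSupport (hG : ContDiff ℝ 2 G)
    (hGs : HasCompactSupport G) (z : ℂ) :
    Δ (logPotential G) z = 4 * Real.pi * G z := by
  have hD (v : ℂ) : ContDiff ℝ 1 (fderiv ℝ G · v) :=
    contDiff_fderiv_apply hG one_add_one_eq_two.le v
  have hDs (v : ℂ) : HasCompactSupport (fderiv ℝ G · v) := hGs.fderiv_apply ℝ v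
  have hDD (v : ℂ) : fderiv ℝ (fderiv ℝ (logPotential G) · v) z v =
      ∫ ζ, Real.log (‖z - ζ‖ ^ 2) * fderiv ℝ (fderiv ℝ G · v) ζ v := by
    rw [fderiv_logPotential_of_hasCompactSupport (hG.of_le one_le_two) hGs]
    exact congrFun (fderiv_logPotential_of_hasCompactSupport (hD v) (hDs v) v) z
  have hint (v : ℂ) :
      Integrable fun ζ => Real.log (‖z - ζ‖ ^ 2) * fderiv ℝ (fderiv ℝ G · v) ζ v :=
    integrable_log_norm_sub_sq_mul z (contDiff_fderiv_apply (m := 0) (hD v) (by simp) v).continuous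
      ((hDs v).fderiv_apply ℝ v)
  let e := Complex.orthonormalBasisOneI
  calc Δ (logPotential G) z
      = ∑ i, ∫ ζ, Real.log (‖z - ζ‖ ^ 2) * fderiv ℝ (fderiv ℝ G · (e i)) ζ (e i) := by
        rw [laplacian_eq_sum_fderiv_fderiv e
          (contDiff_logPotential_of_hasCompactSupport hG hGs).contDiffAt]
        simp only [hDD]
    _ = ∫ ζ, Real.log (‖z - ζ‖ ^ 2) * Δ G ζ := by
        rw [← integral_finsetSum _ fun i _ => hint (e i)]
        refine integral_congr_ae (Eventually.of_forall fun ζ => ?_)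
        simp only [laplacian_eq_sum_fderiv_fderiv e hG.contDiffAt, Finset.mul_sum]
    _ = 4 * Real.pi * G z := integral_log_norm_sub_sq_mul_laplacian hG hGs z

theorem IsLogDensity.exists_logPotential_eq_add_harmonic {m : ℂ → ℝ} (hm : IsLogDensity m)
    (hs : ContDiff ℝ n m) (z : ℂ) : ∃ G h : ℂ → ℝ, ContDiff ℝ n G ∧ HasCompactSupport G ∧
      G z = m z ∧ InnerProductSpace.HarmonicAt h z ∧ logPotential m = logPotential G + h := by
  let χ : ContDiffBump z := ⟨1, 2, one_pos, one_lt_two⟩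
  have hG : ContDiff ℝ n fun w => χ w * m w := χ.contDiff.mul hs
  have hGs : HasCompactSupport fun w => χ w * m w := χ.hasCompactSupport.mul_right
  have hfar : IsLogDensity fun w => (1 - χ w) * m w :=
    hm.mono ((measurable_const.sub χ.continuous.measurable).mul hm.measurable)
      (fun w => mul_nonneg (sub_nonneg.2 χ.le_one) (hm.nonneg w))
      (fun w => mul_le_of_le_one_left (hm.nonneg w) (by linarith [χ.nonneg' w]))
  refine ⟨_, logPotential fun w => (1 - χ w) * m w, hG, hGs, ?_, ?_, ?_⟩
  · rw [χ.one_of_mem_closedBall (Metric.mem_closedBall_self χ.rIn_pos.le), one_mul]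
  · refine hfar.harmonicOnNhd_logPotential Metric.isOpen_ball (fun w hw => ?_) z
      (Metric.mem_ball_self one_pos)
    rw [χ.one_of_mem_closedBall (Metric.ball_subset_closedBall hw), sub_self, zero_mul]
  · ext w
    rw [Pi.add_apply, logPotential, logPotential, logPotential,
      ← integral_add (integrable_log_norm_sub_sq_mul w hG.continuous hGs) (hfar.integrable_log w)]
    refine integral_congr_ae (Eventually.of_forall fun ζ => ?_)
    ring

theorem IsLogDensity.contDiff_logPotential {m : ℂ → ℝ} (hm : IsLogDensity m)
    (hs : ContDiff ℝ n m) : ContDiff ℝ n (logPotential m) := by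
  refine contDiff_iff_contDiffAt.2 fun z => ?_
  obtain ⟨G, h, hG, hGs, -, hh, heq⟩ := hm.exists_logPotential_eq_add_harmonic hs z
  rw [heq]
  exact (contDiff_logPotential_of_hasCompactSupport hG hGs).contDiffAt.add
    (HarmonicAt.analyticAt hh).contDiffAt

theorem IsLogDensity.laplacian_logPotential {m : ℂ → ℝ} (hm : IsLogDensity m)
    (hs : ContDiff ℝ 2 m) (z : ℂ) : Δ (logPotential m) z = 4 * Real.pi * m z := by
  obtain ⟨G, h, hG, hGs, hGz, hh, heq⟩ := hm.exists_logPotential_eq_add_harmonic hs z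
  rw [heq, ContDiffAt.laplacian_add
    (contDiff_logPotential_of_hasCompactSupport hG hGs).contDiffAt hh.1, hh.2.self_of_nhds,
    laplacian_logPotential_of_hasCompactSupport hG hGs, hGz]
  simp only [Pi.zero_apply, add_zero]

end Poisson

section MaximumPrinciple

theorem circleAverage_lt_of_le_of_exists_lt {v : ℂ → ℝ} {c : ℂ} {r M : ℝ} (hr : 0 < r)
    (hv : ContinuousOn v (Metric.sphere c r)) (hle : ∀ z ∈ Metric.sphere c r, v z ≤ M)
    (hlt : ∃ z ∈ Metric.sphere c r, v z < M) : Real.circleAverage v c r < M := by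
  obtain ⟨z, hz, hzM⟩ := hlt
  obtain ⟨θ, hθ, rfl⟩ : ∃ θ ∈ Ioc (0 : ℝ) (2 * Real.pi), circleMap c r θ = z := by
    rwa [← abs_of_pos hr, ← image_circleMap_Ioc c r] at hz
  have hsphere (θ : ℝ) : circleMap c r θ ∈ Metric.sphere c r := circleMap_mem_sphere c hr.le θ
  rw [Real.circleAverage, smul_eq_mul, inv_mul_lt_iff₀ Real.two_pi_pos]
  calc ∫ θ in 0..2 * Real.pi, v (circleMap c r θ)
      < ∫ _ in 0..2 * Real.pi, M :=
        intervalIntegral.integral_lt_integral_of_continuousOn_of_le_of_exists_lt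
          Real.two_pi_pos
          (hv.comp (continuous_circleMap c r).continuousOn fun θ _ => hsphere θ)
          continuousOn_const (fun θ _ => hle _ (hsphere θ)) ⟨θ, Ioc_subset_Icc_self hθ, hzM⟩
    _ = 2 * Real.pi * M := by
        rw [intervalIntegral.integral_const, sub_zero, smul_eq_mul]

theorem nonpos_of_submean {K : Set ℂ} (hK : IsCompact K) {v : ℂ → ℝ} (hv : ContinuousOn v K)
    (hsub : ∀ z ∈ interior K, 0 < v z → ∀ᶠ r in 𝓝[>] (0 : ℝ), v z ≤ Real.circleAverage v z r)
    (hf : ∀ z ∈ frontier K, v z ≤ 0) : ∀ z ∈ K, v z ≤ 0 := by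
  by_contra! hcon
  obtain ⟨z₁, hz₁, hpos⟩ := hcon
  obtain ⟨z₀, hz₀, hmax⟩ := hK.exists_isMaxOn ⟨z₁, hz₁⟩ hv
  have hM : 0 < v z₀ := hpos.trans_le (hmax hz₁)
  have hE : IsCompact (K ∩ v ⁻¹' {v z₀}) :=
    hK.of_isClosed_subset (hv.preimage_isClosed_of_isClosed hK.isClosed isClosed_singleton)
      inter_subset_left
  /- At a rightmost maximum point, small circles contain points where `v` is smaller. -/
  obtain ⟨z₂, ⟨hz₂, hz₂M : v z₂ = v z₀⟩, hre⟩ :=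
    hE.exists_isMaxOn ⟨z₀, hz₀, rfl⟩ Complex.continuous_re.continuousOn
  have hint : z₂ ∈ interior K := by
    by_contra h
    have := hf z₂ (hK.isClosed.frontier_eq ▸ ⟨hz₂, h⟩)
    linarith
  obtain ⟨ε, hε, hball⟩ := Metric.isOpen_iff.1 isOpen_interior z₂ hint
  obtain ⟨r, hle, hr0, hrε⟩ := ((hsub z₂ hint (hz₂M ▸ hM)).and (Ioo_mem_nhdsGT hε)).exists
  have hsphere : Metric.sphere z₂ r ⊆ K := fun z hz => interior_subset <| hball <|
    Metric.mem_ball.2 ((Metric.mem_sphere.1 hz).trans_lt hrε)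
  have hmem : z₂ + (r : ℂ) ∈ Metric.sphere z₂ r := by simp [abs_of_pos hr0]
  refine hle.not_gt ?_
  rw [hz₂M]
  refine circleAverage_lt_of_le_of_exists_lt hr0 (hv.mono hsphere)
    (fun z hz => hmax (hsphere hz)) ⟨_, hmem, (hmax (hsphere hmem)).lt_of_ne fun h => ?_⟩
  have : (z₂ + (r : ℂ)).re ≤ z₂.re := hre ⟨hsphere hmem, h⟩
  simp only [Complex.add_re, Complex.ofReal_re] at this
  linarith

theorem circleAverage_eq_of_harmonicAt {h : ℂ → ℝ} {z : ℂ}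
    (hh : InnerProductSpace.HarmonicAt h z) :
    ∀ᶠ r in 𝓝[>] (0 : ℝ), Real.circleAverage h z r = h z := by
  obtain ⟨ε, hε, hball⟩ := Metric.isOpen_iff.1
    (InnerProductSpace.isOpen_setOfPred_harmonicAt (f := h)) z hh
  filter_upwards [Ioo_mem_nhdsGT hε] with r hr
  refine InnerProductSpace.HarmonicOnNhd.circleAverage_eq fun w hw => hball ?_
  rw [abs_of_pos hr.1] at hw
  exact lt_of_le_of_lt hw hr.2

end MaximumPrinciple

/-! ### Graph coordinates at a boundary point -/

/-- The Euclidean coordinates `(p, q) ↦ x₀ + (p + q i) u` in which `IsSmoothFamily` describes the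
domains; `u` is a unit vector, tangential at `x₀`. -/
def boxMap (x₀ u : ℂ) (q : ℝ × ℝ) : ℂ := x₀ + ((q.1 : ℂ) + (q.2 : ℂ) * Complex.I) * u

/-- The inverse of `boxMap x₀ u`, for a unit vector `u`. -/
def boxCoord (x₀ u z : ℂ) : ℝ × ℝ :=
  (((z - x₀) * (starRingEnd ℂ) u).re, ((z - x₀) * (starRingEnd ℂ) u).im)

/-- The rectangle `|p| < δ`, `|q| < ε` in the coordinates `boxMap x₀ u`. -/
def box (x₀ u : ℂ) (δ ε : ℝ) : Set ℂ := boxCoord x₀ u ⁻¹' (Ioo (-δ) δ ×ˢ Ioo (-ε) ε)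

@[fun_prop]
theorem continuous_boxMap (x₀ u : ℂ) : Continuous (boxMap x₀ u) := by
  unfold boxMap
  fun_prop

@[fun_prop]
theorem continuous_boxCoord (x₀ u : ℂ) : Continuous (boxCoord x₀ u) := by
  unfold boxCoord
  fun_prop

theorem isOpen_box (x₀ u : ℂ) (δ ε : ℝ) : IsOpen (box x₀ u δ ε) :=
  (isOpen_Ioo.prod isOpen_Ioo).preimage (by fun_prop)

section

variable {x₀ u : ℂ} {δ ε : ℝ}

theorem mul_conj_of_norm_eq_one (hu : ‖u‖ = 1) : u * (starRingEnd ℂ) u = 1 := by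
  rw [Complex.mul_conj, Complex.normSq_eq_norm_sq, hu, one_pow, Complex.ofReal_one]

theorem boxCoord_boxMap (hu : ‖u‖ = 1) (q : ℝ × ℝ) : boxCoord x₀ u (boxMap x₀ u q) = q := by
  simp [boxCoord, boxMap, mul_assoc, mul_conj_of_norm_eq_one hu]

theorem boxMap_boxCoord (hu : ‖u‖ = 1) (z : ℂ) : boxMap x₀ u (boxCoord x₀ u z) = z := by
  rw [boxMap, boxCoord, Complex.re_add_im, mul_assoc, mul_comm _ u, mul_conj_of_norm_eq_one hu,
    mul_one, add_sub_cancel]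

theorem boxMap_mem_box (hu : ‖u‖ = 1) {q : ℝ × ℝ} :
    boxMap x₀ u q ∈ box x₀ u δ ε ↔ q ∈ Ioo (-δ) δ ×ˢ Ioo (-ε) ε := by
  rw [box, mem_preimage, boxCoord_boxMap hu]

theorem boxMap_zero : boxMap x₀ u (0, 0) = x₀ := by simp [boxMap]

theorem center_mem_box (hδ : 0 < δ) (hε : 0 < ε) : x₀ ∈ box x₀ u δ ε := by
  simp [box, boxCoord, hδ, hε]

theorem box_subset_ball (hu : ‖u‖ = 1) {η : ℝ} (h : δ + ε ≤ η) :
    box x₀ u δ ε ⊆ Metric.ball x₀ η := by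
  intro z ⟨hx, hy⟩
  rw [mem_ball_iff_norm, ← boxMap_boxCoord hu (x₀ := x₀) z, boxMap, add_sub_cancel_left, norm_mul,
    hu, mul_one]
  refine (norm_add_le _ _).trans_lt ?_
  rw [norm_mul, Complex.norm_I, mul_one, Complex.norm_real, Complex.norm_real, Real.norm_eq_abs,
    Real.norm_eq_abs]
  linarith [abs_lt.2 hx, abs_lt.2 hy]

/-- In the box `box x₀ u δ ε` the set `D` is the subgraph of `c`, in the coordinates
`boxMap x₀ u`. -/
def IsSubgraphOn (D : Set ℂ) (x₀ u : ℂ) (c : ℝ → ℝ) (δ ε : ℝ) : Prop :=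
  ∀ x ∈ Ioo (-δ) δ, ∀ y ∈ Ioo (-ε) ε, (boxMap x₀ u (x, y) ∈ D ↔ y < c x)

namespace IsSubgraphOn

variable {D : Set ℂ} {c : ℝ → ℝ} {x y : ℝ}

theorem mem_iff_boxCoord (h : IsSubgraphOn D x₀ u c δ ε) (hu : ‖u‖ = 1) {z : ℂ}
    (hz : z ∈ box x₀ u δ ε) : z ∈ D ↔ (boxCoord x₀ u z).2 < c (boxCoord x₀ u z).1 := by
  simpa only [Prod.mk.eta, boxMap_boxCoord hu] using h _ hz.1 _ hz.2

theorem mem_closure (h : IsSubgraphOn D x₀ u c δ ε) (hx : x ∈ Ioo (-δ) δ)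
    (hy : y ∈ Ioo (-ε) ε) (hle : y ≤ c x) : boxMap x₀ u (x, y) ∈ closure D := by
  have hc : Tendsto (fun s : ℝ => boxMap x₀ u (x, s)) (𝓝[<] y) (𝓝 (boxMap x₀ u (x, y))) :=
    ((by fun_prop : Continuous fun s : ℝ => boxMap x₀ u (x, s)).tendsto y).mono_left
      nhdsWithin_le_nhds
  refine mem_closure_of_tendsto hc ?_
  filter_upwards [Ioo_mem_nhdsLT hy.1] with s hs
  exact (h x hx s ⟨hs.1, hs.2.trans hy.2⟩).2 (hs.2.trans_le hle)

theorem notMem_closure (h : IsSubgraphOn D x₀ u c δ ε) (hu : ‖u‖ = 1) (hx : x ∈ Ioo (-δ) δ)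
    (hy : y ∈ Ioo (-ε) ε) (hc : ContinuousAt c x) (hlt : c x < y) :
    boxMap x₀ u (x, y) ∉ closure D := by
  have hcoord : ContinuousAt (boxCoord x₀ u) (boxMap x₀ u (x, y)) := by fun_prop
  have habove : ∀ᶠ z in 𝓝 (boxMap x₀ u (x, y)),
      c (boxCoord x₀ u z).1 < (boxCoord x₀ u z).2 := by
    rw [ContinuousAt, boxCoord_boxMap hu, nhds_prod_eq] at hcoord
    exact (hc.tendsto.comp hcoord.fst).eventually_lt hcoord.snd hlt
  have hbox := (isOpen_box x₀ u δ ε).mem_nhds ((boxMap_mem_box hu).2 (mk_mem_prod hx hy))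
  intro hcl
  obtain ⟨z, hzD, hz, hzbox⟩ :=
    ((mem_closure_iff_frequently.1 hcl).and_eventually (habove.and hbox)).exists
  exact lt_asymm hz ((h.mem_iff_boxCoord hu hzbox).1 hzD)

theorem mem_frontier_iff (h : IsSubgraphOn D x₀ u c δ ε) (hu : ‖u‖ = 1) (hD : IsOpen D)
    (hx : x ∈ Ioo (-δ) δ) (hy : y ∈ Ioo (-ε) ε) (hc : ContinuousAt c x) :
    boxMap x₀ u (x, y) ∈ frontier D ↔ y = c x := by
  rw [hD.frontier_eq, Set.mem_sdiff, h x hx y hy, not_lt]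
  refine ⟨fun ⟨hcl, hle⟩ => hle.antisymm' ?_, fun heq => ⟨h.mem_closure hx hy heq.le, heq.ge⟩⟩
  by_contra! hlt
  exact h.notMem_closure hu hx hy hc hlt hcl

end IsSubgraphOn

end

/-- Near `x₀` and for `t` near `t₀`, the set `Ω t` is the subgraph of `γ (·, t)` in the coordinates
`boxMap x₀ u`, and this graph stays in the box. -/
structure IsGraphBox (Ω : ℝ → Set ℂ) (t₀ : ℝ) (x₀ u : ℂ) (γ : ℝ × ℝ → ℝ) (δ ε : ℝ) : Prop where
  norm_eq : ‖u‖ = 1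
  delta_pos : 0 < δ
  eps_pos : 0 < ε
  smooth : ContDiffOn ℝ ∞ γ (Ioo (-δ) δ ×ˢ Ioo (t₀ - δ) (t₀ + δ))
  mem_Ioo : ∀ x ∈ Ioo (-δ) δ, ∀ t ∈ Ioo (t₀ - δ) (t₀ + δ), γ (x, t) ∈ Ioo (-ε) ε
  subgraph : ∀ t ∈ Ioo (t₀ - δ) (t₀ + δ), IsSubgraphOn (Ω t) x₀ u (fun x => γ (x, t)) δ ε

namespace IsGraphBox

variable {Ω : ℝ → Set ℂ} {t₀ : ℝ} {x₀ u : ℂ} {γ : ℝ × ℝ → ℝ} {δ ε : ℝ}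

theorem contDiffAt (h : IsGraphBox Ω t₀ x₀ u γ δ ε) {x t : ℝ} (hx : x ∈ Ioo (-δ) δ)
    (ht : t ∈ Ioo (t₀ - δ) (t₀ + δ)) : ContDiffAt ℝ ∞ γ (x, t) :=
  h.smooth.contDiffAt ((isOpen_Ioo.prod isOpen_Ioo).mem_nhds ⟨hx, ht⟩)

theorem contDiffAt_space (h : IsGraphBox Ω t₀ x₀ u γ δ ε) {x t : ℝ} (hx : x ∈ Ioo (-δ) δ)
    (ht : t ∈ Ioo (t₀ - δ) (t₀ + δ)) : ContDiffAt ℝ ∞ (fun s => γ (s, t)) x :=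
  (h.contDiffAt hx ht).comp x (by fun_prop)

theorem time_mem (h : IsGraphBox Ω t₀ x₀ u γ δ ε) : t₀ ∈ Ioo (t₀ - δ) (t₀ + δ) :=
  ⟨sub_lt_self t₀ h.delta_pos, lt_add_of_pos_right t₀ h.delta_pos⟩

theorem center_mem (h : IsGraphBox Ω t₀ x₀ u γ δ ε) : x₀ ∈ box x₀ u δ ε :=
  center_mem_box h.delta_pos h.eps_pos

theorem mem_frontier (h : IsGraphBox Ω t₀ x₀ u γ δ ε) {x t : ℝ} (hx : x ∈ Ioo (-δ) δ)
    (ht : t ∈ Ioo (t₀ - δ) (t₀ + δ)) (ho : IsOpen (Ω t)) :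
    boxMap x₀ u (x, γ (x, t)) ∈ frontier (Ω t) :=
  ((h.subgraph t ht).mem_frontier_iff h.norm_eq ho hx (h.mem_Ioo x hx t ht)
    (h.contDiffAt_space hx ht).continuousAt).2 rfl

end IsGraphBox

theorem exists_lt_mapsTo_of_continuousAt {X Y Z : Type*} [PseudoMetricSpace X]
    [PseudoMetricSpace Y] [TopologicalSpace Z] {γ : X × Y → Z} {x₀ : X} {t₀ : Y}
    (hγ : ContinuousAt γ (x₀, t₀)) {W : Set Z} (hW : W ∈ 𝓝 (γ (x₀, t₀))) {T : Set Y}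
    (hT : T ∈ 𝓝 t₀) {ε : ℝ} (hε : 0 < ε) :
    ∃ δ, 0 < δ ∧ δ ≤ ε ∧ Metric.ball t₀ δ ⊆ T ∧
      MapsTo γ (Metric.ball x₀ δ ×ˢ Metric.ball t₀ δ) W := by
  have hnhds : γ ⁻¹' W ∩ Prod.snd ⁻¹' T ∈ 𝓝 (x₀, t₀) :=
    inter_mem (hγ hW) (continuousAt_snd hT)
  obtain ⟨δ, hδ, hball⟩ := Metric.mem_nhds_iff.1 hnhds
  rw [← ball_prod_same] at hball
  have hle := Metric.ball_subset_ball (x := t₀) (min_le_left δ ε)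
  refine ⟨min δ ε, lt_min hδ hε, min_le_right _ _, fun t ht => ?_, fun q hq => ?_⟩
  · exact (hball (mk_mem_prod (Metric.mem_ball_self hδ) (hle ht))).2
  · exact (hball ⟨Metric.ball_subset_ball (min_le_left δ ε) hq.1, hle hq.2⟩).1

namespace IsSmoothFamily

variable {Ω : ℝ → Set ℂ} {a b t₀ : ℝ}

theorem exists_isGraphBox (hΩ : IsSmoothFamily Ω a b) (ht₀ : t₀ ∈ Ioo a b) {x₀ : ℂ}
    (hx₀ : x₀ ∈ frontier (Ω t₀)) {η : ℝ} (hη : 0 < η) :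
    ∃ (u : ℂ) (γ : ℝ × ℝ → ℝ) (δ ε : ℝ), IsGraphBox Ω t₀ x₀ u γ δ ε ∧
      box x₀ u δ ε ⊆ Metric.ball x₀ η ∧ Ioo (t₀ - δ) (t₀ + δ) ⊆ Ioo a b := by
  obtain ⟨u, γ, ε₀, hu, hε₀, hγ, hiff⟩ := hΩ.local_graph t₀ ht₀ x₀ hx₀
  have hzero : (0 : ℝ) ∈ Ioo (-ε₀) ε₀ := ⟨neg_lt_zero.2 hε₀, hε₀⟩
  have htime : t₀ ∈ Ioo (t₀ - ε₀) (t₀ + ε₀) := ⟨sub_lt_self t₀ hε₀, lt_add_of_pos_right t₀ hε₀⟩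
  have hcont : ContinuousAt γ (0, t₀) :=
    (hγ.contDiffAt ((isOpen_Ioo.prod isOpen_Ioo).mem_nhds ⟨hzero, htime⟩)).continuousAt
  have hgraph : ∀ t ∈ Ioo (t₀ - ε₀) (t₀ + ε₀),
      IsSubgraphOn (Ω t) x₀ u (fun x => γ (x, t)) ε₀ ε₀ :=
    fun t ht x hx y hy => hiff x hx y hy t ht
  have hγ0 : 0 = γ (0, t₀) :=
    ((hgraph t₀ htime).mem_frontier_iff hu (hΩ.isOpen t₀ ht₀) hzero hzero
      (hcont.comp (f := fun x => (x, t₀)) (by fun_prop))).1 (by rwa [boxMap_zero])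
  obtain ⟨ε, hε, hεε₀, hεη⟩ : ∃ ε, 0 < ε ∧ ε ≤ ε₀ ∧ ε ≤ η / 2 :=
    ⟨min ε₀ (η / 2), lt_min hε₀ (half_pos hη), min_le_left _ _, min_le_right _ _⟩
  obtain ⟨δ, hδ, hδε, hT, hmaps⟩ := exists_lt_mapsTo_of_continuousAt hcont
    (hγ0 ▸ Ioo_mem_nhds (neg_lt_zero.2 hε) hε) (Ioo_mem_nhds ht₀.1 ht₀.2) hε
  simp only [Real.ball_eq_Ioo, zero_sub, zero_add] at hT hmaps
  have hspace : Ioo (-δ) δ ⊆ Ioo (-ε₀) ε₀ := Ioo_subset_Ioo (by linarith) (by linarith)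
  have hheight : Ioo (-ε) ε ⊆ Ioo (-ε₀) ε₀ := Ioo_subset_Ioo (by linarith) hεε₀
  have hinterval : Ioo (t₀ - δ) (t₀ + δ) ⊆ Ioo (t₀ - ε₀) (t₀ + ε₀) :=
    Ioo_subset_Ioo (by linarith) (by linarith)
  exact ⟨u, γ, δ, ε, ⟨hu, hδ, hε, hγ.mono (prod_mono hspace hinterval),
    fun x hx t ht => hmaps (mk_mem_prod hx ht), fun t ht x hx y hy =>
    hgraph t (hinterval ht) x (hspace hx) y (hheight hy)⟩, box_subset_ball hu (by linarith), hT⟩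

end IsSmoothFamily

/-! ### Stability of the domains in time -/

theorem subset_or_disjoint_of_disjoint_frontier {X : Type*} [TopologicalSpace X] {K D : Set X}
    (hK : IsPreconnected K) (hd : Disjoint K (frontier D)) : K ⊆ D ∨ Disjoint K D := by
  have hcover : K ⊆ interior D ∪ (closure D)ᶜ := by
    intro v hv
    by_contra! hcon
    simp only [mem_union, mem_compl_iff, not_or, not_not] at hcon
    exact disjoint_left.1 hd hv ⟨hcon.2, hcon.1⟩
  have hdisj : Disjoint (interior D) (closure D)ᶜ :=
    disjoint_compl_right.mono_left (interior_subset.trans subset_closure)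
  refine (hK.subset_or_subset isOpen_interior isClosed_closure.isOpen_compl hdisj hcover).imp
    (fun h => h.trans interior_subset) fun h => ?_
  exact (disjoint_compl_left.mono_right subset_closure).mono_left h

theorem exists_mem_closedBall_inter_nhds_disjoint {E : Type*} [NormedAddCommGroup E]
    [NormedSpace ℝ E] [ProperSpace E] {S : Set E} (hS : IsClosed S) (hne : S.Nonempty) {z : E}
    (hz : z ∉ S) :
    ∃ x ∈ S, ∀ U ∈ 𝓝 x, ∃ r > 0, Disjoint (Metric.closedBall z r) S ∧
      (Metric.closedBall z r ∩ U).Nonempty := by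
  obtain ⟨x, hx, hdist⟩ := hS.exists_infDist_eq_dist hne z
  have hpos : 0 < dist z x := dist_pos.2 fun h => hz (h ▸ hx)
  refine ⟨x, hx, fun U hU => ?_⟩
  have hline : Tendsto (fun s : ℝ => AffineMap.lineMap x z s) (𝓝[>] 0) (𝓝 x) := by
    have h := (AffineMap.lineMap_continuous (R := ℝ) (p := x) (q := z)).tendsto 0
    rw [AffineMap.lineMap_apply_zero] at h
    exact h.mono_left nhdsWithin_le_nhds
  obtain ⟨s, hsU, hs0, hs1⟩ := ((hline.eventually hU).and (Ioo_mem_nhdsGT one_pos)).exists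
  have hdist_line : dist (AffineMap.lineMap x z s) z = (1 - s) * dist z x := by
    rw [dist_lineMap_right, Real.norm_of_nonneg (by linarith), dist_comm x z]
  refine ⟨(1 - s) * dist z x, mul_pos (by linarith) hpos, ?_, _, hdist_line.le, hsU⟩
  refine disjoint_left.2 fun w hw hwS => ?_
  have hle := hdist.ge.trans (Metric.infDist_le_dist_of_mem (x := z) hwS)
  rw [Metric.mem_closedBall, dist_comm] at hw
  nlinarith

theorem IsGraphBox.eventually_mem_iff {Ω : ℝ → Set ℂ} {t₀ : ℝ} {x₀ u : ℂ} {γ : ℝ × ℝ → ℝ}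
    {δ ε : ℝ} (h : IsGraphBox Ω t₀ x₀ u γ δ ε) (ho : IsOpen (Ω t₀)) {z : ℂ}
    (hz : z ∈ box x₀ u δ ε) (hzf : z ∉ frontier (Ω t₀)) :
    ∀ᶠ t in 𝓝 t₀, (z ∈ Ω t ↔ z ∈ Ω t₀) := by
  set x := (boxCoord x₀ u z).1
  set y := (boxCoord x₀ u z).2
  have hcont : ContinuousAt (fun t => γ (x, t)) t₀ :=
    (h.contDiffAt hz.1 h.time_mem).continuousAt.comp (f := fun t => (x, t)) (by fun_prop)
  have hne : y ≠ γ (x, t₀) := by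
    rwa [Ne, ← (h.subgraph t₀ h.time_mem).mem_frontier_iff h.norm_eq ho hz.1 hz.2
      (h.contDiffAt_space hz.1 h.time_mem).continuousAt, boxMap_boxCoord h.norm_eq]
  have hside : ∀ᶠ t in 𝓝 t₀, (y < γ (x, t) ↔ y < γ (x, t₀)) := by
    rcases hne.lt_or_gt with hlt | hgt
    · filter_upwards [hcont.eventually_const_lt hlt] with t ht using iff_of_true ht hlt
    · filter_upwards [hcont.eventually_lt_const hgt] with t ht
        using iff_of_false ht.not_gt hgt.not_gt
  filter_upwards [hside, Ioo_mem_nhds h.time_mem.1 h.time_mem.2] with t ht ht'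
  rw [(h.subgraph t ht').mem_iff_boxCoord h.norm_eq hz,
    (h.subgraph t₀ h.time_mem).mem_iff_boxCoord h.norm_eq hz]
  exact ht

theorem IsSmoothFamily.eventually_subset_or_disjoint {Ω : ℝ → Set ℂ} {a b t₀ : ℝ}
    (hΩ : IsSmoothFamily Ω a b) (ht₀ : t₀ ∈ Ioo a b) (hne : (Ω t₀).Nonempty) {z : ℂ}
    (hz : z ∉ frontier (Ω t₀)) :
    ∃ K ∈ 𝓝 z, ∀ᶠ t in 𝓝 t₀, (z ∈ Ω t₀ → K ⊆ Ω t) ∧ (z ∉ Ω t₀ → Disjoint K (Ω t)) := by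
  have hfrontier : (frontier (Ω t₀)).Nonempty := nonempty_frontier_iff.2
    ⟨hne, fun h => NormedSpace.unbounded_univ ℝ ℂ (h ▸ hΩ.isBounded t₀ ht₀)⟩
  obtain ⟨x, hx, hball⟩ := exists_mem_closedBall_inter_nhds_disjoint isClosed_frontier hfrontier hz
  obtain ⟨u, γ, δ, ε, hbox, -, -⟩ := hΩ.exists_isGraphBox ht₀ hx one_pos
  obtain ⟨r, hr, hdisj, y, hyK, hy⟩ := hball _ ((isOpen_box x u δ ε).mem_nhds hbox.center_mem)
  have hconn : IsPreconnected (Metric.closedBall z r) := (convex_closedBall z r).isPreconnected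
  have hzK : z ∈ Metric.closedBall z r := Metric.mem_closedBall_self hr.le
  refine ⟨_, Metric.closedBall_mem_nhds z hr, ?_⟩
  filter_upwards [hΩ.frontier_near t₀ ht₀ _ Metric.isClosed_closedBall.isOpen_compl
    hdisj.subset_compl_left, hbox.eventually_mem_iff (hΩ.isOpen t₀ ht₀) hy
    (disjoint_left.1 hdisj hyK)] with t hfar hiff
  have hsplit₀ := subset_or_disjoint_of_disjoint_frontier hconn hdisj
  have hsplit := subset_or_disjoint_of_disjoint_frontier hconn
    (disjoint_compl_right.mono_right hfar)
  constructor
  · intro hzt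
    have hyt : y ∈ Ω t :=
      hiff.2 (hsplit₀.resolve_right (not_disjoint_iff.2 ⟨z, hzK, hzt⟩) hyK)
    exact hsplit.resolve_right (not_disjoint_iff.2 ⟨y, hyK, hyt⟩)
  · intro hzt
    have hdisj₀ := hsplit₀.resolve_left fun h => hzt (h hzK)
    exact hsplit.resolve_left fun h => disjoint_left.1 hdisj₀ hyK (hiff.1 (h hyK))

/-! ### Integrals over a moving subgraph -/

section

variable {x₀ u : ℂ}

theorem measurePreserving_boxMap (hu : ‖u‖ = 1) : MeasurePreserving (boxMap x₀ u) := by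
  have hcomplex : MeasurePreserving fun q : ℝ × ℝ => (q.1 : ℂ) + (q.2 : ℂ) * Complex.I := by
    convert Complex.volume_preserving_equiv_real_prod.symm using 1
    ext q
    exact (Complex.mk_eq_add_mul_I q.1 q.2).symm
  have hrotation : MeasurePreserving fun z : ℂ => z * u := by
    convert (rotation ⟨u, mem_sphere_zero_iff_norm.2 hu⟩).measurePreserving using 1
    ext z
    exact mul_comm z u
  exact (measurePreserving_add_left volume x₀).comp (hrotation.comp hcomplex)

theorem measurableEmbedding_boxMap (hu : ‖u‖ = 1) : MeasurableEmbedding (boxMap x₀ u) :=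
  (continuous_boxMap x₀ u).measurableEmbedding
    (Function.LeftInverse.injective (boxCoord_boxMap hu))

theorem integral_eq_integral_boxMap (hu : ‖u‖ = 1) {f : ℂ → ℝ} (hf : Integrable f) :
    ∫ z, f z = ∫ x : ℝ, ∫ y : ℝ, f (boxMap x₀ u (x, y)) := by
  rw [← (measurePreserving_boxMap (x₀ := x₀) hu).integral_comp (measurableEmbedding_boxMap hu) f]
  exact integral_prod _ (((measurePreserving_boxMap hu).integrable_comp_emb
    (measurableEmbedding_boxMap hu)).2 hf)

variable {D : Set ℂ} {c : ℝ → ℝ} {r ε : ℝ} {f : ℂ → ℝ}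

theorem apply_boxMap_eq_zero (hu : ‖u‖ = 1) (hf : Function.support f ⊆ box x₀ u r ε) {q : ℝ × ℝ}
    (hq : q ∉ Ioo (-r) r ×ˢ Ioo (-ε) ε) : f (boxMap x₀ u q) = 0 :=
  Function.notMem_support.1 fun h => hq ((boxMap_mem_box hu).1 (hf h))

theorem IsSubgraphOn.setIntegral_eq (h : IsSubgraphOn D x₀ u c r ε) (hu : ‖u‖ = 1) (hr : 0 ≤ r)
    (hD : MeasurableSet D) (hf : Function.support f ⊆ box x₀ u r ε) (hint : IntegrableOn f D) :
    ∫ z in D, f z = ∫ x in (-r)..r, ∫ y in Iic (c x), f (boxMap x₀ u (x, y)) := by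
  rw [← integral_indicator hD,
    integral_eq_integral_boxMap (x₀ := x₀) hu (hint.integrable_indicator hD),
    intervalIntegral.integral_of_le (by linarith), integral_Ioc_eq_integral_Ioo,
    ← setIntegral_eq_integral_of_forall_compl_eq_zero (s := Ioo (-r) r)]
  · refine setIntegral_congr_fun measurableSet_Ioo fun x hx => ?_
    rw [integral_Iic_eq_integral_Iio, ← integral_indicator measurableSet_Iio]
    congr 1 with y
    by_cases hy : y ∈ Ioo (-ε) ε
    · simp only [indicator, h x hx y hy, mem_Iio]
    · have hzero : f (boxMap x₀ u (x, y)) = 0 := apply_boxMap_eq_zero hu hf fun hq => hy hq.2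
      simp only [indicator, hzero, ite_self]
  · intro x hx
    have hzero : ∀ y, f (boxMap x₀ u (x, y)) = 0 :=
      fun y => apply_boxMap_eq_zero hu hf fun hq => hx hq.1
    simp only [indicator, hzero, ite_self, integral_zero]

end

theorem setIntegral_Iic_eq_intervalIntegral {E : Type*} [NormedAddCommGroup E] [NormedSpace ℝ E]
    {g : ℝ → E} {a c : ℝ} (hac : a ≤ c) (hg : ∀ y ≤ a, g y = 0) :
    ∫ y in Iic c, g y = ∫ y in a..c, g y := by
  rw [intervalIntegral.integral_of_le hac]
  refine setIntegral_eq_of_subset_of_forall_sdiff_eq_zero measurableSet_Iic Ioc_subset_Iic_self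
    fun y hy => hg y ?_
  exact not_lt.1 fun hlt => hy.2 ⟨hlt, hy.1⟩

theorem hasDerivAt_comp_prodMk_left {E : Type*} [NormedAddCommGroup E] [NormedSpace ℝ E]
    {γ : ℝ × ℝ → E} {x t : ℝ} (hγ : DifferentiableAt ℝ γ (x, t)) :
    HasDerivAt (fun t => γ (x, t)) (fderiv ℝ γ (x, t) (0, 1)) t :=
  hγ.hasFDerivAt.comp_hasDerivAt t ((hasDerivAt_const t x).prodMk (hasDerivAt_id t))

theorem hasDerivAt_integral_integral_graph {E : Type*} [NormedAddCommGroup E] [NormedSpace ℝ E]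
    [CompleteSpace E] {h : ℝ × ℝ → E} (hh : Continuous h) {γ : ℝ × ℝ → ℝ} {S T : Set ℝ}
    (hS : IsOpen S) (hT : IsOpen T) (hγ : ContDiffOn ℝ 1 γ (S ×ˢ T)) {a b : ℝ}
    (hab : uIcc a b ⊆ S) {t₀ : ℝ} (ht₀ : t₀ ∈ T) (e : ℝ) :
    HasDerivAt (fun t => ∫ x in a..b, ∫ y in e..γ (x, t), h (x, y))
      (∫ x in a..b, fderiv ℝ γ (x, t₀) (0, 1) • h (x, γ (x, t₀))) t₀ := by
  set A : ℝ → ℝ → E := fun x c => ∫ y in e..c, h (x, y)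
  have hA : Continuous fun q : ℝ × ℝ => A q.1 q.2 :=
    intervalIntegral.continuous_parametric_primitive_of_continuous
      (f := fun x y => h (x, y)) (μ := volume) (a₀ := e) hh
  have hAderiv : ∀ x c, HasDerivAt (A x) (h (x, c)) c := fun x c =>
    (hh.comp (by fun_prop : Continuous fun y => (x, y))).integral_hasStrictDerivAt e c
      |>.hasDerivAt
  have hγderiv : ∀ x ∈ S, ∀ t ∈ T, HasDerivAt (fun t => γ (x, t)) (fderiv ℝ γ (x, t) (0, 1)) t :=
    fun x hx t ht => hasDerivAt_comp_prodMk_left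
      ((hγ.contDiffAt ((hS.prod hT).mem_nhds ⟨hx, ht⟩)).differentiableAt one_ne_zero)
  have hderivCont : ContinuousOn
      (fun q : ℝ × ℝ => fderiv ℝ γ q (0, 1) • h (q.1, γ q)) (S ×ˢ T) :=
    ((hγ.continuousOn_fderiv_of_isOpen (hS.prod hT) le_rfl).clm_apply continuousOn_const).smul
      (hh.comp_continuousOn (continuousOn_fst.prodMk hγ.continuousOn))
  have hslice : ∀ t ∈ T, ContinuousOn (fun x => (x, t)) (uIcc a b) ∧
      MapsTo (fun x => (x, t)) (uIcc a b) (S ×ˢ T) :=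
    fun t ht => ⟨by fun_prop, fun x hx => ⟨hab hx, ht⟩⟩
  have hAcont : ∀ t ∈ T, ContinuousOn (fun x => A x (γ (x, t))) (uIcc a b) := fun t ht =>
    hA.comp_continuousOn
      (continuousOn_id.prodMk (hγ.continuousOn.comp (hslice t ht).1 (hslice t ht).2))
  have hmeas : ∀ {g : ℝ → E}, ContinuousOn g (uIcc a b) →
      AEStronglyMeasurable g (volume.restrict (Ι a b)) := fun hg =>
    (hg.aestronglyMeasurable measurableSet_uIcc).mono_measure
      (Measure.restrict_mono uIoc_subset_uIcc le_rfl)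
  obtain ⟨r, hr, hrT⟩ := Metric.nhds_basis_closedBall.mem_iff.1 (hT.mem_nhds ht₀)
  obtain ⟨C, hC⟩ := (isCompact_uIcc.prod (isCompact_closedBall t₀ r)).exists_bound_of_continuousOn
    (hderivCont.mono (prod_mono hab hrT))
  refine (intervalIntegral.hasDerivAt_integral_of_dominated_loc_of_deriv_le
    (F := fun t x => A x (γ (x, t)))
    (F' := fun t x => fderiv ℝ γ (x, t) (0, 1) • h (x, γ (x, t)))
    (bound := fun _ => C) (Metric.closedBall_mem_nhds t₀ hr)
    ?_ (hAcont t₀ ht₀).intervalIntegrable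
    (hmeas (hderivCont.comp (hslice t₀ ht₀).1 (hslice t₀ ht₀).2)) ?_ intervalIntegrable_const ?_).2
  · filter_upwards [hT.mem_nhds ht₀] with t ht using hmeas (hAcont t ht)
  · exact Eventually.of_forall fun x hx t ht => hC (x, t) ⟨uIoc_subset_uIcc hx, ht⟩
  · exact Eventually.of_forall fun x hx t ht =>
      (hAderiv x (γ (x, t))).scomp (g₁ := A x) t (hγderiv x (hab (uIoc_subset_uIcc hx)) t (hrT ht))

namespace IsGraphBox

variable {Ω : ℝ → Set ℂ} {t₀ : ℝ} {x₀ u : ℂ} {γ : ℝ × ℝ → ℝ} {δ ε : ℝ}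

theorem subgraph_mono (h : IsGraphBox Ω t₀ x₀ u γ δ ε) {r : ℝ} (hr : r ≤ δ) {t : ℝ}
    (ht : t ∈ Ioo (t₀ - δ) (t₀ + δ)) : IsSubgraphOn (Ω t) x₀ u (fun x => γ (x, t)) r ε :=
  fun x hx => h.subgraph t ht x (Ioo_subset_Ioo (neg_le_neg hr) hr hx)

theorem hasDerivAt_setIntegral (h : IsGraphBox Ω t₀ x₀ u γ δ ε)
    (hΩ : ∀ t ∈ Ioo (t₀ - δ) (t₀ + δ), IsOpen (Ω t)) {H : ℂ → ℝ} (hH : Continuous H)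
    (hHs : HasCompactSupport H) {r : ℝ} (hr : 0 ≤ r) (hrδ : r < δ)
    (hHb : tsupport H ⊆ box x₀ u r ε) :
    HasDerivAt (fun t => ∫ z in Ω t, H z)
      (∫ x in (-r)..r, fderiv ℝ γ (x, t₀) (0, 1) * H (boxMap x₀ u (x, γ (x, t₀)))) t₀ := by
  have hab : uIcc (-r) r ⊆ Ioo (-δ) δ := by
    rw [uIcc_of_le (by linarith)]
    exact Icc_subset_Ioo (by linarith) hrδ
  have hsupp := (subset_tsupport H).trans hHb
  refine (hasDerivAt_integral_integral_graph (hH.comp (continuous_boxMap x₀ u)) isOpen_Ioo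
    isOpen_Ioo (h.smooth.of_le (by simp)) hab h.time_mem (-ε)).congr_of_eventuallyEq ?_
  filter_upwards [Ioo_mem_nhds h.time_mem.1 h.time_mem.2] with t ht
  rw [(h.subgraph_mono hrδ.le ht).setIntegral_eq h.norm_eq hr (hΩ t ht).measurableSet hsupp
    (hH.integrable_of_hasCompactSupport hHs).integrableOn]
  refine intervalIntegral.integral_congr fun x hx => ?_
  refine setIntegral_Iic_eq_intervalIntegral (h.mem_Ioo x (hab hx) t ht).1.le fun y hy => ?_
  exact apply_boxMap_eq_zero h.norm_eq hsupp fun hq => hq.2.1.not_ge hy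

end IsGraphBox

/-! ### The normal velocity in graph coordinates -/

theorem boxMap_add_smul {x₀ u : ℂ} (hu : ‖u‖ = 1) (q : ℝ × ℝ) (s : ℝ) (n : ℂ) :
    boxMap x₀ u q + s • n =
      boxMap x₀ u (q.1 + s * inner ℝ n u, q.2 + s * inner ℝ n (u * Complex.I)) := by
  have hcoord : ((inner ℝ n u : ℝ) : ℂ) + ((inner ℝ n (u * Complex.I) : ℝ) : ℂ) * Complex.I =
      n * (starRingEnd ℂ) u := by
    apply Complex.ext <;> simp [Complex.inner] <;> ring
  rw [boxMap, boxMap, Complex.real_smul]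
  push_cast
  linear_combination (-(s : ℂ) * u) * hcoord - (s * n : ℂ) * mul_conj_of_norm_eq_one hu

theorem IsGraphBox.inner_normalVelocity {Ω : ℝ → Set ℂ} {t₀ : ℝ} {x₀ u : ℂ} {γ : ℝ × ℝ → ℝ}
    {δ ε : ℝ} (h : IsGraphBox Ω t₀ x₀ u γ δ ε) (hΩ : ∀ t ∈ Ioo (t₀ - δ) (t₀ + δ), IsOpen (Ω t))
    {x : ℝ} (hx : x ∈ Ioo (-δ) δ) {V : ℂ}
    (hV : HasNormalVelocity Ω t₀ (boxMap x₀ u (x, γ (x, t₀))) V) :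
    inner ℝ V (u * Complex.I) - fderiv ℝ γ (x, t₀) (1, 0) * inner ℝ V u =
      fderiv ℝ γ (x, t₀) (0, 1) := by
  obtain ⟨n, f, v, -, hf0, hfrontier, hfderiv, rfl⟩ := hV
  set n₁ : ℝ := inner ℝ n u with hn₁
  set n₂ : ℝ := inner ℝ n (u * Complex.I) with hn₂
  have hpath : HasDerivAt (fun t => x + f t * n₁) (v * n₁) t₀ := (hfderiv.mul_const n₁).const_add x
  have hheight : HasDerivAt (fun t => γ (x, t₀) + f t * n₂) (v * n₂) t₀ :=
    (hfderiv.mul_const n₂).const_add _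
  have hpath_mem : ∀ᶠ t in 𝓝 t₀, x + f t * n₁ ∈ Ioo (-δ) δ :=
    hpath.continuousAt (isOpen_Ioo.mem_nhds (by simpa only [hf0, zero_mul, add_zero] using hx))
  have hheight_mem : ∀ᶠ t in 𝓝 t₀, γ (x, t₀) + f t * n₂ ∈ Ioo (-ε) ε :=
    hheight.continuousAt (isOpen_Ioo.mem_nhds
      (by simpa only [hf0, zero_mul, add_zero] using h.mem_Ioo x hx t₀ h.time_mem))
  have heq : (fun t => γ (x, t₀) + f t * n₂) =ᶠ[𝓝 t₀] fun t => γ (x + f t * n₁, t) := by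
    filter_upwards [hfrontier, hpath_mem, hheight_mem, Ioo_mem_nhds h.time_mem.1 h.time_mem.2]
      with t hft hpt hht ht
    rw [boxMap_add_smul h.norm_eq] at hft
    exact ((h.subgraph t ht).mem_frontier_iff h.norm_eq (hΩ t ht) hpt hht
      (h.contDiffAt_space hpt ht).continuousAt).1 hft
  have hγ : HasFDerivAt γ (fderiv ℝ γ (x, t₀)) (x + f t₀ * n₁, t₀) := by
    rw [hf0, zero_mul, add_zero]
    exact ((h.contDiffAt hx h.time_mem).differentiableAt (by simp)).hasFDerivAt
  have hgraph : HasDerivAt (fun t => γ (x + f t * n₁, t)) (fderiv ℝ γ (x, t₀) (v * n₁, 1)) t₀ :=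
    hγ.comp_hasDerivAt (f := fun t => (x + f t * n₁, t)) t₀ (hpath.prodMk (hasDerivAt_id t₀))
  have hspeed := hheight.unique (hgraph.congr_of_eventuallyEq heq)
  have hsplit : ((v * n₁, 1) : ℝ × ℝ) = (v * n₁) • ((1, 0) : ℝ × ℝ) + (0, 1) := by simp
  rw [hsplit, map_add, map_smul, smul_eq_mul] at hspeed
  rw [real_inner_smul_left, real_inner_smul_left, ← hn₁, ← hn₂]
  linarith

/-! ### The Green formula near a boundary point -/

/-- The graph coordinates at `x₀` in which the graph of `c` becomes the line `q.2 = 0`. -/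
def shearMap (x₀ u : ℂ) (c : ℝ → ℝ) (q : ℝ × ℝ) : ℂ := boxMap x₀ u (q.1, c q.1 + q.2)

/-- The second component of the vector field `X u + Y (u i)` in the coordinates
`shearMap x₀ u c`; its first component is `X`. -/
def shearFlux (x₀ u : ℂ) (c : ℝ → ℝ) (X Y : ℂ → ℝ) (q : ℝ × ℝ) : ℝ :=
  Y (shearMap x₀ u c q) - deriv c q.1 * X (shearMap x₀ u c q)

section

variable {x₀ u : ℂ} {c : ℝ → ℝ} {X Y f : ℂ → ℝ}

theorem hasFDerivAt_shearMap {q : ℝ × ℝ} (hc : DifferentiableAt ℝ c q.1) :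
    HasFDerivAt (shearMap x₀ u c)
      ((ContinuousLinearMap.fst ℝ ℝ ℝ).smulRight u +
        (deriv c q.1 • ContinuousLinearMap.fst ℝ ℝ ℝ +
          ContinuousLinearMap.snd ℝ ℝ ℝ).smulRight (u * Complex.I)) q := by
  have hformula : shearMap x₀ u c =
      fun q => x₀ + (q.1 • u + (c q.1 + q.2) • (u * Complex.I)) := by
    ext q
    simp only [shearMap, boxMap, Complex.real_smul]
    ring
  rw [hformula]
  have hgraph : HasFDerivAt (fun q : ℝ × ℝ => c q.1)
      (deriv c q.1 • ContinuousLinearMap.fst ℝ ℝ ℝ) q :=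
    hc.hasDerivAt.comp_hasFDerivAt q hasFDerivAt_fst
  exact ((hasFDerivAt_fst.smul_const u).add
    ((hgraph.add hasFDerivAt_snd).smul_const (u * Complex.I))).const_add x₀

theorem hasFDerivAt_comp_shearMap {q : ℝ × ℝ} (hc : DifferentiableAt ℝ c q.1)
    (hX : DifferentiableAt ℝ X (shearMap x₀ u c q)) :
    HasFDerivAt (fun q => X (shearMap x₀ u c q)) (fderiv ℝ X (shearMap x₀ u c q) ∘L
      ((ContinuousLinearMap.fst ℝ ℝ ℝ).smulRight u +
        (deriv c q.1 • ContinuousLinearMap.fst ℝ ℝ ℝ +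
          ContinuousLinearMap.snd ℝ ℝ ℝ).smulRight (u * Complex.I))) q :=
  hX.hasFDerivAt.comp q (hasFDerivAt_shearMap hc)

theorem hasFDerivAt_shearFlux {q : ℝ × ℝ} (hc : ContDiffAt ℝ 2 c q.1)
    (hX : DifferentiableAt ℝ X (shearMap x₀ u c q))
    (hY : DifferentiableAt ℝ Y (shearMap x₀ u c q)) :
    HasFDerivAt (shearFlux x₀ u c X Y)
      (fderiv ℝ (fun q => Y (shearMap x₀ u c q)) q -
        (deriv c q.1 • fderiv ℝ (fun q => X (shearMap x₀ u c q)) q +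
          X (shearMap x₀ u c q) •
            (deriv (deriv c) q.1 • ContinuousLinearMap.fst ℝ ℝ ℝ))) q := by
  have hc1 := hc.differentiableAt two_ne_zero
  have hc2 : DifferentiableAt ℝ (deriv c) q.1 :=
    (hc.derivWithin (m := 1) (by norm_num)).differentiableAt one_ne_zero
  exact (hasFDerivAt_comp_shearMap hc1 hY).differentiableAt.hasFDerivAt.sub
    ((hc2.hasDerivAt.comp_hasFDerivAt q hasFDerivAt_fst).mul
      (hasFDerivAt_comp_shearMap hc1 hX).differentiableAt.hasFDerivAt)

theorem divergence_shear {q : ℝ × ℝ} (hc : ContDiffAt ℝ 2 c q.1)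
    (hX : DifferentiableAt ℝ X (shearMap x₀ u c q))
    (hY : DifferentiableAt ℝ Y (shearMap x₀ u c q)) :
    fderiv ℝ (fun q => X (shearMap x₀ u c q)) q (1, 0) +
        fderiv ℝ (shearFlux x₀ u c X Y) q (0, 1) =
      fderiv ℝ X (shearMap x₀ u c q) u + fderiv ℝ Y (shearMap x₀ u c q) (u * Complex.I) := by
  have hc1 := hc.differentiableAt two_ne_zero
  rw [(hasFDerivAt_shearFlux hc hX hY).fderiv, (hasFDerivAt_comp_shearMap hc1 hX).fderiv,
    (hasFDerivAt_comp_shearMap hc1 hY).fderiv]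
  simp [-Complex.real_smul]

theorem continuousOn_comp_shearMap (hu : ‖u‖ = 1) {D : Set ℂ} {r ε : ℝ}
    (h : IsSubgraphOn D x₀ u c r ε) (hX : ContinuousOn X (closure D ∩ box x₀ u r ε))
    (hXs : tsupport X ⊆ box x₀ u r ε) {s : Set ℝ} (hc : ContinuousOn c s) {a : ℝ} :
    ContinuousOn (fun q => X (shearMap x₀ u c q)) (s ×ˢ Icc a 0) := by
  have hshear : ContinuousOn (shearMap x₀ u c) (s ×ˢ Icc a 0) :=
    (continuous_boxMap x₀ u).comp_continuousOn (continuousOn_fst.prodMk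
      ((hc.comp continuousOn_fst fun q hq => hq.1).add continuousOn_snd))
  intro q hq
  by_cases hb : shearMap x₀ u c q ∈ box x₀ u r ε
  · have hmem : ∀ q ∈ s ×ˢ Icc a 0, shearMap x₀ u c q ∈ box x₀ u r ε →
        shearMap x₀ u c q ∈ closure D := fun q hq hqb => by
      have hqm := (boxMap_mem_box hu).1 hqb
      exact h.mem_closure hqm.1 hqm.2 (add_le_of_nonpos_right hq.2.2)
    refine (hX _ ⟨hmem q hq hb, hb⟩).comp_of_mem_nhdsWithin_image (hshear q hq) ?_
    refine mem_nhdsWithin.2 ⟨box x₀ u r ε, isOpen_box x₀ u r ε, hb, ?_⟩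
    rintro _ ⟨hz, q', hq', rfl⟩
    exact ⟨hmem q' hq' hz, hz⟩
  · have hzero : X =ᶠ[𝓝 (shearMap x₀ u c q)] 0 :=
      notMem_tsupport_iff_eventuallyEq.1 fun hs => hb (hXs hs)
    exact (continuousAt_const.congr hzero.symm).comp_continuousWithinAt (hshear q hq)

theorem IsSubgraphOn.setIntegral_eq_shear {D : Set ℂ} {r ε : ℝ} (h : IsSubgraphOn D x₀ u c r ε)
    (hu : ‖u‖ = 1) (hr : 0 ≤ r) (hε : 0 < ε) (hc : ∀ x ∈ Icc (-r) r, c x ∈ Ioo (-ε) ε)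
    (hD : MeasurableSet D) (hf : Function.support f ⊆ box x₀ u r ε) (hint : IntegrableOn f D) :
    ∫ z in D, f z = ∫ x in (-r)..r, ∫ s in (-(2 * ε))..0, f (shearMap x₀ u c (x, s)) := by
  rw [h.setIntegral_eq hu hr hD hf hint]
  refine intervalIntegral.integral_congr fun x hx => ?_
  rw [uIcc_of_le (by linarith)] at hx
  rw [setIntegral_Iic_eq_intervalIntegral (a := c x + -(2 * ε)) (by linarith)]
  · simp only [shearMap]
    rw [intervalIntegral.integral_comp_add_left (fun y => f (boxMap x₀ u (x, y))), add_zero]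
  · intro y hy
    refine apply_boxMap_eq_zero hu hf fun hq => ?_
    linarith [hq.2.1, (hc x hx).2]

theorem integral2_eq_of_divergence_eq {G H h : ℝ × ℝ → ℝ} {a₁ a₂ b₁ b₂ : ℝ} (h₁ : a₁ ≤ b₁)
    (h₂ : a₂ ≤ b₂) (hGc : ContinuousOn G (Icc a₁ b₁ ×ˢ Icc a₂ b₂))
    (hHc : ContinuousOn H (Icc a₁ b₁ ×ˢ Icc a₂ b₂))
    (hhc : ContinuousOn h (Icc a₁ b₁ ×ˢ Icc a₂ b₂))
    (hG : ∀ q ∈ Ioo a₁ b₁ ×ˢ Ioo a₂ b₂, DifferentiableAt ℝ G q)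
    (hH : ∀ q ∈ Ioo a₁ b₁ ×ˢ Ioo a₂ b₂, DifferentiableAt ℝ H q)
    (hdiv : ∀ q ∈ Ioo a₁ b₁ ×ˢ Ioo a₂ b₂, fderiv ℝ G q (1, 0) + fderiv ℝ H q (0, 1) = h q) :
    ∫ x in a₁..b₁, ∫ y in a₂..b₂, h (x, y) =
      (((∫ x in a₁..b₁, H (x, b₂)) - ∫ x in a₁..b₁, H (x, a₂)) + ∫ y in a₂..b₂, G (b₁, y)) -
        ∫ y in a₂..b₂, G (a₁, y) := by
  have hae : (Ioo a₁ b₁ ×ˢ Ioo a₂ b₂ : Set (ℝ × ℝ)) =ᵐ[volume] Icc a₁ b₁ ×ˢ Icc a₂ b₂ :=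
    Measure.set_prod_ae_eq Ioo_ae_eq_Icc Ioo_ae_eq_Icc
  have hint : IntegrableOn (fun q => fderiv ℝ G q (1, 0) + fderiv ℝ H q (0, 1))
      (Icc a₁ b₁ ×ˢ Icc a₂ b₂) :=
    (((hhc.integrableOn_compact (isCompact_Icc.prod isCompact_Icc)).congr_set_ae hae).congr_fun
      (fun q hq => (hdiv q hq).symm) (measurableSet_Ioo.prod measurableSet_Ioo)).congr_set_ae
        hae.symm
  rw [← uIcc_of_le h₁, ← uIcc_of_le h₂] at hGc hHc hint
  rw [← integral2_divergence_prod_of_hasFDerivAt G H (fderiv ℝ G) (fderiv ℝ H) a₁ a₂ b₁ b₂ hGc hHc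
    ?_ ?_ hint]
  · refine intervalIntegral.integral_congr_Ioo_of_le h₁ fun x hx => ?_
    exact intervalIntegral.integral_congr_Ioo_of_le h₂ fun y hy => (hdiv (x, y) ⟨hx, hy⟩).symm
  all_goals
    rw [min_eq_left h₁, max_eq_right h₁, min_eq_left h₂, max_eq_right h₂]
  · exact fun q hq => (hG q hq).hasFDerivAt
  · exact fun q hq => (hH q hq).hasFDerivAt

theorem IsSubgraphOn.divergence_at_shearMap {D : Set ℂ} {r ε : ℝ} (h : IsSubgraphOn D x₀ u c r ε)
    (hu : ‖u‖ = 1) (hD : IsOpen D) (hXs : tsupport X ⊆ box x₀ u r ε)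
    (hYs : tsupport Y ⊆ box x₀ u r ε) (hfs : tsupport f ⊆ box x₀ u r ε)
    (hX : DifferentiableOn ℝ X (D ∩ box x₀ u r ε)) (hY : DifferentiableOn ℝ Y (D ∩ box x₀ u r ε))
    (hdiv : ∀ z ∈ D ∩ box x₀ u r ε, fderiv ℝ X z u + fderiv ℝ Y z (u * Complex.I) = f z)
    {q : ℝ × ℝ} (hq : q.2 < 0) :
    DifferentiableAt ℝ X (shearMap x₀ u c q) ∧ DifferentiableAt ℝ Y (shearMap x₀ u c q) ∧
      fderiv ℝ X (shearMap x₀ u c q) u + fderiv ℝ Y (shearMap x₀ u c q) (u * Complex.I) =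
        f (shearMap x₀ u c q) := by
  by_cases hb : shearMap x₀ u c q ∈ box x₀ u r ε
  · have hqm := (boxMap_mem_box hu).1 hb
    have hqD : shearMap x₀ u c q ∈ D := (h _ hqm.1 _ hqm.2).2 (add_lt_of_neg_right _ hq)
    have hnhds := (hD.inter (isOpen_box x₀ u r ε)).mem_nhds ⟨hqD, hb⟩
    exact ⟨hX.differentiableAt hnhds, hY.differentiableAt hnhds, hdiv _ ⟨hqD, hb⟩⟩
  · have hX0 := notMem_tsupport_iff_eventuallyEq.1 fun hs => hb (hXs hs)
    have hY0 := notMem_tsupport_iff_eventuallyEq.1 fun hs => hb (hYs hs)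
    rw [hX0.fderiv_eq, hY0.fderiv_eq, image_eq_zero_of_notMem_tsupport fun hs => hb (hfs hs)]
    exact ⟨(differentiableAt_const 0).congr_of_eventuallyEq hX0,
      (differentiableAt_const 0).congr_of_eventuallyEq hY0, by simp⟩

theorem IsSubgraphOn.setIntegral_divergence {D : Set ℂ} {δ r ε : ℝ}
    (h : IsSubgraphOn D x₀ u c r ε) (hu : ‖u‖ = 1) (hD : IsOpen D) (hr : 0 ≤ r) (hrδ : r < δ)
    (hε : 0 < ε) (hcs : ContDiffOn ℝ 2 c (Ioo (-δ) δ)) (hc : MapsTo c (Ioo (-δ) δ) (Ioo (-ε) ε))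
    (hXs : tsupport X ⊆ box x₀ u r ε) (hYs : tsupport Y ⊆ box x₀ u r ε)
    (hXc : ContinuousOn X (closure D ∩ box x₀ u r ε))
    (hYc : ContinuousOn Y (closure D ∩ box x₀ u r ε))
    (hX : DifferentiableOn ℝ X (D ∩ box x₀ u r ε)) (hY : DifferentiableOn ℝ Y (D ∩ box x₀ u r ε))
    (hf : Continuous f) (hfs : tsupport f ⊆ box x₀ u r ε) (hint : IntegrableOn f D)
    (hdiv : ∀ z ∈ D ∩ box x₀ u r ε, fderiv ℝ X z u + fderiv ℝ Y z (u * Complex.I) = f z) :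
    ∫ z in D, f z = ∫ x in (-r)..r, shearFlux x₀ u c X Y (x, 0) := by
  have hIcc : Icc (-r) r ⊆ Ioo (-δ) δ := Icc_subset_Ioo (by linarith) hrδ
  have hcs' : ∀ x ∈ Ioo (-r) r, ContDiffAt ℝ 2 c x := fun x hx =>
    hcs.contDiffAt (isOpen_Ioo.mem_nhds (hIcc (Ioo_subset_Icc_self hx)))
  have hcc : ContinuousOn c (Icc (-r) r) := hcs.continuousOn.mono hIcc
  have hderiv : ContinuousOn (deriv c) (Icc (-r) r) :=
    (hcs.continuousOn_deriv_of_isOpen isOpen_Ioo one_le_two).mono hIcc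
  have hshearX := continuousOn_comp_shearMap hu h hXc hXs hcc (a := -(2 * ε))
  have hshearY := continuousOn_comp_shearMap hu h hYc hYs hcc (a := -(2 * ε))
  have hinside : ∀ q ∈ Ioo (-r) r ×ˢ Ioo (-(2 * ε)) 0, _ := fun q hq =>
    h.divergence_at_shearMap hu hD hXs hYs hfs hX hY hdiv hq.2.2
  have hzero : ∀ {W : ℂ → ℝ}, tsupport W ⊆ box x₀ u r ε → ∀ q : ℝ × ℝ,
      q.1 ∉ Ioo (-r) r ∨ c q.1 + q.2 ≤ -ε → W (shearMap x₀ u c q) = 0 := fun hW q hq =>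
    apply_boxMap_eq_zero hu ((subset_tsupport _).trans hW) fun hm =>
      hq.elim (fun hn => hn hm.1) fun hle => hm.2.1.not_ge hle
  have hbottom : ∀ x ∈ [[-r, r]], shearFlux x₀ u c X Y (x, -(2 * ε)) = 0 := by
    intro x hx
    rw [uIcc_of_le (by linarith)] at hx
    have hle : c x + -(2 * ε) ≤ -ε := by linarith [(hc (hIcc hx)).2]
    rw [shearFlux, hzero hXs _ (.inr hle), hzero hYs _ (.inr hle), mul_zero, sub_zero]
  rw [h.setIntegral_eq_shear hu hr hε (fun x hx => hc (hIcc hx)) hD.measurableSet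
      ((subset_tsupport f).trans hfs) hint,
    integral2_eq_of_divergence_eq (G := fun q => X (shearMap x₀ u c q))
      (H := shearFlux x₀ u c X Y) (h := fun q => f (shearMap x₀ u c q)) (by linarith) (by linarith)
      hshearX (hshearY.sub ((hderiv.comp continuousOn_fst fun q hq => hq.1).mul hshearX))
      (continuousOn_comp_shearMap hu h hf.continuousOn hfs hcc)
      (fun q hq => (hasFDerivAt_comp_shearMap ((hcs' _ hq.1).differentiableAt two_ne_zero)
        (hinside q hq).1).differentiableAt)
      (fun q hq => (hasFDerivAt_shearFlux (hcs' _ hq.1) (hinside q hq).1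
        (hinside q hq).2.1).differentiableAt)
      (fun q hq => (divergence_shear (hcs' _ hq.1) (hinside q hq).1 (hinside q hq).2.1).trans
        (hinside q hq).2.2),
    intervalIntegral.integral_congr hbottom]
  simp [hzero hXs]

end

theorem laplacian_eq_fderiv_fderiv_rotated {f : ℂ → ℝ} {z u : ℂ} (hu : ‖u‖ = 1)
    (hf : ContDiffAt ℝ 2 f z) :
    Δ f z = fderiv ℝ (fun w => fderiv ℝ f w u) z u +
      fderiv ℝ (fun w => fderiv ℝ f w (u * Complex.I)) z (u * Complex.I) := by
  have hrotation : ∀ w : ℂ, rotation ⟨u, mem_sphere_zero_iff_norm.2 hu⟩ w = u * w := fun _ => rfl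
  rw [laplacian_eq_sum_fderiv_fderiv (Complex.orthonormalBasisOneI.map
    (rotation ⟨u, mem_sphere_zero_iff_norm.2 hu⟩)) hf]
  simp [Fin.sum_univ_two, hrotation]

/-- The component in the direction `v` of `p ∇F - F g`, where `g` stands for `∇p`, extended
continuously to the points where `p` fails to be differentiable. -/
def greenFlux (p : ℂ → ℝ) (g : ℂ → ℂ) (F : ℂ → ℝ) (v z : ℂ) : ℝ :=
  p z * fderiv ℝ F z v - F z * inner ℝ (g z) v

section

variable {p F : ℂ → ℝ} {g : ℂ → ℂ}

theorem tsupport_greenFlux_subset (v : ℂ) : tsupport (greenFlux p g F v) ⊆ tsupport F := by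
  refine (tsupport_sub _ _).trans (union_subset ?_ ?_)
  · exact tsupport_mul_subset_right.trans (tsupport_fderiv_apply_subset ℝ v)
  · exact tsupport_mul_subset_left

theorem continuousOn_greenFlux {s : Set ℂ} (hF : ContDiff ℝ 1 F) (hp : ContinuousOn p s)
    (hg : ContinuousOn g s) (v : ℂ) : ContinuousOn (greenFlux p g F v) s :=
  (hp.mul (contDiff_fderiv_apply (m := 0) hF (by simp) v).continuous.continuousOn).sub
    (hF.continuous.continuousOn.mul (hg.inner continuousOn_const))

theorem hasFDerivAt_greenFlux {z : ℂ} (hF : ContDiffAt ℝ 2 F z) (hp : ContDiffAt ℝ 2 p z)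
    (hg : g =ᶠ[𝓝 z] gradient p) (v : ℂ) :
    HasFDerivAt (greenFlux p g F v)
      (p z • fderiv ℝ (fun w => fderiv ℝ F w v) z + fderiv ℝ F z v • fderiv ℝ p z -
        (F z • fderiv ℝ (fun w => fderiv ℝ p w v) z + fderiv ℝ p z v • fderiv ℝ F z)) z := by
  have heq : greenFlux p g F v =ᶠ[𝓝 z]
      fun z => p z * fderiv ℝ F z v - F z * fderiv ℝ p z v := by
    filter_upwards [hg] with w hw
    rw [greenFlux, hw, inner_gradient_left]
  have hdiff : ∀ {f : ℂ → ℝ}, ContDiffAt ℝ 2 f z → HasFDerivAt f (fderiv ℝ f z) z ∧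
      HasFDerivAt (fun w => fderiv ℝ f w v) (fderiv ℝ (fun w => fderiv ℝ f w v) z) z :=
    fun hf => ⟨(hf.differentiableAt two_ne_zero).hasFDerivAt,
      ((contDiffAt_fderiv_apply (m := 1) hf (by norm_num) v).differentiableAt
        one_ne_zero).hasFDerivAt⟩
  exact (((hdiff hp).1.mul (hdiff hF).2).sub ((hdiff hF).1.mul (hdiff hp).2)).congr_of_eventuallyEq
    heq

theorem divergence_greenFlux {z u : ℂ} (hu : ‖u‖ = 1) (hF : ContDiffAt ℝ 2 F z)
    (hp : InnerProductSpace.HarmonicAt p z) (hg : g =ᶠ[𝓝 z] gradient p) :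
    fderiv ℝ (greenFlux p g F u) z u +
        fderiv ℝ (greenFlux p g F (u * Complex.I)) z (u * Complex.I) = p z * Δ F z := by
  have hharm : Δ p z = 0 := hp.2.self_of_nhds
  rw [laplacian_eq_fderiv_fderiv_rotated hu hp.1] at hharm
  rw [(hasFDerivAt_greenFlux hF hp.1 hg u).fderiv,
    (hasFDerivAt_greenFlux hF hp.1 hg (u * Complex.I)).fderiv,
    laplacian_eq_fderiv_fderiv_rotated hu hF]
  simp only [sub_apply, add_apply, smul_apply, smul_eq_mul]
  linear_combination -(F z) * hharm

theorem IsSubgraphOn.setIntegral_mul_laplacian {D : Set ℂ} {x₀ u : ℂ} {c : ℝ → ℝ} {δ r ε : ℝ}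
    (h : IsSubgraphOn D x₀ u c δ ε) (hu : ‖u‖ = 1) (hD : IsOpen D) (hr : 0 ≤ r) (hrδ : r < δ)
    (hε : 0 < ε) (hcs : ContDiffOn ℝ 2 c (Ioo (-δ) δ)) (hc : MapsTo c (Ioo (-δ) δ) (Ioo (-ε) ε))
    (hp0 : ∀ z ∉ D, p z = 0) (hpc : ∀ z ∈ box x₀ u r ε, ContinuousAt p z)
    (hp : InnerProductSpace.HarmonicOnNhd p (D ∩ box x₀ u r ε))
    (hg : EqOn g (gradient p) (D ∩ box x₀ u r ε))
    (hgc : ContinuousOn g (closure D ∩ box x₀ u r ε))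
    (hF : ContDiff ℝ 2 F) (hFs : HasCompactSupport F) (hFb : tsupport F ⊆ box x₀ u r ε) :
    ∫ z in D, p z * Δ F z = -∫ x in (-r)..r, F (boxMap x₀ u (x, c x)) *
      (inner ℝ (g (boxMap x₀ u (x, c x))) (u * Complex.I) -
        deriv c x * inner ℝ (g (boxMap x₀ u (x, c x))) u) := by
  have hΔs : tsupport (Δ F) ⊆ box x₀ u r ε := (tsupport_laplacian_subset F).trans hFb
  have hΔc : Continuous (Δ F) := (contDiff_laplacian (m := 0) hF (by simp)).continuous
  have hgnhds : ∀ z ∈ D ∩ box x₀ u r ε, g =ᶠ[𝓝 z] gradient p := fun z hz =>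
    hg.eventuallyEq_of_mem ((hD.inter (isOpen_box x₀ u r ε)).mem_nhds hz)
  have hfluxs : ∀ v, tsupport (greenFlux p g F v) ⊆ box x₀ u r ε := fun v =>
    (tsupport_greenFlux_subset v).trans hFb
  have hfluxc : ∀ v, ContinuousOn (greenFlux p g F v) (closure D ∩ box x₀ u r ε) :=
    continuousOn_greenFlux (hF.of_le one_le_two) (fun z hz => (hpc z hz.2).continuousWithinAt) hgc
  have hfluxd : ∀ v, DifferentiableOn ℝ (greenFlux p g F v) (D ∩ box x₀ u r ε) := fun v z hz =>
    (hasFDerivAt_greenFlux hF.contDiffAt (hp z hz).1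
      (hgnhds z hz) v).differentiableAt.differentiableWithinAt
  have hsub : IsSubgraphOn D x₀ u c r ε := fun x hx =>
    h x (Ioo_subset_Ioo (neg_le_neg hrδ.le) hrδ.le hx)
  rw [hsub.setIntegral_divergence hu hD hr hrδ hε hcs hc (hfluxs u) (hfluxs _) (hfluxc u)
    (hfluxc _) (hfluxd u) (hfluxd _) (f := fun z => p z * Δ F z)
    (continuous_of_tsupport fun z hz => (hpc z (hΔs (tsupport_mul_subset_right hz))).mul
      hΔc.continuousAt)
    (tsupport_mul_subset_right.trans hΔs)
    (integrable_mul_of_continuousAt_tsupport hΔc (hasCompactSupport_laplacian hFs)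
      fun z hz => hpc z (hΔs hz)).integrableOn
    fun z hz => divergence_greenFlux hu hF.contDiffAt (hp z hz) (hgnhds z hz),
    ← intervalIntegral.integral_neg]
  refine intervalIntegral.integral_congr fun x hx => ?_
  rw [uIcc_of_le (by linarith)] at hx
  have hx' : x ∈ Ioo (-δ) δ := Icc_subset_Ioo (by linarith) hrδ hx
  have hzero : p (boxMap x₀ u (x, c x)) = 0 :=
    hp0 _ fun hmem => lt_irrefl _ ((h x hx' _ (hc hx')).1 hmem)
  simp only [shearFlux, shearMap, greenFlux, add_zero, hzero]
  ring

end

section TestFunctions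

variable {E : Type*} [NormedAddCommGroup E] [NormedSpace ℝ E] [FiniteDimensional ℝ E]

theorem exists_contDiff_cutoff {K U : Set E} (hK : IsCompact K) (hU : IsOpen U) (hKU : K ⊆ U) :
    ∃ χ : E → ℝ, ContDiff ℝ ∞ χ ∧ HasCompactSupport χ ∧ tsupport χ ⊆ U ∧
      ∀ z ∈ K, ∀ᶠ w in 𝓝 z, χ w = 1 := by
  have : ProperSpace E := FiniteDimensional.proper_real E
  obtain ⟨L, hL, hKL, hLU⟩ := exists_compact_between hK hU hKU
  obtain ⟨χ, hχ1, hχ0, -⟩ := exists_contMDiffMap_one_nhds_of_subset_interior (n := ⊤)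
    (modelWithCornersSelf ℝ E) hK.isClosed hKL
  have hχL : tsupport χ ⊆ L :=
    closure_minimal (fun z hz => by_contra fun h => hz (hχ0 z h)) hL.isClosed
  exact ⟨χ, χ.contMDiff.contDiff, hL.of_isClosed_subset (isClosed_tsupport _) hχL,
    hχL.trans hLU, fun z hz => hχ1.filter_mono (nhds_le_nhdsSet hz)⟩

theorem exists_testFunction_eq_add {U V : Set E} (hU : IsOpen U) (hV : IsOpen V) {F : E → ℝ}
    (hF : ContDiff ℝ ∞ F) (hFs : HasCompactSupport F) (hFUV : tsupport F ⊆ U ∪ V) :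
    ∃ G H : E → ℝ, ContDiff ℝ ∞ G ∧ HasCompactSupport G ∧ tsupport G ⊆ U ∧
      ContDiff ℝ ∞ H ∧ HasCompactSupport H ∧ tsupport H ⊆ V ∧ F = G + H := by
  obtain ⟨χ, hχ, hχs, hχU, hχ1⟩ := exists_contDiff_cutoff (K := tsupport F \ V)
    (hFs.isCompact.diff hV) hU fun z hz => (hFUV hz.1).resolve_right hz.2
  refine ⟨χ * F, (1 - χ) * F, hχ.mul hF, hχs.mul_right, tsupport_mul_subset_left.trans hχU,
    (contDiff_const.sub hχ).mul hF, hFs.mul_left, fun z hz => ?_, by ring⟩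
  by_contra hzV
  refine notMem_tsupport_iff_eventuallyEq.2 ?_ hz
  filter_upwards [hχ1 z ⟨tsupport_mul_subset_right hz, hzV⟩] with w hw
  simp [hw]

theorem forall_testFunction_of_locally {P : (E → ℝ) → Prop} (h0 : P 0)
    (hadd : ∀ F G : E → ℝ, ContDiff ℝ ∞ F → HasCompactSupport F → ContDiff ℝ ∞ G →
      HasCompactSupport G → P F → P G → P (F + G))
    (hloc : ∀ z, ∃ N : Set E, IsOpen N ∧ z ∈ N ∧
      ∀ F : E → ℝ, ContDiff ℝ ∞ F → HasCompactSupport F → tsupport F ⊆ N → P F)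
    {F : E → ℝ} (hF : ContDiff ℝ ∞ F) (hFs : HasCompactSupport F) : P F := by
  obtain ⟨U, -, hFU, hU⟩ : ∃ U : Set E, IsOpen U ∧ tsupport F ⊆ U ∧
      ∀ F : E → ℝ, ContDiff ℝ ∞ F → HasCompactSupport F → tsupport F ⊆ U → P F := by
    refine IsCompact.induction_on hFs (p := fun s => ∃ U : Set E, IsOpen U ∧ s ⊆ U ∧
      ∀ F : E → ℝ, ContDiff ℝ ∞ F → HasCompactSupport F → tsupport F ⊆ U → P F) ?_ ?_ ?_ ?_
    · refine ⟨∅, isOpen_empty, subset_rfl, fun F _ _ h => ?_⟩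
      rw [subset_empty_iff, tsupport_eq_empty_iff] at h
      exact h ▸ h0
    · rintro s t hst ⟨U, hU, htU, h⟩
      exact ⟨U, hU, hst.trans htU, h⟩
    · rintro s t ⟨U, hU, hsU, hPU⟩ ⟨V, hV, htV, hPV⟩
      refine ⟨U ∪ V, hU.union hV, union_subset_union hsU htV, fun F hF hFs hFUV => ?_⟩
      obtain ⟨G, H, hG, hGs, hGU, hH, hHs, hHV, rfl⟩ :=
        exists_testFunction_eq_add hU hV hF hFs hFUV
      exact hadd G H hG hGs hH hHs (hPU G hG hGs hGU) (hPV H hH hHs hHV)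
    · intro z _
      obtain ⟨N, hN, hzN, h⟩ := hloc z
      exact ⟨N, mem_nhdsWithin_of_mem_nhds (hN.mem_nhds hzN), N, hN, subset_rfl, h⟩
  exact hU F hF hFs hFU

end TestFunctions

/-! ### The Green potential -/

theorem harmonicAt_log_norm_sub_sq {z ζ : ℂ} (hz : z ≠ ζ) :
    InnerProductSpace.HarmonicAt (fun w : ℂ => Real.log (‖w - ζ‖ ^ 2)) z := by
  have hlog : (fun w : ℂ => Real.log (‖w - ζ‖ ^ 2)) = (2 : ℝ) • fun w => Real.log ‖w - ζ‖ := by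
    ext w
    simp [Real.log_pow]
  rw [hlog]
  exact (AnalyticAt.harmonicAt_log_norm (f := fun w : ℂ => w - ζ) (by fun_prop)
    (sub_ne_zero.2 hz)).const_smul

theorem harmonicAt_log_norm_sq {z : ℂ} (hz : z ≠ 0) :
    InnerProductSpace.HarmonicAt (fun w : ℂ => Real.log (‖w‖ ^ 2)) z := by
  simpa using harmonicAt_log_norm_sub_sq hz

theorem tendsto_log_norm_sq_nhdsNE_zero {E : Type*} [NormedAddGroup E] :
    Tendsto (fun x : E => Real.log (‖x‖ ^ 2)) (𝓝[≠] 0) atBot := by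
  simp_rw [Real.log_pow]
  exact (Real.tendsto_log_nhdsGT_zero.comp tendsto_norm_nhdsNE_zero).const_mul_atBot (by simp)

namespace IsGreenPotential

variable {D : Set ℂ} {p : ℂ → ℝ}

theorem exists_harmonicOnNhd (hp : IsGreenPotential D p) :
    ∃ h : ℂ → ℝ, InnerProductSpace.HarmonicOnNhd h D ∧
      ∀ z ∈ D, z ≠ 0 → D.indicator p z = -(1 / (4 * Real.pi)) * Real.log (‖z‖ ^ 2) + h z := by
  obtain ⟨h, hh, hph⟩ := hp.laplacian_eq
  refine ⟨h, hh, fun z hz hz0 => ?_⟩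
  rw [indicator_of_mem hz, hph z hz hz0, Real.log_pow]
  push_cast
  ring

theorem harmonicAt_indicator (hp : IsGreenPotential D p) (hD : IsOpen D) {z : ℂ} (hz : z ∈ D)
    (hz0 : z ≠ 0) : InnerProductSpace.HarmonicAt (D.indicator p) z := by
  obtain ⟨h, hh, hph⟩ := hp.exists_harmonicOnNhd
  have heq : D.indicator p =ᶠ[𝓝 z]
      (-(1 / (4 * Real.pi)) : ℝ) • (fun w : ℂ => Real.log (‖w‖ ^ 2)) + h := by
    filter_upwards [hD.mem_nhds hz, isOpen_ne.mem_nhds hz0] with w hw hw0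
    exact hph w hw hw0
  rw [InnerProductSpace.harmonicAt_congr_nhds heq]
  exact (harmonicAt_log_norm_sq hz0).const_smul.add (hh z hz)

theorem continuousAt_indicator (hp : IsGreenPotential D p) (hD : IsOpen D) {z : ℂ} (hz0 : z ≠ 0) :
    ContinuousAt (D.indicator p) z := by
  by_cases hz : z ∈ D
  · exact (hp.harmonicAt_indicator hD hz hz0).1.continuousAt
  by_cases hzc : z ∈ closure D
  · have hin : Tendsto (D.indicator p) (𝓝[D] z) (𝓝 0) :=
      (hp.boundary z (hD.frontier_eq ▸ ⟨hzc, hz⟩)).congr'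
        eqOn_indicator.symm.eventuallyEq_nhdsWithin
    have hout : Tendsto (D.indicator p) (𝓝[Dᶜ] z) (𝓝 0) :=
      tendsto_const_nhds.congr' eqOn_indicator'.symm.eventuallyEq_nhdsWithin
    have := hin.sup hout
    rw [← nhdsWithin_union, union_compl_self, nhdsWithin_univ] at this
    rwa [ContinuousAt, indicator_of_notMem hz]
  · refine (continuousAt_const (y := (0 : ℝ))).congr ?_
    filter_upwards [isClosed_closure.isOpen_compl.mem_nhds hzc] with w hw
    rw [indicator_of_notMem fun h => hw (subset_closure h)]

theorem locallyIntegrable_indicator (hp : IsGreenPotential D p) (hD : IsOpen D)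
    (h0 : (0 : ℂ) ∈ D) : LocallyIntegrable (D.indicator p) := by
  intro z
  by_cases hz : z = 0
  · subst hz
    obtain ⟨h, hh, hph⟩ := hp.exists_harmonicOnNhd
    have hhint : IntegrableAtFilter h (𝓝 0) volume :=
      hD.nhdsWithin_eq h0 ▸ hh.continuousOn.integrableAt_nhdsWithin hD.measurableSet h0
    obtain ⟨s, hs, hint⟩ : IntegrableAtFilter
        (fun z => -(1 / (4 * Real.pi)) * Real.log (‖z‖ ^ 2) + h z) (𝓝 0) volume :=
      (locallyIntegrable_log_norm_sq 0).smul (-(1 / (4 * Real.pi)) : ℝ) |>.add hhint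
    obtain ⟨t, hts, hto, h0t⟩ := mem_nhds_iff.1 hs
    refine ⟨t ∩ D, (hto.inter hD).mem_nhds ⟨h0t, h0⟩,
      (hint.mono_set (inter_subset_left.trans hts)).congr ?_⟩
    filter_upwards [ae_restrict_of_ae (Measure.ae_ne volume 0),
      ae_restrict_mem (hto.inter hD).measurableSet] with w hw hwD
    exact (hph w hwD.2 hw).symm
  · have hcont : ContinuousOn (D.indicator p) {0}ᶜ := fun w hw =>
      (hp.continuousAt_indicator hD hw).continuousWithinAt
    exact isOpen_compl_singleton.nhdsWithin_eq hz ▸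
      hcont.integrableAt_nhdsWithin (measurableSet_singleton 0).compl hz

theorem integrable_indicator_mul (hp : IsGreenPotential D p) (hD : IsOpen D) (h0 : (0 : ℂ) ∈ D)
    {g : ℂ → ℝ} (hg : Continuous g) (hgs : HasCompactSupport g) :
    Integrable fun z => D.indicator p z * g z :=
  (hp.locallyIntegrable_indicator hD h0).integrable_smul_right_of_hasCompactSupport hg hgs

theorem tendsto_indicator_zero (hp : IsGreenPotential D p) (hD : IsOpen D) (h0 : (0 : ℂ) ∈ D) :
    Tendsto (D.indicator p) (𝓝[≠] 0) atTop := by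
  obtain ⟨h, hh, hph⟩ := hp.exists_harmonicOnNhd
  have hneg : -(1 / (4 * Real.pi)) < 0 := neg_lt_zero.2 (by positivity)
  refine (Tendsto.atTop_add (C := h 0) (tendsto_log_norm_sq_nhdsNE_zero.const_mul_atBot_of_neg hneg)
    ((hh 0 h0).1.continuousAt.tendsto.mono_left nhdsWithin_le_nhds)).congr' ?_
  filter_upwards [self_mem_nhdsWithin, mem_nhdsWithin_of_mem_nhds (hD.mem_nhds h0)] with w hw hwD
  exact (hph w hwD hw).symm

theorem indicator_nonneg (hp : IsGreenPotential D p) (hD : IsOpen D) (h0 : (0 : ℂ) ∈ D)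
    (hb : Bornology.IsBounded D) {z : ℂ} (hz : z ≠ 0) : 0 ≤ D.indicator p z := by
  obtain ⟨r, hr, hnear⟩ : ∃ r > 0, ∀ w ∈ Metric.ball (0 : ℂ) r, w ≠ 0 → 0 ≤ D.indicator p w :=
    Metric.eventually_nhds_iff_ball.1 <| eventually_nhdsWithin_iff.1 <|
      (hp.tendsto_indicator_zero hD h0).eventually_ge_atTop 0
  by_cases hzD : z ∈ D
  swap
  · rw [indicator_of_notMem hzD]
  by_cases hzr : z ∈ Metric.ball 0 r
  · exact hnear z hzr hz
  set K := closure D ∩ (Metric.ball 0 (r / 2))ᶜ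
  have hK : IsCompact K :=
    hb.isCompact_closure.inter_right Metric.isOpen_ball.isClosed_compl
  have hne : ∀ w ∈ K, w ≠ 0 := by
    rintro w hw rfl
    exact hw.2 (Metric.mem_ball_self (half_pos hr))
  have hzK : z ∈ K := ⟨subset_closure hzD, fun h =>
    hzr (Metric.ball_subset_ball (half_le_self hr.le) h)⟩
  have hfrontier : ∀ w ∈ frontier K, -D.indicator p w ≤ 0 := by
    intro w hw
    by_cases hwD : w ∈ D
    · refine neg_nonpos.2 (hnear w ?_ (hne w (hK.isClosed.frontier_subset hw)))
      rcases frontier_inter_subset _ _ hw with ⟨hwf, -⟩ | ⟨-, hwf⟩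
      · exact absurd hwD (hD.frontier_eq ▸ frontier_closure_subset hwf).2
      · rw [frontier_compl] at hwf
        exact Metric.closedBall_subset_ball (half_lt_self hr) (Metric.sphere_subset_closedBall
          (Metric.frontier_ball_subset_sphere hwf))
    · rw [indicator_of_notMem hwD, neg_zero]
  refine neg_nonpos.1 (nonpos_of_submean hK (v := fun w => -D.indicator p w)
    (fun w hw => (hp.continuousAt_indicator hD (hne w hw)).neg.continuousWithinAt)
    (fun w hw hpos => ?_) hfrontier z hzK)
  have hwD : w ∈ D := by
    by_contra hcon
    simp [indicator_of_notMem hcon] at hpos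
  filter_upwards [circleAverage_eq_of_harmonicAt
    (hp.harmonicAt_indicator hD hwD (hne w (interior_subset hw))).neg] with s hs
  exact hs.ge

theorem integral_indicator_mul_laplacian (hp : IsGreenPotential D p) {F : ℂ → ℝ}
    (hF : ContDiff ℝ 2 F) (hFs : HasCompactSupport F) (hFD : tsupport F ⊆ D) :
    ∫ z, D.indicator p z * Δ F z = -F 0 := by
  obtain ⟨h, hh, hph⟩ := hp.exists_harmonicOnNhd
  have hL := (contDiff_laplacian (m := 0) hF (by simp)).continuous
  have hLs := hasCompactSupport_laplacian hFs
  have heq : (fun z => D.indicator p z * Δ F z) =ᵐ[volume] fun z =>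
      -(1 / (4 * Real.pi)) * (Real.log (‖0 - z‖ ^ 2) * Δ F z) + h z * Δ F z := by
    filter_upwards [Measure.ae_ne volume 0] with z hz
    by_cases hzF : z ∈ tsupport F
    · rw [hph z (hFD hzF) hz, zero_sub, norm_neg]
      ring
    · simp [laplacian_eq_zero_of_notMem_tsupport hzF]
  rw [integral_congr_ae heq, integral_add ((integrable_log_norm_sub_sq_mul 0 hL hLs).const_mul _)
    (integrable_mul_of_continuousAt_tsupport hL hLs fun z hz =>
      (hh z (hFD (tsupport_laplacian_subset F hz))).1.continuousAt),
    integral_const_mul, integral_log_norm_sub_sq_mul_laplacian hF hFs,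
    integral_harmonic_mul_laplacian hF hFs (hh.mono hFD)]
  field_simp
  ring

end IsGreenPotential

/-! ### Transport along the strong flow -/

theorem eqOn_gradient_indicator {D : Set ℂ} (hD : IsOpen D) (p : ℂ → ℝ) :
    EqOn (gradient (D.indicator p)) (gradient p) D := fun _ hz => by
  rw [gradient, gradient, (eqOn_indicator.eventuallyEq_of_mem (hD.mem_nhds hz)).fderiv_eq]

theorem IsGreenPotential.continuousAt_gradient {D : Set ℂ} {p : ℂ → ℝ} (hp : IsGreenPotential D p)
    (hD : IsOpen D) {z : ℂ} (hz : z ∈ D) (hz0 : z ≠ 0) : ContinuousAt (gradient p) z := by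
  have hharm := hp.harmonicAt_indicator hD hz hz0
  rw [InnerProductSpace.harmonicAt_congr_nhds
    (eqOn_indicator.eventuallyEq_of_mem (hD.mem_nhds hz))] at hharm
  exact (InnerProductSpace.toDual ℝ ℂ).symm.continuous.continuousAt.comp
    (hharm.1.fderiv_right (m := 0) one_le_two).continuousAt

section GraphBox

variable {Ω : ℝ → Set ℂ} {t₀ : ℝ} {x₀ u : ℂ} {γ : ℝ × ℝ → ℝ} {δ ε r : ℝ} {p κ F : ℂ → ℝ}

theorem IsGraphBox.integral_indicator_mul_laplacian (h : IsGraphBox Ω t₀ x₀ u γ δ ε)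
    (hD : IsOpen (Ω t₀)) (hp : IsGreenPotential (Ω t₀) p)
    (hG : ∀ x ∈ frontier (Ω t₀), ∃ G, Tendsto (gradient p) (𝓝[Ω t₀] x) (𝓝 G))
    (hr : 0 ≤ r) (hrδ : r < δ) (h0 : (0 : ℂ) ∉ box x₀ u r ε) (hF : ContDiff ℝ 2 F)
    (hFs : HasCompactSupport F) (hFb : tsupport F ⊆ box x₀ u r ε) :
    ∫ z, (Ω t₀).indicator p z * Δ F z = -∫ x in (-r)..r, F (boxMap x₀ u (x, γ (x, t₀))) *
      (inner ℝ (extendFrom (Ω t₀) (gradient p) (boxMap x₀ u (x, γ (x, t₀)))) (u * Complex.I) -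
        deriv (fun s => γ (s, t₀)) x *
          inner ℝ (extendFrom (Ω t₀) (gradient p) (boxMap x₀ u (x, γ (x, t₀)))) u) := by
  have hbox : ∀ z ∈ box x₀ u r ε, z ≠ 0 := fun z hz hz0 => h0 (hz0 ▸ hz)
  have hlim : ∀ z ∈ closure (Ω t₀) ∩ box x₀ u r ε,
      ∃ G, Tendsto (gradient p) (𝓝[Ω t₀] z) (𝓝 G) := by
    intro z hz
    by_cases hzD : z ∈ Ω t₀
    · exact ⟨_, (hp.continuousAt_gradient hD hzD (hbox z hz.2)).continuousWithinAt⟩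
    · exact hG z (hD.frontier_eq ▸ ⟨hz.1, hzD⟩)
  rw [← setIntegral_eq_integral_of_forall_compl_eq_zero (s := Ω t₀)
    (fun z hz => by rw [indicator_of_notMem hz, zero_mul])]
  refine (h.subgraph t₀ h.time_mem).setIntegral_mul_laplacian h.norm_eq hD hr hrδ h.eps_pos
    (fun x hx => ((h.contDiffAt_space hx h.time_mem).of_le ENat.LEInfty.out).contDiffWithinAt)
    (fun x hx => h.mem_Ioo x hx t₀ h.time_mem) (fun z hz => indicator_of_notMem hz p)
    (fun z hz => hp.continuousAt_indicator hD (hbox z hz))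
    (fun z hz => hp.harmonicAt_indicator hD hz.1 (hbox z hz.2)) (fun z hz => ?_)
    (continuousOn_extendFrom inter_subset_left hlim) hF hFs hFb
  rw [eqOn_gradient_indicator hD p hz.1]
  exact extendFrom_eq (subset_closure hz.1)
    (hp.continuousAt_gradient hD hz.1 (hbox z hz.2)).continuousWithinAt

theorem IsGraphBox.deriv_space (h : IsGraphBox Ω t₀ x₀ u γ δ ε) {x t : ℝ} (hx : x ∈ Ioo (-δ) δ)
    (ht : t ∈ Ioo (t₀ - δ) (t₀ + δ)) :
    deriv (fun s => γ (s, t)) x = fderiv ℝ γ (x, t) (1, 0) :=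
  (((h.contDiffAt hx ht).differentiableAt (by simp)).hasFDerivAt.comp_hasDerivAt x
    ((hasDerivAt_id x).prodMk (hasDerivAt_const x t))).deriv

theorem IsGraphBox.hasDerivAt_setIntegral_div (h : IsGraphBox Ω t₀ x₀ u γ δ ε)
    (hΩ : ∀ t ∈ Ioo (t₀ - δ) (t₀ + δ), IsOpen (Ω t)) (hκ : Continuous κ) (hκ0 : ∀ z, κ z ≠ 0)
    (hp : IsGreenPotential (Ω t₀) p)
    (hV : ∀ x ∈ frontier (Ω t₀), ∃ V G : ℂ, HasNormalVelocity Ω t₀ x V ∧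
      Tendsto (gradient p) (𝓝[Ω t₀] x) (𝓝 G) ∧ V = -(κ x • G))
    (hr : 0 ≤ r) (hrδ : r < δ) (h0 : (0 : ℂ) ∉ box x₀ u r ε) (hF : ContDiff ℝ 2 F)
    (hFs : HasCompactSupport F) (hFb : tsupport F ⊆ box x₀ u r ε) :
    HasDerivAt (fun t => ∫ z in Ω t, F z / κ z) (∫ z, (Ω t₀).indicator p z * Δ F z) t₀ := by
  have hdiv : (fun z => F z / κ z) = F * κ⁻¹ := funext fun z => div_eq_mul_inv _ _
  have hderiv := h.hasDerivAt_setIntegral hΩ (H := fun z => F z / κ z)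
    (hF.continuous.div hκ hκ0) (hdiv ▸ hFs.mul_right) hr hrδ
    (hdiv ▸ tsupport_mul_subset_left.trans hFb)
  rw [h.integral_indicator_mul_laplacian (hΩ t₀ h.time_mem) hp
    (fun x hx => let ⟨_, G, _, hG, _⟩ := hV x hx; ⟨G, hG⟩) hr hrδ h0 hF hFs hFb,
    ← intervalIntegral.integral_neg]
  convert hderiv using 1
  refine intervalIntegral.integral_congr fun x hx => ?_
  rw [uIcc_of_le (neg_le_self hr)] at hx
  have hxδ : x ∈ Ioo (-δ) δ := ⟨(neg_lt_neg hrδ).trans_le hx.1, hx.2.trans_lt hrδ⟩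
  have hfrontier := h.mem_frontier hxδ h.time_mem (hΩ t₀ h.time_mem)
  obtain ⟨V, G, hVx, hG, rfl⟩ := hV _ hfrontier
  rw [extendFrom_eq (frontier_subset_closure hfrontier) hG, h.deriv_space hxδ h.time_mem,
    ← h.inner_normalVelocity hΩ hxδ hVx, inner_neg_left, inner_neg_left, real_inner_smul_left,
    real_inner_smul_left]
  have := hκ0 (boxMap x₀ u (x, γ (x, t₀)))
  field_simp
  ring

end GraphBox

section Transport

variable {Ω : ℝ → Set ℂ} {a b t₀ : ℝ} {p κ F : ℂ → ℝ}

theorem integrable_div_of_hasCompactSupport {X : Type*} [TopologicalSpace X] [MeasurableSpace X]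
    [OpensMeasurableSpace X] {μ : Measure X} [IsFiniteMeasureOnCompacts μ] {f g : X → ℝ}
    (hf : Continuous f) (hfs : HasCompactSupport f) (hg : Continuous g) (hg0 : ∀ x, g x ≠ 0) :
    Integrable (fun x => f x / g x) μ :=
  (hf.div hg hg0).integrable_of_hasCompactSupport (by
    simp_rw [div_eq_mul_inv]
    exact hfs.mul_right)

theorem IsSmoothFamily.exists_hasDerivAt_setIntegral_div_of_notMem_frontier
    (hΩ : IsSmoothFamily Ω a b) (ht₀ : t₀ ∈ Ioo a b) (h0 : (0 : ℂ) ∈ Ω t₀)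
    (hp : IsGreenPotential (Ω t₀) p) (κ : ℂ → ℝ) {z : ℂ} (hz : z ∉ frontier (Ω t₀)) :
    ∃ N, IsOpen N ∧ z ∈ N ∧ ∀ F : ℂ → ℝ, ContDiff ℝ 2 F → HasCompactSupport F → tsupport F ⊆ N →
      HasDerivAt (fun t => ∫ z in Ω t, F z / κ z)
        (F 0 + ∫ z, (Ω t₀).indicator p z * Δ F z) t₀ := by
  obtain ⟨K, hK, hKt⟩ := hΩ.eventually_subset_or_disjoint ht₀ ⟨0, h0⟩ hz
  obtain ⟨N, hNK, hN, hzN⟩ := mem_nhds_iff.1 hK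
  refine ⟨N, hN, hzN, fun F hF hFs hFN => ?_⟩
  have hoff : ∀ w ∉ K, F w / κ w = 0 := fun w hw => by
    rw [image_eq_zero_of_notMem_tsupport fun h => hw (hNK (hFN h)), zero_div]
  by_cases hzD : z ∈ Ω t₀
  · have hKΩ : K ⊆ Ω t₀ := hKt.self_of_nhds.1 hzD
    rw [hp.integral_indicator_mul_laplacian hF hFs (hFN.trans (hNK.trans hKΩ)), add_neg_cancel]
    refine (hasDerivAt_const t₀ (∫ z, F z / κ z)).congr_of_eventuallyEq ?_
    filter_upwards [hKt] with t ht
    exact setIntegral_eq_integral_of_forall_compl_eq_zero fun w hw =>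
      hoff w fun h => hw (ht.1 hzD h)
  · have hKΩ : Disjoint K (Ω t₀) := hKt.self_of_nhds.2 hzD
    have hF0 : F 0 = 0 := image_eq_zero_of_notMem_tsupport fun h =>
      disjoint_left.1 hKΩ (hNK (hFN h)) h0
    have hgreen : ∀ w, (Ω t₀).indicator p w * Δ F w = 0 := by
      intro w
      by_cases hw : w ∈ tsupport F
      · rw [indicator_of_notMem (disjoint_left.1 hKΩ (hNK (hFN hw))), zero_mul]
      · rw [laplacian_eq_zero_of_notMem_tsupport hw, mul_zero]
    simp_rw [hgreen, hF0, integral_zero, add_zero]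
    refine (hasDerivAt_const t₀ (0 : ℝ)).congr_of_eventuallyEq ?_
    filter_upwards [hKt] with t ht
    exact setIntegral_eq_zero_of_forall_eq_zero fun w hw =>
      hoff w fun h => disjoint_left.1 (ht.2 hzD) h hw

theorem IsSmoothFamily.exists_hasDerivAt_setIntegral_div_of_mem_frontier
    (hΩ : IsSmoothFamily Ω a b) (ht₀ : t₀ ∈ Ioo a b) (h0 : (0 : ℂ) ∈ Ω t₀)
    (hp : IsGreenPotential (Ω t₀) p) (hκ : Continuous κ) (hκ0 : ∀ z, κ z ≠ 0)
    (hV : ∀ x ∈ frontier (Ω t₀), ∃ V G : ℂ, HasNormalVelocity Ω t₀ x V ∧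
      Tendsto (gradient p) (𝓝[Ω t₀] x) (𝓝 G) ∧ V = -(κ x • G))
    {z : ℂ} (hz : z ∈ frontier (Ω t₀)) :
    ∃ N, IsOpen N ∧ z ∈ N ∧ ∀ F : ℂ → ℝ, ContDiff ℝ 2 F → HasCompactSupport F → tsupport F ⊆ N →
      HasDerivAt (fun t => ∫ z in Ω t, F z / κ z)
        (F 0 + ∫ z, (Ω t₀).indicator p z * Δ F z) t₀ := by
  have hz0 : z ≠ 0 := by
    rintro rfl
    exact (hΩ.isOpen t₀ ht₀).frontier_eq ▸ hz |>.2 h0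
  obtain ⟨u, γ, δ, ε, hB, hball, htime⟩ := hΩ.exists_isGraphBox ht₀ hz (norm_pos_iff.2 hz0)
  have hδ := half_pos hB.delta_pos
  have hbox0 : (0 : ℂ) ∉ box z u (δ / 2) ε := fun h => by
    have hlt : (0 : ℂ) ∈ box z u δ ε :=
      ⟨Ioo_subset_Ioo (by linarith) (by linarith) h.1, h.2⟩
    simpa using hball hlt
  refine ⟨box z u (δ / 2) ε, isOpen_box _ _ _ _, center_mem_box hδ hB.eps_pos,
    fun F hF hFs hFb => ?_⟩
  rw [image_eq_zero_of_notMem_tsupport fun h => hbox0 (hFb h), zero_add]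
  exact hB.hasDerivAt_setIntegral_div (fun t ht => hΩ.isOpen t (htime ht)) hκ hκ0 hp hV hδ.le
    (half_lt_self hB.delta_pos) hbox0 hF hFs hFb

theorem IsSmoothFamily.hasDerivAt_setIntegral_div (hΩ : IsSmoothFamily Ω a b) (ht₀ : t₀ ∈ Ioo a b)
    (h0 : (0 : ℂ) ∈ Ω t₀) (hp : IsGreenPotential (Ω t₀) p) (hκ : Continuous κ)
    (hκ0 : ∀ z, κ z ≠ 0)
    (hV : ∀ x ∈ frontier (Ω t₀), ∃ V G : ℂ, HasNormalVelocity Ω t₀ x V ∧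
      Tendsto (gradient p) (𝓝[Ω t₀] x) (𝓝 G) ∧ V = -(κ x • G))
    (hF : ContDiff ℝ ∞ F) (hFs : HasCompactSupport F) :
    HasDerivAt (fun t => ∫ z in Ω t, F z / κ z)
      (F 0 + ∫ z, (Ω t₀).indicator p z * Δ F z) t₀ := by
  refine forall_testFunction_of_locally (P := fun F => HasDerivAt (fun t => ∫ z in Ω t, F z / κ z)
      (F 0 + ∫ z, (Ω t₀).indicator p z * Δ F z) t₀) ?_ ?_ (fun z => ?_) hF hFs
  · have hΔ : Δ (0 : ℂ → ℝ) = 0 := funext fun z => laplacian_eq_zero_of_notMem_tsupport (by simp)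
    simp [hΔ, hasDerivAt_const]
  · intro F G hF hFs hG hGs hdF hdG
    have hint {H : ℂ → ℝ} (hH : ContDiff ℝ ∞ H) (hHs : HasCompactSupport H) :
        Integrable fun z => (Ω t₀).indicator p z * Δ H z :=
      hp.integrable_indicator_mul (hΩ.isOpen t₀ ht₀) h0
        (contDiff_laplacian (m := 0) (hH.of_le ENat.LEInfty.out : ContDiff ℝ 2 H)
          (by simp)).continuous (hasCompactSupport_laplacian hHs)
    have hmass : (fun t => ∫ z in Ω t, (F + G) z / κ z) =
        (fun t => ∫ z in Ω t, F z / κ z) + fun t => ∫ z in Ω t, G z / κ z := by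
      ext t
      rw [Pi.add_apply, ← integral_add
        (integrable_div_of_hasCompactSupport hF.continuous hFs hκ hκ0).integrableOn
        (integrable_div_of_hasCompactSupport hG.continuous hGs hκ hκ0).integrableOn]
      simp only [Pi.add_apply, add_div]
    have hgreen : ∫ z, (Ω t₀).indicator p z * Δ (F + G) z =
        (∫ z, (Ω t₀).indicator p z * Δ F z) + ∫ z, (Ω t₀).indicator p z * Δ G z := by
      rw [← integral_add (hint hF hFs) (hint hG hGs)]
      congr 1 with z
      rw [(hF.contDiffAt.of_le ENat.LEInfty.out).laplacian_add
        (hG.contDiffAt.of_le ENat.LEInfty.out), mul_add]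
    rw [hmass, hgreen, Pi.add_apply, add_add_add_comm]
    exact hdF.add hdG
  · obtain ⟨N, hN, hzN, hderiv⟩ : ∃ N, IsOpen N ∧ z ∈ N ∧ ∀ F : ℂ → ℝ, ContDiff ℝ 2 F →
        HasCompactSupport F → tsupport F ⊆ N → HasDerivAt (fun t => ∫ z in Ω t, F z / κ z)
          (F 0 + ∫ z, (Ω t₀).indicator p z * Δ F z) t₀ := by
      by_cases hz : z ∈ frontier (Ω t₀)
      · exact hΩ.exists_hasDerivAt_setIntegral_div_of_mem_frontier ht₀ h0 hp hκ hκ0 hV hz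
      · exact hΩ.exists_hasDerivAt_setIntegral_div_of_notMem_frontier ht₀ h0 hp κ hz
    exact ⟨N, hN, hzN, fun F hF => hderiv F (hF.of_le ENat.LEInfty.out)⟩

end Transport

/-! ### Quadrature along the flow -/

theorem IsSmoothFamily.frontier_subset_closure_compl_closure {Ω : ℝ → Set ℂ} {a b t : ℝ}
    (hΩ : IsSmoothFamily Ω a b) (ht : t ∈ Ioo a b) :
    frontier (Ω t) ⊆ closure (closure (Ω t))ᶜ := by
  intro z hz
  obtain ⟨u, γ, δ, ε, hB, -, -⟩ := hΩ.exists_isGraphBox ht hz one_pos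
  have h0δ : (0 : ℝ) ∈ Ioo (-δ) δ := ⟨neg_lt_zero.2 hB.delta_pos, hB.delta_pos⟩
  have h0ε : (0 : ℝ) ∈ Ioo (-ε) ε := ⟨neg_lt_zero.2 hB.eps_pos, hB.eps_pos⟩
  have hsub := hB.subgraph t hB.time_mem
  have hγ : ContinuousAt (fun x => γ (x, t)) 0 := (hB.contDiffAt_space h0δ hB.time_mem).continuousAt
  have hγ0 : 0 = γ (0, t) :=
    (hsub.mem_frontier_iff hB.norm_eq (hΩ.isOpen t ht) h0δ h0ε hγ).1 (by rwa [boxMap_zero])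
  have hlim : Tendsto (fun y : ℝ => boxMap z u (0, y)) (𝓝[>] 0) (𝓝 z) :=
    tendsto_nhdsWithin_of_tendsto_nhds
      (((continuous_boxMap z u).comp (Continuous.prodMk_right 0)).tendsto' 0 z boxMap_zero)
  refine mem_closure_of_tendsto hlim ?_
  filter_upwards [Ioo_mem_nhdsGT hB.eps_pos] with y hy
  exact hsub.notMem_closure hB.norm_eq h0δ ⟨h0ε.1.trans hy.1, hy.2⟩ hγ (hγ0 ▸ hy.1)

theorem IsSmoothFamily.interior_closure_subset {Ω : ℝ → Set ℂ} {a b t : ℝ}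
    (hΩ : IsSmoothFamily Ω a b) (ht : t ∈ Ioo a b) : interior (closure (Ω t)) ⊆ Ω t := by
  intro z hz
  by_contra hzt
  have hzf : z ∈ frontier (Ω t) := by
    rw [(hΩ.isOpen t ht).frontier_eq]
    exact ⟨interior_subset hz, hzt⟩
  have hzc := hΩ.frontier_subset_closure_compl_closure ht hzf
  rw [closure_compl] at hzc
  exact hzc hz

theorem exists_testFunction_eventuallyEq {E : Type*} [NormedAddCommGroup E] [NormedSpace ℝ E]
    [FiniteDimensional ℝ E] {K O : Set E} (hK : IsCompact K) (hO : IsOpen O) (hKO : K ⊆ O)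
    {f : E → ℝ} (hf : ContDiffOn ℝ ∞ f O) :
    ∃ F : E → ℝ, ContDiff ℝ ∞ F ∧ HasCompactSupport F ∧ ∀ z ∈ K, F =ᶠ[𝓝 z] f := by
  obtain ⟨χ, hχ, hχs, hχO, hχ1⟩ := exists_contDiff_cutoff hK hO hKO
  refine ⟨fun z => χ z * f z, contDiff_iff_contDiffAt.2 fun z => ?_, hχs.mul_right, fun z hz => ?_⟩
  · by_cases hz : z ∈ tsupport χ
    · exact hχ.contDiffAt.mul (hf.contDiffAt (hO.mem_nhds (hχO hz)))
    · refine (contDiffAt_const (c := (0 : ℝ))).congr_of_eventuallyEq ?_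
      filter_upwards [notMem_tsupport_iff_eventuallyEq.1 hz] with w hw
      rw [hw, Pi.zero_apply, zero_mul]
  · filter_upwards [hχ1 z hz] with w hw
    rw [hw, one_mul]

/-- A strong Hele-Shaw flow emanating from the origin, with the standing assumptions on the
permeability. -/
structure IsInjectionFlow (κ : ℂ → ℝ) (Ω : ℝ → Set ℂ) (b : ℝ) : Prop where
  contDiff : ContDiff ℝ ∞ κ
  pos : ∀ z, 0 < κ z
  integrable : ∀ z : ℂ, Integrable (fun ζ : ℂ => Real.log (‖z - ζ‖ ^ 2) / κ ζ)
  smoothFamily : IsSmoothFamily Ω 0 b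
  zero_mem : ∀ t ∈ Ioo 0 b, (0 : ℂ) ∈ Ω t
  monotoneOn : MonotoneOn Ω (Ioo 0 b)
  strong : IsStrongHeleShawFlow κ Ω 0 b
  shrinks : ∀ U ∈ 𝓝 (0 : ℂ), ∀ᶠ t in 𝓝[>] (0 : ℝ), Ω t ⊆ U

namespace IsInjectionFlow

variable {κ : ℂ → ℝ} {Ω : ℝ → Set ℂ} {b s t : ℝ} {z : ℂ} {O : Set ℂ} {f F : ℂ → ℝ}

theorem isOpen (h : IsInjectionFlow κ Ω b) (ht : t ∈ Ioo 0 b) : IsOpen (Ω t) :=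
  h.smoothFamily.isOpen t ht

theorem isCompact_closure (h : IsInjectionFlow κ Ω b) (ht : t ∈ Ioo 0 b) :
    IsCompact (closure (Ω t)) :=
  (h.smoothFamily.isBounded t ht).isCompact_closure

theorem Ioc_subset (ht : t ∈ Ioo 0 b) : Ioc 0 t ⊆ Ioo 0 b := fun _ hs =>
  ⟨hs.1, hs.2.trans_lt ht.2⟩

theorem subset (h : IsInjectionFlow κ Ω b) (ht : t ∈ Ioo 0 b) (hs : s ∈ Ioc 0 t) : Ω s ⊆ Ω t :=
  h.monotoneOn (Ioc_subset ht hs) ht hs.2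

theorem tendsto_setIntegral_zero (h : IsInjectionFlow κ Ω b) (ht : t ∈ Ioo 0 b)
    (hf : IntegrableOn f (Ω t)) : Tendsto (fun s => ∫ z in Ω s, f z) (𝓝[>] 0) (𝓝 0) := by
  have hvol : Tendsto (volume.restrict (Ω t) ∘ Ω) (𝓝[>] 0) (𝓝 0) := by
    rw [ENNReal.tendsto_nhds_zero]
    intro ε hε
    obtain ⟨U, hU, hUo, hUε⟩ := ({0} : Set ℂ).exists_isOpen_lt_of_lt ε (μ := volume)
      ((measure_singleton 0).trans_lt hε)
    filter_upwards [h.shrinks U (hUo.mem_nhds (hU rfl))] with s hs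
    exact (Measure.restrict_apply_le _ _).trans ((measure_mono hs).trans hUε.le)
  refine (hf.tendsto_setIntegral_nhds_zero hvol).congr' ?_
  filter_upwards [Ioc_mem_nhdsGT ht.1] with s hs
  rw [Measure.restrict_restrict (h.isOpen (Ioc_subset ht hs)).measurableSet,
    inter_eq_left.2 (h.subset ht hs)]

theorem exists_hasDerivAt (h : IsInjectionFlow κ Ω b) (ht : t ∈ Ioo 0 b) (hF : ContDiff ℝ ∞ F)
    (hFs : HasCompactSupport F) (hΔ : ∀ z ∈ Ω t, 0 ≤ Δ F z) :
    ∃ d, 0 ≤ d ∧ HasDerivAt (fun s => (∫ z in Ω s, F z / κ z) - s * F 0) d t := by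
  obtain ⟨p, hp, hV⟩ := h.strong t ht
  have hderiv := h.smoothFamily.hasDerivAt_setIntegral_div ht (h.zero_mem t ht) hp
    h.contDiff.continuous (fun z => (h.pos z).ne') hV hF hFs
  refine ⟨∫ z, (Ω t).indicator p z * Δ F z, integral_nonneg_of_ae ?_, ?_⟩
  · filter_upwards [Measure.ae_ne volume 0] with z hz
    by_cases hzt : z ∈ Ω t
    · exact mul_nonneg (hp.indicator_nonneg (h.isOpen ht) (h.zero_mem t ht)
        (h.smoothFamily.isBounded t ht) hz) (hΔ z hzt)
    · rw [indicator_of_notMem hzt, zero_mul, Pi.zero_apply]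
  · have hsub := hderiv.sub ((hasDerivAt_id t).mul_const (F 0))
    rwa [one_mul, add_sub_cancel_left] at hsub

theorem monotoneOn_setIntegral_sub_of_hasCompactSupport (h : IsInjectionFlow κ Ω b)
    (ht : t ∈ Ioo 0 b) (hF : ContDiff ℝ ∞ F) (hFs : HasCompactSupport F)
    (hΔ : ∀ z ∈ Ω t, 0 ≤ Δ F z) :
    MonotoneOn (fun s => (∫ z in Ω s, F z / κ z) - s * F 0) (Ioc 0 t) := by
  have hderiv : ∀ s ∈ Ioc 0 t, ∃ d, 0 ≤ d ∧
      HasDerivAt (fun s => (∫ z in Ω s, F z / κ z) - s * F 0) d s := fun s hs =>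
    h.exists_hasDerivAt (Ioc_subset ht hs) hF hFs fun z hz => hΔ z (h.subset ht hs hz)
  refine monotoneOn_of_deriv_nonneg (convex_Ioc 0 t) (fun s hs => ?_) (fun s hs => ?_)
    (fun s hs => ?_)
  · obtain ⟨d, -, hd⟩ := hderiv s hs
    exact hd.continuousAt.continuousWithinAt
  · obtain ⟨d, -, hd⟩ := hderiv s (interior_subset hs)
    exact hd.differentiableAt.differentiableWithinAt
  · obtain ⟨d, hd0, hd⟩ := hderiv s (interior_subset hs)
    rwa [hd.deriv]

theorem monotoneOn_setIntegral_sub (h : IsInjectionFlow κ Ω b) (ht : t ∈ Ioo 0 b) (hO : IsOpen O)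
    (hΩO : closure (Ω t) ⊆ O) (hf : ContDiffOn ℝ ∞ f O) (hΔ : ∀ z ∈ Ω t, 0 ≤ Δ f z) :
    MonotoneOn (fun s => (∫ z in Ω s, f z / κ z) - s * f 0) (Ioc 0 t) := by
  obtain ⟨F, hF, hFs, hFf⟩ := exists_testFunction_eventuallyEq (h.isCompact_closure ht) hO hΩO hf
  have heq : EqOn F f (Ω t) := fun z hz => (hFf z (subset_closure hz)).self_of_nhds
  have hΔF : ∀ z ∈ Ω t, 0 ≤ Δ F z := fun z hz => by
    rw [(InnerProductSpace.laplacian_congr_nhds (hFf z (subset_closure hz))).self_of_nhds]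
    exact hΔ z hz
  refine (h.monotoneOn_setIntegral_sub_of_hasCompactSupport ht hF hFs hΔF).congr fun s hs => ?_
  have hmass : ∫ z in Ω s, F z / κ z = ∫ z in Ω s, f z / κ z :=
    setIntegral_congr_fun (h.isOpen (Ioc_subset ht hs)).measurableSet fun z hz =>
      congrArg (· / κ z) (heq (h.subset ht hs hz))
  simp only [hmass, heq (h.zero_mem t ht)]

theorem mul_le_setIntegral (h : IsInjectionFlow κ Ω b) (ht : t ∈ Ioo 0 b) (hO : IsOpen O)
    (hΩO : closure (Ω t) ⊆ O) (hf : ContDiffOn ℝ ∞ f O) (hΔ : ∀ z ∈ Ω t, 0 ≤ Δ f z) :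
    t * f 0 ≤ ∫ z in Ω t, f z / κ z := by
  have hint : IntegrableOn (fun z => f z / κ z) (Ω t) :=
    (((hf.continuousOn.mono hΩO).div h.contDiff.continuous.continuousOn
      fun z _ => (h.pos z).ne').integrableOn_compact (h.isCompact_closure ht)).mono_set
        subset_closure
  have hlim : Tendsto (fun s => (∫ z in Ω s, f z / κ z) - s * f 0) (𝓝[>] 0) (𝓝 0) := by
    simpa using (h.tendsto_setIntegral_zero ht hint).sub
      ((tendsto_nhdsWithin_of_tendsto_nhds (tendsto_id (α := ℝ))).mul_const (f 0))
  refine sub_nonneg.1 (le_of_tendsto hlim ?_)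
  filter_upwards [Ioc_mem_nhdsGT ht.1] with s hs
  exact h.monotoneOn_setIntegral_sub ht hO hΩO hf hΔ hs (right_mem_Ioc.2 ht.1) hs.2

theorem setIntegral_eq_of_harmonicOnNhd (h : IsInjectionFlow κ Ω b) (ht : t ∈ Ioo 0 b)
    (hO : IsOpen O) (hΩO : closure (Ω t) ⊆ O) (hf : InnerProductSpace.HarmonicOnNhd f O) :
    ∫ z in Ω t, f z / κ z = t * f 0 := by
  have hsmooth : ContDiffOn ℝ ∞ f O := fun z hz =>
    (HarmonicAt.analyticAt (hf z hz)).contDiffAt.contDiffWithinAt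
  have hΔ : ∀ z ∈ Ω t, Δ f z = 0 := fun z hz => (hf z (hΩO (subset_closure hz))).2.self_of_nhds
  have hneg : t * (-f) 0 ≤ ∫ z in Ω t, (-f) z / κ z :=
    h.mul_le_setIntegral ht hO hΩO hsmooth.neg fun z hz => by
      rw [InnerProductSpace.laplacian_neg, Pi.neg_apply, hΔ z hz, neg_zero]
  simp only [Pi.neg_apply, neg_div, integral_neg, mul_neg, neg_le_neg_iff] at hneg
  exact hneg.antisymm (h.mul_le_setIntegral ht hO hΩO hsmooth fun z hz => (hΔ z hz).ge)

theorem contDiff_inv (h : IsInjectionFlow κ Ω b) : ContDiff ℝ ∞ fun z => (κ z)⁻¹ :=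
  h.contDiff.inv fun z => (h.pos z).ne'

theorem isLogDensity (h : IsInjectionFlow κ Ω b) : IsLogDensity fun z => (κ z)⁻¹ where
  measurable := h.contDiff_inv.continuous.measurable
  nonneg z := (inv_pos.2 (h.pos z)).le
  locally_bounded R := by
    obtain ⟨C, hC⟩ := (isCompact_closedBall (0 : ℂ) R).bddAbove_image
      h.contDiff_inv.continuous.continuousOn
    exact ⟨C, fun z hz => hC (mem_image_of_mem _ hz)⟩
  integrable_log z := by simpa only [div_eq_mul_inv] using h.integrable z

theorem isLogDensity_indicator (h : IsInjectionFlow κ Ω b) (ht : t ∈ Ioo 0 b) :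
    IsLogDensity ((Ω t).indicator fun z => (κ z)⁻¹) :=
  h.isLogDensity.indicator (h.isOpen ht).measurableSet

theorem isLogDensity_indicator_compl (h : IsInjectionFlow κ Ω b) (ht : t ∈ Ioo 0 b) :
    IsLogDensity ((Ω t)ᶜ.indicator fun z => (κ z)⁻¹) :=
  h.isLogDensity.indicator (h.isOpen ht).measurableSet.compl

end IsInjectionFlow

/-! ### The excess potential -/

theorem log_one_add_le {x : ℝ} (hx : 0 < x) : Real.log (1 + x) ≤ Real.log 2 + |Real.log x| := by
  rcases le_total x 1 with h1 | h1
  · calc Real.log (1 + x) ≤ Real.log 2 := Real.log_le_log (by positivity) (by linarith)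
      _ ≤ Real.log 2 + |Real.log x| := le_add_of_nonneg_right (abs_nonneg _)
  · calc Real.log (1 + x) ≤ Real.log (2 * x) := Real.log_le_log (by positivity) (by linarith)
      _ = Real.log 2 + Real.log x := Real.log_mul two_ne_zero hx.ne'
      _ ≤ Real.log 2 + |Real.log x| := by gcongr; exact le_abs_self _

namespace IsLogDensity

variable {m m' : ℂ → ℝ}

theorem integrable_log_one_add (hm : IsLogDensity m) (z : ℂ) :
    Integrable fun ζ => Real.log (1 + ‖z - ζ‖ ^ 2) * m ζ := by
  refine ((hm.integrable.const_mul (Real.log 2)).add (hm.integrable_log z).abs).mono'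
    ((by fun_prop : Measurable fun ζ : ℂ => Real.log (1 + ‖z - ζ‖ ^ 2)).mul
      hm.measurable).aestronglyMeasurable ?_
  filter_upwards [ae_norm_sub_sq_pos z] with ζ hζ
  rw [Real.norm_of_nonneg (mul_nonneg (Real.log_nonneg (by linarith)) (hm.nonneg ζ)),
    Pi.add_apply, abs_mul, abs_of_nonneg (hm.nonneg ζ), ← add_mul]
  exact mul_le_mul_of_nonneg_right (log_one_add_le hζ) (hm.nonneg ζ)

theorem tendsto_integral_log_add (hm : IsLogDensity m) (z : ℂ) :
    Tendsto (fun c : ℝ => ∫ ζ, Real.log (‖z - ζ‖ ^ 2 + (c ^ 2)⁻¹) * m ζ) atTop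
      (𝓝 (logPotential m z)) :=
  tendsto_integral_log_add_inv_sq_mul z hm.measurable.aestronglyMeasurable (hm.integrable_log z)
    (hm.integrable_log_one_add z)

theorem logPotential_sub (hm : IsLogDensity m) (hm' : IsLogDensity m') (z : ℂ) :
    logPotential (m - m') z = logPotential m z - logPotential m' z := by
  simp only [logPotential, Pi.sub_apply, mul_sub]
  exact integral_sub (hm.integrable_log z) (hm'.integrable_log z)

end IsLogDensity

theorem integral_mul_indicator_inv {X : Type*} [MeasurableSpace X] {μ : Measure X} {S : Set X}
    (hS : MeasurableSet S) (f g : X → ℝ) :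
    ∫ x, f x * S.indicator (fun x => (g x)⁻¹) x ∂μ = ∫ x in S, f x / g x ∂μ := by
  simp_rw [← integral_indicator hS, div_eq_mul_inv, indicator_mul_right]

/-- The difference `Q_t` between the logarithmic potential of `1 / κ` on `Ω_t` and that of the point
mass `t δ₀`. At the origin its value is meaningless, as `Real.log 0 = 0`. -/
def excess (κ : ℂ → ℝ) (Ω : ℝ → Set ℂ) (t : ℝ) (z : ℂ) : ℝ :=
  logPotential ((Ω t).indicator fun z => (κ z)⁻¹) z - t * Real.log (‖z‖ ^ 2)

namespace IsInjectionFlow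

variable {κ : ℂ → ℝ} {Ω : ℝ → Set ℂ} {b s t : ℝ} {z : ℂ}

theorem continuousAt_excess (h : IsInjectionFlow κ Ω b) (ht : t ∈ Ioo 0 b) (hz : z ≠ 0) :
    ContinuousAt (excess κ Ω t) z :=
  (h.isLogDensity_indicator ht).continuous_logPotential.continuousAt.sub
    (continuousAt_const.mul (continuousAt_log_norm_sq hz))

theorem tendsto_regularized_excess (h : IsInjectionFlow κ Ω b) (ht : t ∈ Ioo 0 b) (hz : z ≠ 0) :
    Tendsto (fun c : ℝ => (∫ ζ in Ω t, Real.log (‖z - ζ‖ ^ 2 + (c ^ 2)⁻¹) / κ ζ) -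
      t * Real.log (‖z - 0‖ ^ 2 + (c ^ 2)⁻¹)) atTop (𝓝 (excess κ Ω t z)) := by
  simp_rw [← integral_mul_indicator_inv (h.isOpen ht).measurableSet, sub_zero]
  exact ((h.isLogDensity_indicator ht).tendsto_integral_log_add z).sub
    ((tendsto_log_add_inv_sq (pow_ne_zero 2 (norm_ne_zero_iff.2 hz))).const_mul t)

theorem excess_mono (h : IsInjectionFlow κ Ω b) (ht : t ∈ Ioo 0 b) (hs : s ∈ Ioc 0 t)
    (hz : z ≠ 0) : excess κ Ω s z ≤ excess κ Ω t z := by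
  refine le_of_tendsto_of_tendsto (h.tendsto_regularized_excess (Ioc_subset ht hs) hz)
    (h.tendsto_regularized_excess ht hz) ?_
  filter_upwards [eventually_gt_atTop (0 : ℝ)] with c hc
  refine h.monotoneOn_setIntegral_sub ht isOpen_univ (subset_univ _)
    (f := fun ζ => Real.log (‖z - ζ‖ ^ 2 + (c ^ 2)⁻¹))
    (contDiff_log_norm_sub_sq_add z (by positivity)).contDiffOn (fun ζ _ => ?_) hs
    (right_mem_Ioc.2 ht.1) hs.2
  rw [laplacian_log_norm_sub_sq_add_complex z (by positivity)]
  positivity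

theorem excess_eq_zero_of_notMem_closure (h : IsInjectionFlow κ Ω b) (ht : t ∈ Ioo 0 b)
    (hz : z ∉ closure (Ω t)) : excess κ Ω t z = 0 := by
  have hharm : InnerProductSpace.HarmonicOnNhd (fun ζ : ℂ => Real.log (‖z - ζ‖ ^ 2)) {z}ᶜ :=
    fun w hw => by
      simp_rw [norm_sub_rev z]
      exact harmonicAt_log_norm_sub_sq hw
  rw [excess, logPotential, integral_mul_indicator_inv (h.isOpen ht).measurableSet,
    h.setIntegral_eq_of_harmonicOnNhd ht isOpen_compl_singleton
      (subset_compl_singleton_iff.2 hz) hharm, sub_zero, sub_self]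

theorem excess_eq_zero (h : IsInjectionFlow κ Ω b) (ht : t ∈ Ioo 0 b) (hz : z ∉ Ω t) :
    excess κ Ω t z = 0 := by
  by_cases hzc : z ∈ closure (Ω t)
  · have hz0 : z ≠ 0 := fun hz0 => hz (hz0 ▸ h.zero_mem t ht)
    have hzf : z ∈ frontier (Ω t) := (h.isOpen ht).frontier_eq ▸ ⟨hzc, hz⟩
    have hmem := (h.continuousAt_excess ht hz0).continuousWithinAt.mem_closure (t := {0})
      (h.smoothFamily.frontier_subset_closure_compl_closure ht hzf)
      fun w hw => h.excess_eq_zero_of_notMem_closure ht hw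
    rwa [closure_singleton] at hmem
  · exact h.excess_eq_zero_of_notMem_closure ht hzc

theorem excess_nonneg (h : IsInjectionFlow κ Ω b) (ht : t ∈ Ioo 0 b) (hz : z ≠ 0) :
    0 ≤ excess κ Ω t z := by
  obtain ⟨s, hs, hst⟩ := ((h.shrinks {z}ᶜ (isOpen_compl_singleton.mem_nhds hz.symm)).and
    (Ioc_mem_nhdsGT ht.1)).exists
  rw [← h.excess_eq_zero (Ioc_subset ht hst) fun hzs => hs hzs rfl]
  exact h.excess_mono ht hst hz

end IsInjectionFlow

/-! ### Positivity and subharmonicity -/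

theorem frontier_connectedComponentIn_subset_compl {X : Type*} [TopologicalSpace X]
    [LocallyConnectedSpace X] {U : Set X} (hU : IsOpen U) (x : X) :
    frontier (connectedComponentIn U x) ⊆ Uᶜ := by
  intro y hy hyU
  have hyo : IsOpen (connectedComponentIn U y) := hU.connectedComponentIn
  obtain ⟨w, hwy, hwx⟩ := mem_closure_iff.1 hy.1 _ hyo (mem_connectedComponentIn hyU)
  have heq : connectedComponentIn U x = connectedComponentIn U y :=
    (connectedComponentIn_eq hwx).trans (connectedComponentIn_eq hwy).symm
  exact hy.2 (mem_interior_iff_mem_nhds.2 (heq ▸ hyo.mem_nhds (mem_connectedComponentIn hyU)))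

theorem eventually_forall_mem_sphere {X : Type*} [PseudoMetricSpace X] {p : X → Prop} {x : X}
    (hp : ∀ᶠ y in 𝓝 x, p y) : ∀ᶠ r in 𝓝[>] (0 : ℝ), ∀ y ∈ Metric.sphere x r, p y :=
  nhdsWithin_le_nhds <| (eventually_closedBall_subset hp).mono fun _ hr _ hy =>
    hr (Metric.sphere_subset_closedBall hy)

theorem eventually_continuousAt_of_harmonicAt {f : ℂ → ℝ} {z : ℂ}
    (hf : InnerProductSpace.HarmonicAt f z) : ∀ᶠ w in 𝓝 z, ContinuousAt f w :=
  (hf.1.eventually (by simp)).mono fun _ hw => hw.continuousAt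

theorem circleIntegrable_of_forall_mem_sphere {f : ℂ → ℝ} {z : ℂ} {r : ℝ} (hr : 0 < r)
    (hf : ∀ w ∈ Metric.sphere z r, ContinuousAt f w) : CircleIntegrable f z r :=
  ContinuousOn.circleIntegrable hr.le fun w hw => (hf w hw).continuousWithinAt

theorem eventually_eq_zero_of_harmonicAt_of_nonneg {v : ℂ → ℝ} {w : ℂ}
    (hv : InnerProductSpace.HarmonicAt v w) (hnn : ∀ᶠ z in 𝓝 w, 0 ≤ v z) (hw : v w = 0) :
    ∀ᶠ z in 𝓝 w, v z = 0 := by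
  have hmean : ∀ᶠ r in 𝓝[>] (0 : ℝ), ∀ z ∈ Metric.sphere w r, v z = 0 := by
    filter_upwards [circleAverage_eq_of_harmonicAt hv.neg, self_mem_nhdsWithin,
      eventually_forall_mem_sphere (hnn.and (eventually_continuousAt_of_harmonicAt hv))]
      with r hr hr0 hsphere
    by_contra! hne
    obtain ⟨z, hz, hvz⟩ := hne
    have hlt : Real.circleAverage (-v) w r < 0 :=
      circleAverage_lt_of_le_of_exists_lt hr0
        (fun y hy => (hsphere y hy).2.neg.continuousWithinAt)
        (fun y hy => neg_nonpos.2 (hsphere y hy).1)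
        ⟨z, hz, neg_neg_of_pos ((hsphere z hz).1.lt_of_ne' hvz)⟩
    rw [hr, Pi.neg_apply, hw, neg_zero] at hlt
    exact lt_irrefl _ hlt
  have hne : ∀ᶠ z in 𝓝[≠] w, v z = 0 :=
    ((tendsto_norm_sub_self_nhdsNE w).eventually hmean).mono fun z hz => hz z (by simp)
  rw [eventually_nhdsWithin_iff] at hne
  filter_upwards [hne] with z hz
  rcases eq_or_ne z w with rfl | hzw
  exacts [hw, hz hzw]

theorem pos_of_harmonicAt_of_tendsto_atTop {U : Set ℂ} (hU : IsOpen U) (hc : IsPreconnected U)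
    {a : ℂ} (ha : a ∈ U) {v : ℂ → ℝ}
    (hv : ∀ z ∈ U, z ≠ a → InnerProductSpace.HarmonicAt v z) (hnn : ∀ z ∈ U, z ≠ a → 0 ≤ v z)
    (hlim : Tendsto v (𝓝[≠] a) atTop) {z : ℂ} (hz : z ∈ U) (hza : z ≠ a) : 0 < v z := by
  refine (hnn z hz hza).lt_of_ne' fun hvz => ?_
  set E : Set ℂ := {w | w ∈ U ∧ w ≠ a ∧ v w = 0}
  have hEo : IsOpen E := isOpen_iff_mem_nhds.2 fun w ⟨hwU, hwa, hvw⟩ => by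
    have hUa : ∀ᶠ y in 𝓝 w, y ∈ U ∧ y ≠ a := 
      (hU.eventually_mem hwU).and (isOpen_ne.eventually_mem hwa)
    filter_upwards [hUa, eventually_eq_zero_of_harmonicAt_of_nonneg (hv w hwU hwa)
      (hUa.mono fun y hy => hnn y hy.1 hy.2) hvw] with y hy hvy
    exact ⟨hy.1, hy.2, hvy⟩
  have haE : a ∉ closure E := fun haE => by
    have hpos := eventually_nhdsWithin_iff.1 (hlim.eventually_gt_atTop 0)
    obtain ⟨x, hxE, hx⟩ := (mem_closure_iff_frequently.1 haE |>.and_eventually hpos).exists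
    exact (hx hxE.2.1).ne' hxE.2.2
  have hsub : U ⊆ E := hc.subset_of_closure_inter_subset hEo ⟨z, hz, hz, hza, hvz⟩
    fun w ⟨hwE, hwU⟩ => by
      have hwa : w ≠ a := fun hwa => haE (hwa ▸ hwE)
      have hvw := (hv w hwU hwa).1.continuousAt.continuousWithinAt.mem_closure (t := {0}) hwE
        fun x hx => hx.2.2
      exact ⟨hwU, hwa, by rwa [closure_singleton] at hvw⟩
  exact (hsub ha).2.1 rfl

theorem IsLogDensity.eventually_logPotential_add_le_circleAverage {m : ℂ → ℝ}
    (hm : IsLogDensity m) {f : ℂ → ℝ} {z : ℂ} (hf : InnerProductSpace.HarmonicAt f z) :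
    ∀ᶠ r in 𝓝[>] (0 : ℝ), logPotential m z + f z ≤
      Real.circleAverage (fun w => logPotential m w + f w) z r := by
  filter_upwards [circleAverage_eq_of_harmonicAt hf, self_mem_nhdsWithin,
    eventually_forall_mem_sphere (eventually_continuousAt_of_harmonicAt hf)] with r hr hr0 hcont
  rw [Real.circleAverage_fun_add (hm.continuous_logPotential.continuousOn.circleIntegrable hr0.le)
    (circleIntegrable_of_forall_mem_sphere hr0 hcont), hr]
  gcongr
  exact hm.logPotential_le_circleAverage z hr0

theorem upperSemicontinuous_update_bot {X : Type*} [TopologicalSpace X] [T1Space X] [DecidableEq X]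
    {w : X → ℝ} {a : X} (hw : ∀ x ≠ a, ContinuousAt w x) (hlim : Tendsto w (𝓝[≠] a) atBot) :
    UpperSemicontinuous (Function.update (fun x => (w x : EReal)) a ⊥) := by
  intro x
  rcases eq_or_ne x a with rfl | hx
  · have hbot : Tendsto (fun y => (w y : EReal)) (𝓝[≠] x) (𝓝 ⊥) :=
      EReal.tendsto_coe_nhds_bot_iff.2 hlim
    exact (continuousAt_update_same.2 hbot).upperSemicontinuousAt
  · exact ((continuousAt_update_of_ne hx).2
      (continuous_coe_real_ereal.continuousAt.comp (hw x hx))).upperSemicontinuousAt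

section Subharmonic

variable {w h : ℂ → ℝ} {a : ℂ} {K : Set ℂ}

theorem continuousOn_update_max_sub_zero (hw : ∀ z ≠ a, ContinuousAt w z)
    (hlim : Tendsto w (𝓝[≠] a) atBot) (hh : ContinuousOn h K) :
    ContinuousOn (Function.update (fun z => max (w z - h z) 0) a 0) K := by
  intro z hz
  rcases eq_or_ne z a with rfl | hza
  · have hh' : ∀ᶠ x in 𝓝[K] z, h z - 1 < h x := (hh z hz).eventually_const_lt (sub_one_lt _)
    have hw' := eventually_nhdsWithin_iff.1 (hlim.eventually_lt_atBot (h z - 1))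
    refine continuousWithinAt_const.congr_of_eventuallyEq (f := fun _ => (0 : ℝ)) ?_
      (Function.update_self ..)
    filter_upwards [hh', nhdsWithin_le_nhds hw'] with x hhx hwx
    rcases eq_or_ne x z with rfl | hxz
    · exact Function.update_self ..
    · rw [Function.update_of_ne hxz, max_eq_right]
      linarith [hwx hxz]
  · rw [continuousWithinAt_update_of_ne hza]
    exact ((hw z hza).continuousWithinAt.sub (hh z hz)).sup continuousWithinAt_const

theorem eventually_le_circleAverage_update_max_sub_zero (hw : ∀ z ≠ a, ContinuousAt w z)
    {z : ℂ} (hza : z ≠ a) (hsub : ∀ᶠ r in 𝓝[>] (0 : ℝ), w z ≤ Real.circleAverage w z r)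
    (hh : InnerProductSpace.HarmonicAt h z) :
    ∀ᶠ r in 𝓝[>] (0 : ℝ), w z - h z ≤
      Real.circleAverage (Function.update (fun z => max (w z - h z) 0) a 0) z r := by
  filter_upwards [hsub, circleAverage_eq_of_harmonicAt hh, self_mem_nhdsWithin,
    eventually_forall_mem_sphere ((isOpen_ne.eventually_mem hza).and
      (eventually_continuousAt_of_harmonicAt hh))] with r hwr hhr hr0 hsphere
  have hwi : CircleIntegrable w z r :=
    circleIntegrable_of_forall_mem_sphere hr0 fun y hy => hw y (hsphere y hy).1
  have hhi : CircleIntegrable h z r :=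
    circleIntegrable_of_forall_mem_sphere hr0 fun y hy => (hsphere y hy).2
  calc w z - h z ≤ Real.circleAverage w z r - Real.circleAverage h z r := by rw [hhr]; gcongr
    _ = Real.circleAverage (w - h) z r := (Real.circleAverage_sub hwi hhi).symm
    _ ≤ _ := by
      refine Real.circleAverage_mono (hwi.sub hhi) ?_ fun y hy => ?_
      · exact circleIntegrable_of_forall_mem_sphere hr0 fun y hy =>
          (continuousAt_update_of_ne (hsphere y hy).1).2
            (((hw y (hsphere y hy).1).sub (hsphere y hy).2).sup continuousAt_const)
      · rw [abs_of_pos hr0] at hy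
        rw [Function.update_of_ne (hsphere y hy).1]
        exact le_max_left _ _

theorem isSubharmonic_update_bot (hw : ∀ z ≠ a, ContinuousAt w z)
    (hlim : Tendsto w (𝓝[≠] a) atBot)
    (hsub : ∀ z ≠ a, ∀ᶠ r in 𝓝[>] (0 : ℝ), w z ≤ Real.circleAverage w z r) :
    IsSubharmonic (Function.update (fun z => (w z : EReal)) a ⊥) where
  usc := upperSemicontinuous_update_bot hw hlim
  lt_top z := by
    rcases eq_or_ne z a with rfl | hza
    · simp
    · simp [hza]
  le_of_le_frontier K h hK hh hharm hfr := by
    /- The difference `w - h` is cut off at `0`, which removes the pole. -/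
    have hnonpos : ∀ z ∈ K, Function.update (fun z => max (w z - h z) 0) a 0 z ≤ 0 := by
      refine nonpos_of_submean hK (continuousOn_update_max_sub_zero hw hlim hh)
        (fun z hz hpos => ?_) fun z hz => ?_
      · rcases eq_or_ne z a with rfl | hza
        · rw [Function.update_self] at hpos
          exact absurd hpos (lt_irrefl _)
        · rw [Function.update_of_ne hza] at hpos ⊢
          rw [max_eq_left ((lt_max_iff.1 hpos).resolve_right (lt_irrefl _)).le]
          exact eventually_le_circleAverage_update_max_sub_zero hw hza (hsub z hza) (hharm z hz)
      · rcases eq_or_ne z a with rfl | hza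
        · exact (Function.update_self ..).le
        · have hwh := hfr z hz
          rw [Function.update_of_ne hza, EReal.coe_le_coe_iff] at hwh
          rw [Function.update_of_ne hza]
          exact max_le (sub_nonpos.2 hwh) le_rfl
    intro z hz
    rcases eq_or_ne z a with rfl | hza
    · rw [Function.update_self]
      exact bot_le
    · have hle := hnonpos z hz
      rw [Function.update_of_ne hza] at hle ⊢
      exact EReal.coe_le_coe_iff.2 (sub_nonpos.1 ((le_max_left _ _).trans hle))

end Subharmonic

/-! ### The extremal potential -/

/-- The potential `V_t` of the measure `1_{ℂ ∖ Ω_t} / κ + t δ₀`, in which the mass of `1 / κ` in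
`Ω_t` is swept to the origin; it is `log (1 + |z|²) + ψ_t`. At the origin, where it should be `-∞`,
its value is meaningless, as `Real.log 0 = 0`. -/
def extremalPotential (κ : ℂ → ℝ) (Ω : ℝ → Set ℂ) (t : ℝ) (z : ℂ) : ℝ :=
  logPotential ((Ω t)ᶜ.indicator fun z => (κ z)⁻¹) z + t * Real.log (‖z‖ ^ 2)

namespace IsInjectionFlow

variable {κ : ℂ → ℝ} {Ω : ℝ → Set ℂ} {b s t : ℝ} {z : ℂ}

theorem excess_eq (h : IsInjectionFlow κ Ω b) (ht : t ∈ Ioo 0 b) :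
    excess κ Ω t = logPotential (fun z => (κ z)⁻¹) - extremalPotential κ Ω t := by
  ext z
  rw [Pi.sub_apply, extremalPotential, indicator_compl,
    h.isLogDensity.logPotential_sub (h.isLogDensity_indicator ht), excess]
  ring

theorem continuousAt_extremalPotential (h : IsInjectionFlow κ Ω b) (ht : t ∈ Ioo 0 b)
    (hz : z ≠ 0) : ContinuousAt (extremalPotential κ Ω t) z :=
  (h.isLogDensity_indicator_compl ht).continuous_logPotential.continuousAt.add
    (continuousAt_const.mul (continuousAt_log_norm_sq hz))

theorem harmonicAt_extremalPotential (h : IsInjectionFlow κ Ω b) (ht : t ∈ Ioo 0 b)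
    (hz : z ∈ Ω t) (hz0 : z ≠ 0) : InnerProductSpace.HarmonicAt (extremalPotential κ Ω t) z :=
  ((h.isLogDensity_indicator_compl ht).harmonicOnNhd_logPotential (h.isOpen ht)
    (fun _ hw => indicator_of_notMem (notMem_compl_iff.2 hw) _) z hz).add
    ((harmonicAt_log_norm_sq hz0).const_smul (c := t))

theorem laplacian_excess (h : IsInjectionFlow κ Ω b) (ht : t ∈ Ioo 0 b) (hz : z ∈ Ω t)
    (hz0 : z ≠ 0) : Δ (excess κ Ω t) z = 4 * Real.pi * (κ z)⁻¹ := by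
  have hV := h.harmonicAt_extremalPotential ht hz hz0
  rw [h.excess_eq ht, ContDiffAt.laplacian_sub
    ((h.isLogDensity.contDiff_logPotential h.contDiff_inv).contDiffAt.of_le ENat.LEInfty.out) hV.1,
    h.isLogDensity.laplacian_logPotential (h.contDiff_inv.of_le ENat.LEInfty.out),
    hV.2.self_of_nhds, Pi.zero_apply, sub_zero]

theorem eventually_excess_le_circleAverage (h : IsInjectionFlow κ Ω b) (ht : t ∈ Ioo 0 b)
    (hz : z ≠ 0) :
    ∀ᶠ r in 𝓝[>] (0 : ℝ), excess κ Ω t z ≤ Real.circleAverage (excess κ Ω t) z r := by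
  have heq : excess κ Ω t = fun w =>
      logPotential ((Ω t).indicator fun z => (κ z)⁻¹) w + -t * Real.log (‖w‖ ^ 2) := by
    ext w
    rw [excess, neg_mul, sub_eq_add_neg]
  rw [heq]
  exact (h.isLogDensity_indicator ht).eventually_logPotential_add_le_circleAverage
    ((harmonicAt_log_norm_sq hz).const_smul (c := -t))

/-- A component of `Ω_t` not containing the origin would be one on which the excess, being
subharmonic, vanishes; but its Laplacian does not. -/
theorem zero_mem_connectedComponentIn (h : IsInjectionFlow κ Ω b) (ht : t ∈ Ioo 0 b)
    (hz : z ∈ Ω t) : 0 ∈ connectedComponentIn (Ω t) z := by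
  by_contra h0
  set D := connectedComponentIn (Ω t) z
  have hDo : IsOpen D := (h.isOpen ht).connectedComponentIn
  have hDΩ : D ⊆ Ω t := connectedComponentIn_subset _ _
  have hfr : frontier D ⊆ (Ω t)ᶜ := frontier_connectedComponentIn_subset_compl (h.isOpen ht) z
  have hne : ∀ w ∈ closure D, w ≠ 0 := by
    rintro w hw rfl
    exact hfr (hDo.frontier_eq ▸ ⟨hw, h0⟩) (h.zero_mem t ht)
  have hle : ∀ w ∈ closure D, excess κ Ω t w ≤ 0 :=
    nonpos_of_submean ((h.isCompact_closure ht).of_isClosed_subset isClosed_closure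
      (closure_mono hDΩ)) (fun w hw => (h.continuousAt_excess ht (hne w hw)).continuousWithinAt)
      (fun w hw _ => h.eventually_excess_le_circleAverage ht (hne w (interior_subset hw)))
      fun w hw => (h.excess_eq_zero ht (hfr (frontier_closure_subset hw))).le
  have hzero : excess κ Ω t =ᶠ[𝓝 z] fun _ => 0 := by
    filter_upwards [hDo.mem_nhds (mem_connectedComponentIn hz)] with w hw
    exact (hle w (subset_closure hw)).antisymm (h.excess_nonneg ht (hne w (subset_closure hw)))
  have hΔ := h.laplacian_excess ht hz (hne z (subset_closure (mem_connectedComponentIn hz)))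
  rw [(InnerProductSpace.laplacian_congr_nhds hzero).self_of_nhds,
    (InnerProductSpace.harmonicAt_const (0 : ℝ)).2.self_of_nhds] at hΔ
  have hκ := inv_pos.2 (h.pos z)
  exact absurd hΔ (by positivity)

theorem tendsto_excess_sub_excess (h : IsInjectionFlow κ Ω b) (hs : s ∈ Ioo 0 b)
    (ht : t ∈ Ioo 0 b) (hst : s < t) :
    Tendsto (fun z => excess κ Ω t z - excess κ Ω s z) (𝓝[≠] 0) atTop := by
  have hcont : Continuous fun z => logPotential ((Ω t).indicator fun z => (κ z)⁻¹) z -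
      logPotential ((Ω s).indicator fun z => (κ z)⁻¹) z :=
    (h.isLogDensity_indicator ht).continuous_logPotential.sub
      (h.isLogDensity_indicator hs).continuous_logPotential
  refine (((hcont.tendsto 0).mono_left nhdsWithin_le_nhds).add_atTop
    (tendsto_log_norm_sq_nhdsNE_zero.const_mul_atBot_of_neg (sub_neg.2 hst))).congr fun z => ?_
  rw [excess, excess]
  ring

theorem excess_pos (h : IsInjectionFlow κ Ω b) (ht : t ∈ Ioo 0 b) (hz : z ∈ Ω t) (hz0 : z ≠ 0) :
    0 < excess κ Ω t z := by
  have hzf : z ∉ frontier (Ω t) := fun hzf => ((h.isOpen ht).frontier_eq ▸ hzf).2 hz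
  obtain ⟨K, hK, hKt⟩ := h.smoothFamily.eventually_subset_or_disjoint ht ⟨z, hz⟩ hzf
  obtain ⟨s, hs, hst⟩ := ((hKt.filter_mono (nhdsWithin_le_nhds (s := Iio t))).and
    (Ioo_mem_nhdsLT ht.1)).exists
  have hzs : z ∈ Ω s := hs.1 hz (mem_of_mem_nhds hK)
  have hst' : s ∈ Ioc 0 t := Ioo_subset_Ioc_self hst
  have hs' : s ∈ Ioo 0 b := Ioc_subset ht hst'
  set D := connectedComponentIn (Ω s) z
  have hDs : D ⊆ Ω s := connectedComponentIn_subset _ _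
  have hharm : ∀ w ∈ D, w ≠ 0 →
      InnerProductSpace.HarmonicAt (fun w => excess κ Ω t w - excess κ Ω s w) w := by
    intro w hw hw0
    simp only [h.excess_eq ht, h.excess_eq hs', Pi.sub_apply, sub_sub_sub_cancel_left]
    exact (h.harmonicAt_extremalPotential hs' (hDs hw) hw0).sub
      (h.harmonicAt_extremalPotential ht (h.subset ht hst' (hDs hw)) hw0)
  have hpos : 0 < excess κ Ω t z - excess κ Ω s z :=
    pos_of_harmonicAt_of_tendsto_atTop (h.isOpen hs').connectedComponentIn
      isPreconnected_connectedComponentIn (h.zero_mem_connectedComponentIn hs' hzs) hharm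
      (fun w _ hw0 => sub_nonneg.2 (h.excess_mono ht hst' hw0))
      (h.tendsto_excess_sub_excess hs' ht hst.2) (mem_connectedComponentIn hzs) hz0
  exact (h.excess_nonneg hs' hz0).trans_lt (sub_pos.1 hpos)

end IsInjectionFlow

/-! ### The envelope -/

theorem IsSubharmonic.le_of_eventually_le {u : ℂ → EReal} (hu : IsSubharmonic u) {K : Set ℂ}
    (hK : IsCompact K) {a : ℂ} {f : ℂ → ℝ} (hf : ContinuousOn f (K \ {a}))
    (hharm : ∀ z ∈ interior K, z ≠ a → InnerProductSpace.HarmonicAt f z)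
    (ha : ∀ᶠ z in 𝓝[≠] a, u z ≤ f z) (hfr : ∀ z ∈ frontier K, z ≠ a → u z ≤ f z) {z : ℂ}
    (hz : z ∈ K) (hza : z ≠ a) : u z ≤ f z := by
  obtain ⟨r, ⟨hr, hrz⟩, hr0⟩ :=
    (((eventually_closedBall_subset (eventually_nhdsWithin_iff.1 ha)).and
      (eventually_le_nhds (dist_pos.2 hza))).filter_mono nhdsWithin_le_nhds |>.and
        (self_mem_nhdsWithin (s := Ioi (0 : ℝ)))).exists
  have hne : ∀ w ∈ K \ Metric.ball a r, w ≠ a := by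
    rintro w hw rfl
    exact hw.2 (Metric.mem_ball_self hr0)
  refine hu.le_of_le_frontier _ f (hK.diff Metric.isOpen_ball)
    (hf.mono fun w hw => ⟨hw.1, hne w hw⟩)
    (fun w hw => hharm w (interior_mono sdiff_subset hw) (hne w (interior_subset hw)))
    (fun w hw => ?_) z ⟨hz, fun hzr => (Metric.mem_ball.1 hzr).not_ge hrz⟩
  have hwa : w ≠ a := hne w ((hK.diff Metric.isOpen_ball).isClosed.frontier_subset hw)
  rw [sdiff_eq, frontier] at hw
  rcases frontier_inter_subset _ _ hw with hw | hw
  · exact hfr w hw.1 hwa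
  · rw [frontier_compl, frontier_ball a hr0.ne'] at hw
    exact hr (Metric.sphere_subset_closedBall hw.2) hwa

section Candidate

variable {g φ : ℂ → ℝ} {t : ℝ} {ψ : ℂ → EReal}

theorem LelongGE.exists_add_le (hψ : LelongGE ψ t) (hg : ContinuousAt g 0) :
    ∃ C : ℝ, ∀ᶠ z in 𝓝[≠] (0 : ℂ),
      (g z : EReal) + ψ z ≤ ((t * Real.log (‖z‖ ^ 2) + C : ℝ) : EReal) := by
  obtain ⟨C, hC⟩ := hψ
  refine ⟨g 0 + 1 + C, ?_⟩
  filter_upwards [hC, nhdsWithin_le_nhds (hg.eventually_lt_const (lt_add_one _))] with z hz hgz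
  refine (add_le_add (EReal.coe_le_coe_iff.2 hgz.le) hz).trans ?_
  rw [← EReal.coe_add, EReal.coe_le_coe_iff]
  linarith

namespace IsCandidate

theorem eq_bot_at_zero (hψ : IsCandidate g φ t ψ) (hg : ContinuousAt g 0) (ht : 0 < t) :
    ψ 0 = ⊥ := by
  obtain ⟨C, hC⟩ := hψ.lelong.exists_add_le hg
  have hbound : ∀ c : ℝ, (g 0 : EReal) + ψ 0 ≤ c := fun c => by
    have hlog := (tendsto_log_norm_sq_nhdsNE_zero (E := ℂ)).eventually_lt_atBot ((c - C) / t)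
    have hle : ∀ᶠ w in 𝓝[≠] (0 : ℂ), (g w : EReal) + ψ w ≤ c := by
      filter_upwards [hC, hlog] with w hw hwc
      rw [lt_div_iff₀' ht] at hwc
      exact hw.trans (EReal.coe_le_coe_iff.2 (by linarith))
    obtain ⟨r, hr, hr0⟩ := (((eventually_closedBall_subset
      (eventually_nhdsWithin_iff.1 hle)).filter_mono nhdsWithin_le_nhds).and
        (self_mem_nhdsWithin (s := Ioi (0 : ℝ)))).exists
    refine hψ.subharmonic.le_of_le_frontier (Metric.closedBall 0 r) (fun _ => c)
      (isCompact_closedBall _ _) continuousOn_const (InnerProductSpace.harmonicOnNhd_const c)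
      (fun w hw => ?_) 0 (Metric.mem_closedBall_self (le_of_lt hr0))
    rw [frontier_closedBall _ (ne_of_gt hr0)] at hw
    exact hr (Metric.sphere_subset_closedBall hw) (Metric.ne_of_mem_sphere hw (ne_of_gt hr0))
  by_contra hbot
  obtain ⟨x, hx⟩ : ∃ x : ℝ, ψ 0 = x := ⟨(ψ 0).toReal,
    (EReal.coe_toReal ((hψ.le 0).trans_lt (EReal.coe_lt_top _)).ne hbot).symm⟩
  have hlt := hbound (g 0 + x - 1)
  rw [hx, ← EReal.coe_add, EReal.coe_le_coe_iff] at hlt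
  linarith

/-- A multiple `η` of the Green function of a large disc dominates the error `O(1)` at the pole. -/
theorem eventually_add_le (hψ : IsCandidate g φ t ψ) (hg : ContinuousAt g 0) {P : ℂ → ℝ}
    (hP : ContinuousAt P 0) {η : ℝ} (hη : 0 < η) (L : ℝ) : ∀ᶠ z in 𝓝[≠] (0 : ℂ),
      (g z : EReal) + ψ z ≤ ((P z + t * Real.log (‖z‖ ^ 2) +
        η * (L - Real.log (‖z‖ ^ 2)) : ℝ) : EReal) := by
  obtain ⟨C, hC⟩ := hψ.lelong.exists_add_le hg
  have hP' : ∀ᶠ z in 𝓝[≠] (0 : ℂ), P 0 - 1 < P z :=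
    nhdsWithin_le_nhds (hP.eventually_const_lt (sub_one_lt _))
  have hlog := (tendsto_log_norm_sq_nhdsNE_zero (E := ℂ)).eventually_lt_atBot
    (L - (C - (P 0 - 1)) / η)
  filter_upwards [hC, hP', hlog] with z hz hPz hlogz
  rw [lt_sub_comm, div_lt_iff₀' hη] at hlogz
  exact hz.trans (EReal.coe_le_coe_iff.2 (by linarith))

end IsCandidate

end Candidate

theorem contDiff_fsPotential : ContDiff ℝ ∞ fsPotential :=
  (contDiff_const.add (contDiff_norm_sq ℝ)).log fun z => by positivity

theorem fsPotential_add_potential (κ : ℂ → ℝ) :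
    fsPotential + potential κ = logPotential fun z => (κ z)⁻¹ := by
  ext z
  simp only [Pi.add_apply, potential, logPotential, fsPotential, div_eq_mul_inv, add_sub_cancel]

/-- The upper semicontinuous representative of `φ - Q_t`, with the value `-∞` at the origin. -/
def extremalCandidate (κ : ℂ → ℝ) (Ω : ℝ → Set ℂ) (t : ℝ) : ℂ → EReal :=
  Function.update (fun z => ((potential κ z - excess κ Ω t z : ℝ) : EReal)) 0 ⊥

namespace IsInjectionFlow

variable {κ : ℂ → ℝ} {Ω : ℝ → Set ℂ} {b t : ℝ} {z : ℂ} {ψ : ℂ → EReal}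

theorem contDiff_potential (h : IsInjectionFlow κ Ω b) : ContDiff ℝ ∞ (potential κ) := by
  rw [eq_sub_of_add_eq' (fsPotential_add_potential κ)]
  exact (h.isLogDensity.contDiff_logPotential h.contDiff_inv).sub contDiff_fsPotential

theorem ddcDensity_eq (h : IsInjectionFlow κ Ω b) (z : ℂ) :
    ddcDensity (fun w => fsPotential w + potential κ w) z = (κ z)⁻¹ := by
  have hΔ : Δ (fun w => fsPotential w + potential κ w) z = 4 * Real.pi * (κ z)⁻¹ := by
    rw [← h.isLogDensity.laplacian_logPotential (h.contDiff_inv.of_le ENat.LEInfty.out),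
      ← fsPotential_add_potential]
    rfl
  rw [ddcDensity, hΔ, one_div, inv_mul_cancel_left₀ (by positivity)]

theorem time_le_integral_inv (h : IsInjectionFlow κ Ω b) (ht : t ∈ Ioo 0 b) :
    t ≤ ∫ z, (κ z)⁻¹ := by
  have hmass : ∫ z in Ω t, (κ z)⁻¹ = t := by
    simpa only [one_div, mul_one] using h.setIntegral_eq_of_harmonicOnNhd ht isOpen_univ
      (subset_univ _) (InnerProductSpace.harmonicOnNhd_const 1)
  exact hmass.ge.trans (setIntegral_le_integral h.isLogDensity.integrable
    (Eventually.of_forall h.isLogDensity.nonneg))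

theorem ofReal_le_lintegral (h : IsInjectionFlow κ Ω b) :
    ENNReal.ofReal b ≤
      ∫⁻ z : ℂ, ENNReal.ofReal (ddcDensity (fun w => fsPotential w + potential κ w) z) := by
  simp_rw [h.ddcDensity_eq]
  rw [← ofReal_integral_eq_lintegral_ofReal h.isLogDensity.integrable
    (Eventually.of_forall h.isLogDensity.nonneg)]
  refine ENNReal.ofReal_le_ofReal (le_of_not_gt fun hlt => ?_)
  obtain ⟨t, hκt, htb⟩ := exists_between hlt
  have ht0 : 0 < t := (integral_nonneg h.isLogDensity.nonneg).trans_lt hκt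
  exact hκt.not_ge (h.time_le_integral_inv ⟨ht0, htb⟩)

theorem fsPotential_add_potential_sub_excess (h : IsInjectionFlow κ Ω b) (ht : t ∈ Ioo 0 b)
    (z : ℂ) : fsPotential z + (potential κ z - excess κ Ω t z) = extremalPotential κ Ω t z := by
  rw [← add_sub_assoc, ← Pi.add_apply fsPotential, fsPotential_add_potential, h.excess_eq ht,
    Pi.sub_apply, sub_sub_cancel]

theorem tendsto_extremalPotential (h : IsInjectionFlow κ Ω b) (ht : t ∈ Ioo 0 b) :
    Tendsto (extremalPotential κ Ω t) (𝓝[≠] 0) atBot :=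
  (((h.isLogDensity_indicator_compl ht).continuous_logPotential.tendsto 0).mono_left
    nhdsWithin_le_nhds).add_atBot (tendsto_log_norm_sq_nhdsNE_zero.const_mul_atBot ht.1)

theorem upperSemicontinuous_extremalCandidate (h : IsInjectionFlow κ Ω b) (ht : t ∈ Ioo 0 b) :
    UpperSemicontinuous (extremalCandidate κ Ω t) := by
  refine upperSemicontinuous_update_bot (fun z hz =>
    h.contDiff_potential.continuous.continuousAt.sub (h.continuousAt_excess ht hz)) ?_
  simp_rw [fun z => eq_sub_of_add_eq' (h.fsPotential_add_potential_sub_excess ht z), sub_eq_neg_add]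
  exact ((contDiff_fsPotential.continuous.neg.tendsto 0).mono_left nhdsWithin_le_nhds).add_atBot
    (h.tendsto_extremalPotential ht)

theorem fsPotential_add_extremalCandidate (h : IsInjectionFlow κ Ω b) (ht : t ∈ Ioo 0 b) :
    (fun z => (fsPotential z : EReal) + extremalCandidate κ Ω t z) =
      Function.update (fun z => (extremalPotential κ Ω t z : EReal)) 0 ⊥ := by
  ext z
  rcases eq_or_ne z 0 with rfl | hz
  · simp only [extremalCandidate, Function.update_self, EReal.add_bot]
  · rw [extremalCandidate, Function.update_of_ne hz, Function.update_of_ne hz, ← EReal.coe_add,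
      h.fsPotential_add_potential_sub_excess ht]

theorem lelongGE_extremalCandidate (h : IsInjectionFlow κ Ω b) (ht : t ∈ Ioo 0 b) :
    LelongGE (extremalCandidate κ Ω t) t := by
  set P := fun z => logPotential ((Ω t)ᶜ.indicator fun z => (κ z)⁻¹) z - fsPotential z
  have hP : Continuous P :=
    (h.isLogDensity_indicator_compl ht).continuous_logPotential.sub contDiff_fsPotential.continuous
  refine ⟨P 0 + 1, ?_⟩
  filter_upwards [nhdsWithin_le_nhds ((hP.tendsto 0).eventually_lt_const (lt_add_one _)),
    self_mem_nhdsWithin] with z hz hz0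
  rw [extremalCandidate, Function.update_of_ne hz0, EReal.coe_le_coe_iff,
    eq_sub_of_add_eq' (h.fsPotential_add_potential_sub_excess ht z), extremalPotential]
  linarith

theorem isCandidate_extremalCandidate (h : IsInjectionFlow κ Ω b) (ht : t ∈ Ioo 0 b) :
    IsCandidate fsPotential (potential κ) t (extremalCandidate κ Ω t) where
  usc := h.upperSemicontinuous_extremalCandidate ht
  le z := by
    rcases eq_or_ne z 0 with rfl | hz
    · rw [extremalCandidate, Function.update_self]
      exact bot_le
    · rw [extremalCandidate, Function.update_of_ne hz, EReal.coe_le_coe_iff]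
      exact sub_le_self _ (h.excess_nonneg ht hz)
  subharmonic := by
    rw [h.fsPotential_add_extremalCandidate ht]
    exact isSubharmonic_update_bot (fun z hz => h.continuousAt_extremalPotential ht hz)
      (h.tendsto_extremalPotential ht) fun z hz =>
        (h.isLogDensity_indicator_compl ht).eventually_logPotential_add_le_circleAverage
          ((harmonicAt_log_norm_sq hz).const_smul (c := t))
  lelong := h.lelongGE_extremalCandidate ht

theorem add_le_extremalPotential_add (h : IsInjectionFlow κ Ω b) (ht : t ∈ Ioo 0 b)
    (hψ : IsCandidate fsPotential (potential κ) t ψ) {R η : ℝ}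
    (hR : closure (Ω t) ⊆ Metric.closedBall 0 R) (hη : 0 < η) (hz : z ∈ closure (Ω t))
    (hz0 : z ≠ 0) : (fsPotential z : EReal) + ψ z ≤
      ((extremalPotential κ Ω t z + η * (Real.log (R ^ 2) - Real.log (‖z‖ ^ 2)) : ℝ) : EReal) := by
  refine hψ.subharmonic.le_of_eventually_le (h.isCompact_closure ht) (a := 0)
    (f := fun w => extremalPotential κ Ω t w + η * (Real.log (R ^ 2) - Real.log (‖w‖ ^ 2)))
    (fun w hw => ((h.continuousAt_extremalPotential ht hw.2).add (continuousAt_const.mul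
      (continuousAt_const.sub (continuousAt_log_norm_sq hw.2)))).continuousWithinAt)
    (fun w hw hw0 => (h.harmonicAt_extremalPotential ht
      (h.smoothFamily.interior_closure_subset ht hw) hw0).add
        (((InnerProductSpace.harmonicAt_const (Real.log (R ^ 2))).sub
          (harmonicAt_log_norm_sq hw0)).const_smul (c := η)))
    (hψ.eventually_add_le contDiff_fsPotential.continuous.continuousAt
      (h.isLogDensity_indicator_compl ht).continuous_logPotential.continuousAt hη _)
    (fun w hw hw0 => ?_) hz hz0
  have hwΩ : w ∉ Ω t := ((h.isOpen ht).frontier_eq ▸ frontier_closure_subset hw).2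
  have hwR : ‖w‖ ≤ R := mem_closedBall_zero_iff.1 (hR (isClosed_closure.frontier_subset hw))
  have hlog : Real.log (‖w‖ ^ 2) ≤ Real.log (R ^ 2) :=
    Real.log_le_log (pow_pos (norm_pos_iff.2 hw0) 2) (by gcongr)
  refine (add_le_add le_rfl (hψ.le w)).trans ?_
  rw [← EReal.coe_add, EReal.coe_le_coe_iff, ← h.fsPotential_add_potential_sub_excess ht,
    h.excess_eq_zero ht hwΩ, sub_zero]
  exact le_add_of_nonneg_right (mul_nonneg hη.le (sub_nonneg.2 hlog))

theorem add_le_extremalPotential (h : IsInjectionFlow κ Ω b) (ht : t ∈ Ioo 0 b)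
    (hψ : IsCandidate fsPotential (potential κ) t ψ) (hz : z ∈ closure (Ω t)) (hz0 : z ≠ 0) :
    (fsPotential z : EReal) + ψ z ≤ (extremalPotential κ Ω t z : EReal) := by
  obtain ⟨R, hR⟩ := (h.isCompact_closure ht).isBounded.subset_closedBall (0 : ℂ)
  have hlim : Tendsto (fun η : ℝ => ((extremalPotential κ Ω t z +
      η * (Real.log (R ^ 2) - Real.log (‖z‖ ^ 2)) : ℝ) : EReal)) (𝓝[>] 0)
      (𝓝 (extremalPotential κ Ω t z : EReal)) :=
    tendsto_nhdsWithin_of_tendsto_nhds <| Continuous.tendsto'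
      (continuous_coe_real_ereal.comp (by fun_prop)) _ _ (by simp)
  refine ge_of_tendsto hlim ?_
  filter_upwards [self_mem_nhdsWithin] with η hη
  exact h.add_le_extremalPotential_add ht hψ hR hη hz hz0

theorem envelope_eq (h : IsInjectionFlow κ Ω b) (ht : t ∈ Ioo 0 b) :
    envelope fsPotential (potential κ) t = extremalCandidate κ Ω t := by
  ext z
  refine le_antisymm (iSup₂_le fun ψ hψ => ?_)
    (le_iSup₂_of_le _ (h.isCandidate_extremalCandidate ht) le_rfl)
  rcases eq_or_ne z 0 with rfl | hz0
  · rw [hψ.eq_bot_at_zero contDiff_fsPotential.continuous.continuousAt ht.1]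
    exact bot_le
  rw [extremalCandidate, Function.update_of_ne hz0]
  by_cases hz : z ∈ Ω t
  · have hle := h.add_le_extremalPotential ht hψ (subset_closure hz) hz0
    rw [← h.fsPotential_add_potential_sub_excess ht, EReal.coe_add] at hle
    exact EReal.addLECancellable_coe _ hle
  · rw [h.excess_eq_zero ht hz, sub_zero]
    exact hψ.le z

theorem eq_domain (h : IsInjectionFlow κ Ω b) (ht : t ∈ Ioo 0 b) :
    Ω t = domain fsPotential (potential κ) t := by
  ext z
  rw [domain, mem_ofPred_eq, h.envelope_eq ht]
  rcases eq_or_ne z 0 with rfl | hz0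
  · rw [extremalCandidate, Function.update_self]
    exact iff_of_true (h.zero_mem t ht) (EReal.bot_lt_coe _)
  · rw [extremalCandidate, Function.update_of_ne hz0, EReal.coe_lt_coe_iff, sub_lt_self_iff]
    refine ⟨fun hz => h.excess_pos ht hz hz0, fun hpos => ?_⟩
    by_contra hz
    exact hpos.ne' (h.excess_eq_zero ht hz)

end IsInjectionFlow

end HeleShaw

end

theorem proposition2p7_general (κ : ℂ → ℝ) (hκ : ContDiff ℝ ∞ κ) (hκ_pos : ∀ z, 0 < κ z)
    (hκ_int : ∀ z : ℂ, Integrable (fun ζ : ℂ => Real.log (‖z - ζ‖ ^ 2) / κ ζ))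
    (Ω : ℝ → Set ℂ) (b : ℝ)
    (hsmooth : HeleShaw.IsSmoothFamily Ω 0 b)
    (hzero : ∀ t ∈ Ioo 0 b, (0 : ℂ) ∈ Ω t)
    (hmono : MonotoneOn Ω (Ioo 0 b))
    (hstrong : HeleShaw.IsStrongHeleShawFlow κ Ω 0 b)
    (hlim : ∀ U ∈ 𝓝 (0 : ℂ), ∀ᶠ t in 𝓝[>] (0 : ℝ), Ω t ⊆ U) :
    HeleShaw.IsHeleShawFlow HeleShaw.fsPotential (HeleShaw.potential κ) Ω b := by
  have h : HeleShaw.IsInjectionFlow κ Ω b :=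
    ⟨hκ, hκ_pos, hκ_int, hsmooth, hzero, hmono, hstrong, hlim⟩
  exact ⟨h.contDiff_potential, fun z => by rw [h.ddcDensity_eq]; exact inv_pos.2 (hκ_pos z),
    h.ofReal_le_lintegral, fun t ht => h.eq_domain ht⟩

theorem proposition2p7 (κ : ℂ → ℝ) (hκ : ContDiff ℝ ∞ κ) (hκ_pos : ∀ z, 0 < κ z)
    (hκ_int : ∀ z : ℂ, Integrable (fun ζ : ℂ => Real.log (‖z - ζ‖ ^ 2) / κ ζ))
    (Ω : ℝ → Set ℂ) (b : ℝ)
    (hsmooth : HeleShaw.IsSmoothFamily Ω 0 b)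
    (hsc : ∀ t ∈ Ioo 0 b, IsSimplyConnected (Ω t))
    (hzero : ∀ t ∈ Ioo 0 b, (0 : ℂ) ∈ Ω t)
    (hmono : StrictMonoOn Ω (Ioo 0 b))
    (hstrong : HeleShaw.IsStrongHeleShawFlow κ Ω 0 b)
    (hlim : ∀ U ∈ 𝓝 (0 : ℂ), ∀ᶠ t in 𝓝[>] (0 : ℝ), Ω t ⊆ U) :
    HeleShaw.IsHeleShawFlow HeleShaw.fsPotential (HeleShaw.potential κ) Ω b := by
  exact proposition2p7_general κ hκ hκ_pos hκ_int Ω b hsmooth hzero hmono.monotoneOn hstrong hlim
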